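/- **Setting.** Let $K$ be a field of characteristic $p>0$, $\nu:K^*\to\Gamma$ a non-trivial valuation with values in an archimedean ordered abelian group $\Gamma$ (real rank 1), $L=K[x]$ a finite separable extension of $K$, $\nu'$ an extension of $\nu$ to $L$ with values in $\Gamma$, and $f=X^n+a_{n-1}X^{n-1}+\dots+a_0$ the minimal polynomial of $x$; assume $\nu(a_i)>0$ for $i<n$. For $h\in K[X]$ put $\nu'(h):=\nu'(h(x))\in\Gamma\cup\{\infty\}$; $\mathrm{in}\,h$ denotes the class of $h$ in $\mathbf P'_{\nu'(h)}/\mathbf P'_{\nu'(h)+}\subset G_{\nu'}$, where $\mathbf P'_{\beta}=\{\nu'\ge\beta\}$, $\mathbf P'_{\beta+}=\{\nu'>\beta\}$ and $G_{\nu'}=\bigoplus_\beta\mathbf P'_\beta/\mathbf P'_{\beta+}$; $G_\nu$ is defined likewise. **Standard expansions.** Let $Q_i\in K[X]$ (monic) and integers $\alpha_i\ge1$ be given for ordinals $i\le l$ (indices start at $0$), with $\deg Q_i=\prod_{j\le i}\alpha_j$. An index $i<l$ is $l$-essential if there is an integer $t>0$ with $i+t=l$, or with $i+t<l$ and $\alpha_{i+t}>1$;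 put $i+:=i+1$ if $i$ is $l$-essential and $i+:=i+\omega$ otherwise. An $l$-standard monomial not involving $Q_l$ is a product $c\prod_{i<l}Q_i^{\gamma_i}$, $c\in K$, with almost all $\gamma_i=0$, $\gamma_i<\alpha_{i+}$, degree $\sum\gamma_i\deg Q_i\le n$, and such that for each $l$-inessential $i$ at most one $j<i+$ with $j+=i+$ has $\gamma_j\ne0$. A homogeneous $l$-standard expansion of value $\beta\in\Gamma$, not involving $Q_l$, is a finite sum $S$ of such monomials, all of value $\beta$, the sum of whose initial forms is non-zero (i.e. $\nu'(S)=\beta$). An $l$-standard expansion not involving $Q_l$ is a finite (possibly empty) sum of such $S$ with distinct values $\beta$. An $l$-standard expansion of $h\in K[X]$ is an expression $h=\sum_j c_jQ_l^j$ with every $c_j$ an $l$-standard expansion not involving $Q_l$; it is weakly affine if $c_j=0$ for every $j>0$ that is not a power of $p$ (with $1=p^0$ a power of $p$). **Newton polygons.** For $P$ monic write $f=\sum_j d_jP^j$ with $\deg d_j<\deg P$. Let $\delta_l$ be the largest $j$ at which $\min_j(\nu'(d_j)+j\nu'(Q_l))$ is attained, for $P=Q_l$; put $\beta_l=\nu'(Q_l)$.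 For $P=Q_l+z_l+\dots+z_{i}$ as below and $\delta=\delta_l$, the characteristic side $A(P)$ is the side with upper endpoint $(\nu'(d_\delta),\delta)$, its slope is determined by $\beta(P)=\min_{j<\delta}(\nu'(d_j)-\nu'(d_\delta))/(\delta-j)$, and $\mathrm{in}_{A(P)}f$ is the sum of the terms $\mathrm{in}(d_j)\bar P^j$, $j\le\delta$, lying on $A(P)$. **Construction of the key polynomials.** $Q_0=X$, $\alpha_0=1$. Suppose that $Q_i,\alpha_i$ $(i\le l)$ are constructed, $\beta_l\neq\infty$. The step at $l$ is *special* if $\mathrm{in}_lf=\mathrm{in}(d_\delta)(\bar Q_l+\mathrm{in}\,z)^{\delta}$ for some homogeneous $l$-standard expansion $z$ of value $\beta_l$ not involving $Q_l$, where $\delta=\delta_l$ and $\mathrm{in}_lf$ is the sum of the terms $\mathrm{in}(d_j)\bar Q_l^j$ at which the above minimum is attained. (a) If the step is not special (or if $l=0$), one may take $Q_{l+1}=Q_l^{\alpha_{l+1}}+\sum_{j<\alpha_{l+1}}c_jQ_l^j$, a lifting of the minimal polynomial of $\mathrm{in}\,Q_l$, of degree $\alpha_{l+1}$, over $G_\nu[\mathrm{in}\,Q_i:i<l]$: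 each $c_j$ is $0$ or a homogeneous $l$-standard expansion of value $(\alpha_{l+1}-j)\beta_l$ not involving $Q_l$. The construction then continues at $l+1$. (b) If the step is special, let $T$ be the set of expansions $Q'=Q_l+z_l+z_{l+1}+\dots+z_i$ (with $i=l+t$, $t\in\mathbb N$), the $z_j$ being homogeneous $l$-standard expansions not involving $Q_l$ with $\beta_l=\nu'(z_l)<\nu'(z_{l+1})<\dots<\nu'(z_i)<\beta(Q')$ and $\mathrm{in}_{A(Q'_j)}f=\mathrm{in}(d_\delta)(\bar Q'_j+\mathrm{in}\,z_j)^\delta$ for $l\le j<i$, where $Q'_j=Q_l+z_l+\dots+z_{j-1}$, $\delta=\delta_l$, and $d_\delta$ is the coefficient for $P=Q'_j$. Order $T$ by prolongation. *Case 1:* if $T$ has a maximal element, one such element $Q_l+z_l+\dots+z_{s-1}$ is chosen, $Q_i=Q_l+z_l+\dots+z_{i-1}$ and $\alpha_i=1$ for $l<i\le s$, and the construction continues at $s$. *Case 2b:* $T$ has no maximal element and the set of values $\{\nu'(Q'):Q'\in T\}$ has a least upper bound $\bar\beta\in\Gamma$, which is not attained. Then an infinite sequence $z_l,z_{l+1},\dots$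 is chosen with $Q_l+z_l+\dots+z_{l+t}\in T$ for all $t\in\mathbb N$ and with the values $\nu'(Q_l+z_l+\dots+z_{l+t})$ increasing to $\bar\beta$; one puts $Q_{l+t}=Q_l+z_l+\dots+z_{l+t-1}$ for $t\in\mathbb N$ and $\alpha_{l+t}=1$ for $t>0$. Write $\delta_l=p^eu$ with $p\nmid u$. A *limit key polynomial* $Q_{l+\omega}$ is a polynomial which, for some $i\in\{l+t\mid t\in\mathbb N\}$ and some integer $e_0$ with $0<e_0\le e$, is a weakly affine $i$-standard expansion, monic of degree $p^{e_0}$ in $Q_i$, with $$\bar\beta\le\frac1{p^{e_0}}\,\nu'(Q_{l+\omega}),$$ and for which $e_0$ is the least possible. One puts $\alpha_{l+\omega}=p^{e_0}$, and the construction continues at $l+\omega$. **Proposition.** Suppose that the $Q_i$, $\alpha_i$ with $i\le l$ have been constructed in this way and that, as is assumed inductively in the construction, for every $i\le l$ the polynomial $f$ and every polynomial of degree $<n$ (i.e. every element of $L$) admit an $i$-standard expansion. Suppose that we are in Case 2b at $l$, with $Q_{l+t}$ $(t\in\mathbb N)$ and $\bar\beta$ as there. Then there exist $i\in\{l+t\mid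 t\in\mathbb N\}$, an integer $e_0$ with $0<e_0\le e$, and a weakly affine $i$-standard expansion $Q_{l+\omega}$, monic of degree $p^{e_0}$ in $Q_i$, such that $\bar\beta\le\frac1{p^{e_0}}\nu'(Q_{l+\omega})$. Taken with $e_0$ minimal, it is a limit key polynomial. -/

import Mathlib

open Polynomial Ordinal

noncomputable section

namespace KeyPoly

/-- The value `ν'(h mod f) = ν'(h(x))` of a polynomial `h`, where `f` is the minimal polynomial
of `x`. -/
def polyVal {K L Γ : Type*} [Field K] [Field L] [Algebra K L] [AddCommGroup Γ] [LinearOrder Γ]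
    [IsOrderedAddMonoid Γ] (ν' : AddValuation L (WithTop Γ)) (x : L) (h : K[X]) : WithTop Γ :=
  ν' (aeval x h)

/-- A family of polynomials `Q_i` together with positive integers `α_i`, indexed by ordinals.
Indices start at `0`, so that `Q 0 = X`. -/
structure Family (K : Type*) [Field K] where
  Q : Ordinal.{0} → K[X]
  α : Ordinal.{0} → ℕ

section Standard

variable {K : Type*} [Field K] {Γ : Type*} [AddCommGroup Γ] [LinearOrder Γ]
  [IsOrderedAddMonoid Γ]

/-- The index `i < l` is `l`-essential. -/
def IsEssential (F : Family K) (l i : Ordinal.{0}) : Prop :=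
  ∃ t : ℕ, 0 < t ∧ (i + (t : Ordinal.{0}) = l ∨
    (i + (t : Ordinal.{0}) < l ∧ 1 < F.α (i + (t : Ordinal.{0}))))

open Classical in
/-- The index `i+`, relative to `l`. -/
def next (F : Family K) (l i : Ordinal.{0}) : Ordinal.{0} :=
  if IsEssential F l i then i + 1 else i + ω

/-- The monomial `a · ∏ Q_i ^ γ_i`. -/
def mon (F : Family K) (a : K) (γ : Ordinal.{0} →₀ ℕ) : K[X] :=
  C a * γ.prod fun i k => F.Q i ^ k

/-- The multi-index `γ = (γ_i)_{i ≤ l}` is standard with respect to `(α_i)_{i ≤ l}`; the bound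
`degree_le` is the bound on the degree in `x` (recall `deg Q_i = ∏_{j ≤ i} α_j`). -/
structure IsStandardIndex (F : Family K) (n : ℕ) (l : Ordinal.{0}) (γ : Ordinal.{0} →₀ ℕ) :
    Prop where
  support_le : ∀ i, γ i ≠ 0 → i ≤ l
  lt_next : ∀ i, i < l → γ i < F.α (next F l i)
  degree_le : (γ.sum fun i k => k * (F.Q i).natDegree) ≤ n
  tail : ∀ i, i < l → ¬ IsEssential F l i →
    {j | j < next F l i ∧ next F l j = next F l i ∧ γ j ≠ 0}.Subsingleton

/-- `m` is an `l`-standard monomial not involving `Q_l`. -/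
def IsStandardMonomial (F : Family K) (n : ℕ) (l : Ordinal.{0}) (m : K[X]) : Prop :=
  ∃ (a : K) (γ : Ordinal.{0} →₀ ℕ), IsStandardIndex F n l γ ∧ γ l = 0 ∧ m = mon F a γ

/-- `S` is a homogeneous `l`-standard expansion of value `β`, not involving `Q_l`: a finite sum of
`l`-standard monomials of value `β`, not involving `Q_l`, whose initial forms have non-zero sum in
`P'_β / P'_{β+}`, that is, `S` does not lie in `P'_{β+}`. -/
def IsHomogeneous (v : K[X] → WithTop Γ) (F : Family K) (n : ℕ) (l : Ordinal.{0}) (β : Γ)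
    (S : K[X]) : Prop :=
  ∃ s : Multiset K[X], (∀ m ∈ s, IsStandardMonomial F n l m ∧ v m = (β : WithTop Γ)) ∧
    S = s.sum ∧ ¬ (β : WithTop Γ) < v S

/-- `S` is an `l`-standard expansion not involving `Q_l`. -/
def IsExpansion (v : K[X] → WithTop Γ) (F : Family K) (n : ℕ) (l : Ordinal.{0}) (S : K[X]) :
    Prop :=
  ∃ (B : Finset Γ) (T : Γ → K[X]), (∀ β ∈ B, IsHomogeneous v F n l β (T β)) ∧
    S = ∑ β ∈ B, T β

/-- `g` admits an `l`-standard expansion `∑ c_j Q_l ^ j`. -/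
def HasStandardExpansion (v : K[X] → WithTop Γ) (F : Family K) (n : ℕ) (l : Ordinal.{0})
    (g : K[X]) : Prop :=
  ∃ (s : ℕ) (c : ℕ → K[X]), (∀ j ≤ s, IsExpansion v F n l (c j)) ∧
    g = ∑ j ∈ Finset.range (s + 1), c j * F.Q l ^ j

/-- `G = ∑_{j ≤ p ^ e₀} c_j Q_i ^ j` is a weakly affine `i`-standard expansion, monic of degree
`p ^ e₀` in `Q_i`. -/
def IsWeaklyAffine (v : K[X] → WithTop Γ) (F : Family K) (n p : ℕ) (i : Ordinal.{0}) (e₀ : ℕ)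
    (G : K[X]) : Prop :=
  ∃ c : ℕ → K[X], (∀ j ≤ p ^ e₀, IsExpansion v F n i (c j)) ∧
    c (p ^ e₀) = 1 ∧
    (∀ j ≤ p ^ e₀, 0 < j → (¬ ∃ k : ℕ, j = p ^ k) → c j = 0) ∧
    G = ∑ j ∈ Finset.range (p ^ e₀ + 1), c j * F.Q i ^ j

end Standard

section Newton

variable {K : Type*} [Field K] {Γ : Type*} [AddCommGroup Γ] [LinearOrder Γ]
  [IsOrderedAddMonoid Γ]

/-- The coefficient `d_j` in the expansion `h = ∑ d_j P ^ j`, `deg d_j < deg P`, with respect to a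
monic polynomial `P`. -/
def digit (P h : K[X]) (j : ℕ) : K[X] := (h /ₘ P ^ j) %ₘ P

/-- `min_j (ν'(d_j) + j ν'(P))`, where `h = ∑ d_j P ^ j`. For `P = Q_l` this is `ν_l(h)`. -/
def newtonMin (v : K[X] → WithTop Γ) (P h : K[X]) : WithTop Γ :=
  (Finset.range (h.natDegree + 1)).inf fun j => v (digit P h j) + j • v P

open Classical in
/-- The largest `j` at which the minimum `min_j (ν'(d_j) + j ν'(P))` is attained. For `P = Q_l`
this is `δ_l(h)`, the degree of `in_l h`. -/
def delta (v : K[X] → WithTop Γ) (P h : K[X]) : ℕ :=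
  ((Finset.range (h.natDegree + 1)).filter fun j =>
    v (digit P h j) + j • v P = newtonMin v P h).sup id

/-- `b < β(P)`, where `β(P)` determines the characteristic side of the Newton polygon of
`h = ∑ d_j P ^ j`, the one with upper endpoint `(ν'(d_δ), δ)`; that is,
`β(P) = min_{j < δ} (ν'(d_j) - ν'(d_δ)) / (δ - j)`. -/
def LtCharSlope (v : K[X] → WithTop Γ) (h : K[X]) (δ : ℕ) (P : K[X]) (b : WithTop Γ) : Prop :=
  ∀ j < δ, v (digit P h δ) + δ • b < v (digit P h j) + j • b

/-- The initial form of `h = ∑ d_j P ^ j` along the side with upper endpoint `(ν'(d_δ), δ)` is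
`in(d_δ) (P̄ + in(z)) ^ δ`. The side is then the one determined by `b = ν'(z)`, and the equality
is written coefficient by coefficient: for `j < δ` the coefficient of `P̄ ^ j` on the left, which is
the class of `d_j` in degree `ν'(d_δ) + (δ - j) b`, is the class of
`(δ choose j) d_δ z ^ (δ - j)`. -/
def InitIsPower (v : K[X] → WithTop Γ) (h : K[X]) (δ : ℕ) (P z : K[X]) : Prop :=
  ∀ j < δ, v (digit P h δ) + δ • v z <
    v (digit P h j - (δ.choose j : K[X]) * digit P h δ * z ^ (δ - j)) + j • v z

end Newton

section Construction

variable {K : Type*} [Field K] {Γ : Type*} [AddCommGroup Γ] [LinearOrder Γ]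
  [IsOrderedAddMonoid Γ]

/-- The step from `Q_l` is special (`t = α_{l+1} = 1`): `in_l f` is a unit times a power of one
monic linear polynomial `Q̄_l + in(z)` over `G_ν[in Q_i : i < l]`. -/
def IsSpecial (v : K[X] → WithTop Γ) (f : K[X]) (F : Family K) (l : Ordinal.{0}) : Prop :=
  ∃ (β : Γ) (z : K[X]), v (F.Q l) = (β : WithTop Γ) ∧ IsHomogeneous v F f.natDegree l β z ∧
    InitIsPower v f (delta v (F.Q l) f) (F.Q l) z

/-- `Q_{l+1}` is a lifting of the minimal polynomial, of degree `α_{l+1}`, of `in Q_l` over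
`G_ν[in Q_i : i < l]`. -/
structure IsLifting (v : K[X] → WithTop Γ) (f : K[X]) (F : Family K) (l : Ordinal.{0}) :
    Prop where
  /-- `Q_{l+1}` lifts a homogeneous monic polynomial of degree `α_{l+1}` -/
  exists_eq : ∃ c : ℕ → K[X],
    (∀ j < F.α (l + 1), c j = 0 ∨ ∃ β : Γ, IsHomogeneous v F f.natDegree l β (c j) ∧
      (β : WithTop Γ) + j • v (F.Q l) = F.α (l + 1) • v (F.Q l)) ∧
    F.Q (l + 1) = F.Q l ^ F.α (l + 1) + ∑ j ∈ Finset.range (F.α (l + 1)), c j * F.Q l ^ j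
  /-- this polynomial vanishes at `in Q_l` -/
  vanish : F.α (l + 1) • v (F.Q l) < v (F.Q (l + 1))
  /-- no non-zero homogeneous polynomial of smaller degree over `G_ν[in Q_i : i < l]` vanishes at
  `in Q_l`; the `j`-th coefficient is the class of a sum `d_j` of monomials of value `β - j β_l`
  in the `Q_i`, `i < l` -/
  minimal : ∀ (β : Γ) (d : ℕ → K[X]),
    (∀ j < F.α (l + 1), ∃ s : Multiset K[X], d j = s.sum ∧
      ∀ m ∈ s, (∃ (a : K) (γ : Ordinal.{0} →₀ ℕ), (∀ i, γ i ≠ 0 → i < l) ∧ m = mon F a γ) ∧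
        v m + j • v (F.Q l) = (β : WithTop Γ)) →
    (∃ j < F.α (l + 1), v (d j) + j • v (F.Q l) = (β : WithTop Γ)) →
    ¬ (β : WithTop Γ) < v (∑ j ∈ Finset.range (F.α (l + 1)), d j * F.Q l ^ j)

/-- `Q_l + z_0 + ⋯ + z_{t-1}`. -/
def partialSum (F : Family K) (l : Ordinal.{0}) (z : ℕ → K[X]) (t : ℕ) : K[X] :=
  F.Q l + ∑ k ∈ Finset.range t, z k

/-- The expansion `Q_l + z_0 + ⋯ + z_m` belongs to the set `T` attached to `l`. -/
structure InT (v : K[X] → WithTop Γ) (f : K[X]) (F : Family K) (l : Ordinal.{0})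
    (z : ℕ → K[X]) (m : ℕ) : Prop where
  homogeneous : ∀ k ≤ m, ∃ β : Γ, IsHomogeneous v F f.natDegree l β (z k)
  val_zero : v (z 0) = v (F.Q l)
  val_lt : ∀ k < m, v (z k) < v (z (k + 1))
  lt_slope : LtCharSlope v f (delta v (F.Q l) f) (partialSum F l z (m + 1)) (v (z m))
  init : ∀ k < m, InitIsPower v f (delta v (F.Q l) f) (partialSum F l z k) (z k)

/-- `Q_l + z_0 + ⋯ + z_m` is a maximal element of `T`, where `T` is ordered by prolongation of
expansions. -/
def IsMaximalInT (v : K[X] → WithTop Γ) (f : K[X]) (F : Family K) (l : Ordinal.{0})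
    (z : ℕ → K[X]) (m : ℕ) : Prop :=
  InT v f F l z m ∧
    ∀ (z' : ℕ → K[X]) (m' : ℕ), m < m' → (∀ k ≤ m, z' k = z k) → ¬ InT v f F l z' m'

/-- The set of values `{ν'(Q') | Q' ∈ T}`. -/
def valuesT (v : K[X] → WithTop Γ) (f : K[X]) (F : Family K) (l : Ordinal.{0}) :
    Set (WithTop Γ) :=
  {b | ∃ (z : ℕ → K[X]) (m : ℕ), InT v f F l z m ∧ b = v (partialSum F l z (m + 1))}

/-- Case 2b at `l`: the step from `Q_l` is special, `T` has no maximal element, its values have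
a finite least upper bound `β̄` and no maximum, and `z_0, z_1, …` is a sequence all of whose
expansions `Q_l + z_0 + ⋯ + z_t` are in `T`, with values increasing to `β̄`; the polynomials
`Q_{l+t}` are defined by that sequence. -/
structure IsCase2b (v : K[X] → WithTop Γ) (f : K[X]) (F : Family K) (l : Ordinal.{0})
    (z : ℕ → K[X]) (βbar : Γ) : Prop where
  special : IsSpecial v f F l
  no_maximal : ∀ (z' : ℕ → K[X]) (m : ℕ), ¬ IsMaximalInT v f F l z' m
  isLUB : IsLUB (valuesT v f F l) (βbar : WithTop Γ)
  not_attained : (βbar : WithTop Γ) ∉ valuesT v f F l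
  inT : ∀ t : ℕ, InT v f F l z t
  isLUB_seq : IsLUB (Set.range fun t : ℕ => v (partialSum F l z (t + 1))) (βbar : WithTop Γ)
  Q_eq : ∀ t : ℕ, F.Q (l + (t : Ordinal.{0})) = partialSum F l z t
  α_eq : ∀ t : ℕ, 0 < t → F.α (l + (t : Ordinal.{0})) = 1

/-- `G` is a weakly affine `i`-standard expansion, monic of degree `p ^ e₀` in `Q_i`, for some
`i ∈ {l + t | t ∈ ℕ}`, with `0 < e₀ ≤ e`, where `p ^ e` is the largest power of `p` dividing
`δ = δ_l(f)`, and `β̄ ≤ ν'(G) / p ^ e₀`. -/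
structure IsLimitCandidate (v : K[X] → WithTop Γ) (f : K[X]) (p : ℕ) (F : Family K)
    (l : Ordinal.{0}) (βbar : Γ) (e₀ : ℕ) (G : K[X]) : Prop where
  pos : 0 < e₀
  le : e₀ ≤ padicValNat p (delta v (F.Q l) f)
  weaklyAffine : ∃ t : ℕ, IsWeaklyAffine v F f.natDegree p (l + (t : Ordinal.{0})) e₀ G
  le_val : ((p ^ e₀ • βbar : Γ) : WithTop Γ) ≤ v G

/-- `G` is a limit key polynomial: a candidate with the least possible `e₀`. -/
def IsLimitKey (v : K[X] → WithTop Γ) (f : K[X]) (p : ℕ) (F : Family K)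
    (l : Ordinal.{0}) (βbar : Γ) (e₀ : ℕ) (G : K[X]) : Prop :=
  IsLimitCandidate v f p F l βbar e₀ G ∧
    ∀ (e₁ : ℕ) (G' : K[X]), IsLimitCandidate v f p F l βbar e₁ G' → e₀ ≤ e₁

/-- `IsStage v f p F l`: the polynomials `Q_i` and integers `α_i`, `i ≤ l`, have been obtained by
the recursive construction of key polynomials (in characteristic `p`), which has arrived at a point
where the next step starts from `Q_l`. -/
inductive IsStage (v : K[X] → WithTop Γ) (f : K[X]) (p : ℕ) (F : Family K) :
    Ordinal.{0} → Prop
  /-- the first key polynomial is `x` -/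
  | zero (hQ : F.Q 0 = X) (hα : F.α 0 = 1) : IsStage v f p F 0
  /-- non-special step (and always allowed at the very first step): lift the minimal polynomial -/
  | lift (l : Ordinal.{0}) (hl : IsStage v f p F l) (h0 : v (F.Q l) ≠ ⊤)
      (hs : l = 0 ∨ ¬ IsSpecial v f F l) (hQ : IsLifting v f F l) : IsStage v f p F (l + 1)
  /-- special step, Case 1: a maximal element of `T` defines `Q_{l+1}, …, Q_{l+m+1}` -/
  | finite (l : Ordinal.{0}) (z : ℕ → K[X]) (m : ℕ) (hl : IsStage v f p F l)
      (hs : IsSpecial v f F l) (hmax : IsMaximalInT v f F l z m)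
      (hQ : ∀ t ≤ m + 1, F.Q (l + (t : Ordinal.{0})) = partialSum F l z t)
      (hα : ∀ t ≤ m + 1, 0 < t → F.α (l + (t : Ordinal.{0})) = 1) :
      IsStage v f p F (l + ((m + 1 : ℕ) : Ordinal.{0}))
  /-- special step, Case 2b: the sequence `Q_{l+t}` is followed by a limit key polynomial -/
  | limit (l : Ordinal.{0}) (z : ℕ → K[X]) (βbar : Γ) (e₀ : ℕ) (hl : IsStage v f p F l)
      (hc : IsCase2b v f F l z βbar)
      (hQ : IsLimitKey v f p F l βbar e₀ (F.Q (l + ω))) (hα : F.α (l + ω) = p ^ e₀) :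
      IsStage v f p F (l + ω)

end Construction

end KeyPoly

end

/-! An archimedean Γ embeds in ℝ, so values may be taken real. Write P_t for Q_{l+t}, β_t for its
value and B for the image of β̄.

A monic Q is controlled by the property `KeyPair`: for a, b of degree less than deg Q, the quotient
of ab by Q contributes only terms of value greater than v(ab). Then the Gauss function min_j (v h_j
+ j s) on Q-adic digits is multiplicative (`KeyPair.top_mul`), and Q may be replaced by Q + z. Every
Q_i of finite value produced by the construction has this property, by induction on the stages
(`IsStage.degData_keyPair`).

Along the sequence, the largest index r at which the minimum for h at slope β_t is attained becomes
constant. Cutting h at that index and dividing by its leading digit gives a monic polynomial of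
degree r in P_t whose Gauss value at slope β_t is at least r β_t for all large t: r is a `Deep`
degree (`LimSeq.deep_of_top`). So if m is the least positive `Deep` degree, non-zero polynomials of
degree below m deg P_0 have the value of a constant digit. For f the index is δ > 0 at every t,
because each initial form in the definition of T is a δ-th power; so δ is `Deep`.

Characteristic p enters through Hasse derivatives of the expansion of a `Deep` polynomial of degree
m. If q is the p-part of m, the derivative of order m - q has leading coefficient binom(m, q) ≠ 0,
so q is `Deep` (`LimSeq.deep_prime_pow`). Hence the least `Deep` degree m is a power of p, at most
the p-part of δ. It is not 1: a monic polynomial of degree deg Q_l reaching β̄ would yield an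
element of T attaining β̄ (`CaseData.not_le_val`). If 0 < j < m is not a power of p and q is its
p-part, the derivative of order q lies below degree m, so its value is that of a constant digit and
is at least (m - q) B; as binom(j, q) ≠ 0, the term in P_t^j has value at least m B for large t.
Dropping these terms and replacing the other coefficients by representatives of small degree gives
the weakly affine polynomial (`LimSeq.exists_weaklyAffine`). -/

namespace KeyPoly

/-! ### Expansions in powers of a monic polynomial. -/

section Digits

variable {K : Type*} [Field K] {P : K[X]}

theorem add_divByMonic (hP : P.Monic) (a b : K[X]) : (a + b) /ₘ P = a /ₘ P + b /ₘ P := by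
  refine (div_modByMonic_unique (f := a + b) (a /ₘ P + b /ₘ P) (a %ₘ P + b %ₘ P) hP ⟨?_, ?_⟩).1
  · linear_combination modByMonic_add_div a P + modByMonic_add_div b P
  · rw [← add_modByMonic]
    exact degree_modByMonic_lt _ hP

theorem divByMonic_pow_succ (hP : P.Monic) (h : K[X]) (j : ℕ) :
    h /ₘ P ^ (j + 1) = h /ₘ P ^ j /ₘ P := by
  refine (div_modByMonic_unique (f := h) (h /ₘ P ^ j /ₘ P)
    (h %ₘ P ^ j + P ^ j * (h /ₘ P ^ j %ₘ P)) (hP.pow _) ⟨?_, ?_⟩).1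
  · linear_combination modByMonic_add_div h (P ^ j) + P ^ j * modByMonic_add_div (h /ₘ P ^ j) P
  · have h1 : degree (h %ₘ P ^ j) < degree (P ^ j) := degree_modByMonic_lt _ (hP.pow _)
    have h2 : degree (h /ₘ P ^ j %ₘ P) < degree P := degree_modByMonic_lt _ hP
    have h3 : degree (P ^ j) ≤ degree (P ^ (j + 1)) := by
      rw [pow_succ, degree_mul]
      exact le_add_of_nonneg_right (zero_le_degree_iff.2 hP.ne_zero)
    refine degree_lt_degree_of_lt h1 h2 h3
where
  degree_lt_degree_of_lt {j : ℕ} {a b : K[X]} (h1 : degree a < degree (P ^ j))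
      (h2 : degree b < degree P) (h3 : degree (P ^ j) ≤ degree (P ^ (j + 1))) :
      degree (a + P ^ j * b) < degree (P ^ (j + 1)) := by
    refine (degree_add_le _ _).trans_lt (max_lt (h1.trans_le h3) ?_)
    by_cases hP0 : P ^ j = 0
    · rw [hP0] at h1
      simp at h1
    rw [pow_succ, degree_mul, degree_mul]
    exact WithBot.add_lt_add_left (by rwa [Ne, degree_eq_bot]) h2

theorem sum_digit_add (hP : P.Monic) (h : K[X]) (N : ℕ) :
    ∑ j ∈ Finset.range N, digit P h j * P ^ j + h /ₘ P ^ N * P ^ N = h := by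
  induction N with
  | zero => simp
  | succ N ih =>
    rw [Finset.sum_range_succ, divByMonic_pow_succ hP]
    unfold digit at ih ⊢
    linear_combination ih + P ^ N * modByMonic_add_div (h /ₘ P ^ N) P

theorem divByMonic_pow_eq_zero (hP : P.Monic) {h : K[X]} {j : ℕ}
    (hj : h.degree < (P ^ j).degree) : h /ₘ P ^ j = 0 :=
  (divByMonic_eq_zero_iff (hP.pow j)).2 hj

theorem degree_lt_degree_pow (hP : P.Monic) {h : K[X]} {j : ℕ}
    (hj : h.natDegree < j * P.natDegree) : h.degree < (P ^ j).degree := by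
  refine degree_lt_degree ?_
  rwa [hP.natDegree_pow]

theorem digit_eq_zero (hP : P.Monic) {h : K[X]} {j : ℕ}
    (hj : h.natDegree < j * P.natDegree) : digit P h j = 0 := by
  rw [digit, divByMonic_pow_eq_zero hP (degree_lt_degree_pow hP hj), zero_modByMonic]

theorem sum_digit (hP : P.Monic) {h : K[X]} {N : ℕ} (hN : h.natDegree < N * P.natDegree) :
    ∑ j ∈ Finset.range N, digit P h j * P ^ j = h := by
  have := sum_digit_add hP h N
  rwa [divByMonic_pow_eq_zero hP (degree_lt_degree_pow hP hN), zero_mul, add_zero] at this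

theorem degree_digit_lt (hP : P.Monic) (h : K[X]) (j : ℕ) : (digit P h j).degree < P.degree :=
  degree_modByMonic_lt _ hP

theorem digit_add (hP : P.Monic) (a b : K[X]) (j : ℕ) :
    digit P (a + b) j = digit P a j + digit P b j := by
  rw [digit, add_divByMonic (hP.pow j), add_modByMonic]
  rfl

/-- The digits as an additive map. -/
noncomputable def digitHom (hP : P.Monic) (j : ℕ) : K[X] →+ K[X] where
  toFun h := digit P h j
  map_zero' := by simp [digit]
  map_add' a b := digit_add hP a b j

theorem digit_zero (hP : P.Monic) (j : ℕ) : digit P 0 j = 0 := (digitHom hP j).map_zero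

theorem digit_neg (hP : P.Monic) (a : K[X]) (j : ℕ) : digit P (-a) j = -digit P a j :=
  (digitHom hP j).map_neg a

theorem digit_sub (hP : P.Monic) (a b : K[X]) (j : ℕ) :
    digit P (a - b) j = digit P a j - digit P b j :=
  (digitHom hP j).map_sub a b

theorem digit_sum (hP : P.Monic) {ι : Type*} (s : Finset ι) (a : ι → K[X]) (j : ℕ) :
    digit P (∑ i ∈ s, a i) j = ∑ i ∈ s, digit P (a i) j :=
  map_sum (digitHom hP j) a s

theorem digit_mul_pow (hP : P.Monic) {a : K[X]} (ha : a.degree < P.degree) (i j : ℕ) :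
    digit P (a * P ^ i) j = if j = i then a else 0 := by
  by_cases ha0 : a = 0
  · simp [ha0, digit_zero hP]
  have hlt : a.natDegree < P.natDegree := natDegree_lt_natDegree ha0 ha
  rcases lt_trichotomy j i with h | rfl | h
  · obtain ⟨k, rfl⟩ := Nat.exists_eq_add_of_lt h
    rw [if_neg (by omega), digit, show a * P ^ (j + k + 1) = P ^ j * (P * (a * P ^ k)) by ring,
      mul_divByMonic_cancel_left _ (hP.pow j), self_mul_modByMonic hP]
  · rw [if_pos rfl, digit, mul_comm, mul_divByMonic_cancel_left _ (hP.pow j),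
      (modByMonic_eq_self_iff hP).2 ha]
  · rw [if_neg (by omega)]
    refine digit_eq_zero hP ?_
    rw [natDegree_mul ha0 (hP.pow i).ne_zero, hP.natDegree_pow]
    nlinarith

end Digits

end KeyPoly

namespace KeyPoly

/-! ### Gauss-type bounds on digits: products and translations. -/

section Gauss

variable {K : Type*} [Field K] {v : AddValuation K[X] (WithTop ℝ)} {P Q a b h z : K[X]}
  {s c c' x y : ℝ} {S S' S'' : Set ℕ}

theorem coe_le_mul (ha : (x : WithTop ℝ) ≤ v a) (hb : (y : WithTop ℝ) ≤ v b) :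
    ((x + y : ℝ) : WithTop ℝ) ≤ v (a * b) := by
  rw [v.map_mul, WithTop.coe_add]
  exact add_le_add ha hb

theorem coe_lt_mul (ha : (x : WithTop ℝ) < v a) (hb : (y : WithTop ℝ) ≤ v b) :
    ((x + y : ℝ) : WithTop ℝ) < v (a * b) := by
  rw [v.map_mul, WithTop.coe_add]
  exact WithTop.add_lt_add_of_lt_of_le WithTop.coe_ne_top ha hb

theorem coe_lt_mul' (ha : (x : WithTop ℝ) ≤ v a) (hb : (y : WithTop ℝ) < v b) :
    ((x + y : ℝ) : WithTop ℝ) < v (a * b) := by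
  rw [mul_comm, add_comm]
  exact coe_lt_mul hb ha

theorem coe_le_pow (ha : (x : WithTop ℝ) ≤ v a) (i : ℕ) :
    ((i * x : ℝ) : WithTop ℝ) ≤ v (a ^ i) := by
  induction i with
  | zero => simp [v.map_one]
  | succ i ih =>
    rw [pow_succ]
    convert coe_le_mul ih ha using 2
    push_cast; ring

theorem coe_le_trans {w : WithTop ℝ} (hx : (x : WithTop ℝ) ≤ w) (hy : y ≤ x) :
    (y : WithTop ℝ) ≤ w :=
  (WithTop.coe_le_coe.2 hy).trans hx

theorem coe_lt_trans {w : WithTop ℝ} (hx : (x : WithTop ℝ) < w) (hy : y ≤ x) :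
    (y : WithTop ℝ) < w :=
  (WithTop.coe_le_coe.2 hy).trans_lt hx

theorem coe_lt_of_le {w : WithTop ℝ} (hx : (x : WithTop ℝ) ≤ w) (hy : y < x) :
    (y : WithTop ℝ) < w :=
  (WithTop.coe_lt_coe.2 hy).trans_le hx

/-- The digits `h_j` of `h` with respect to `Q` satisfy `v h_j + j s ≥ c`, with strict inequality
for `j` outside `S`. -/
def InG (v : AddValuation K[X] (WithTop ℝ)) (Q : K[X]) (s c : ℝ) (S : Set ℕ) (h : K[X]) : Prop :=
  ∀ j : ℕ, ((c - j * s : ℝ) : WithTop ℝ) ≤ v (digit Q h j) ∧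
    (j ∉ S → ((c - j * s : ℝ) : WithTop ℝ) < v (digit Q h j))

theorem inG_zero (hQ : Q.Monic) : InG v Q s c S 0 := fun j => by
  rw [digit_zero hQ, v.map_zero]
  exact ⟨le_top, fun _ => WithTop.coe_lt_top _⟩

theorem InG.add (hQ : Q.Monic) (ha : InG v Q s c S a) (hb : InG v Q s c S b) :
    InG v Q s c S (a + b) := fun j => by
  rw [digit_add hQ]
  exact ⟨v.map_le_add (ha j).1 (hb j).1, fun hj => v.map_lt_add ((ha j).2 hj) ((hb j).2 hj)⟩

theorem InG.neg (hQ : Q.Monic) (ha : InG v Q s c S a) : InG v Q s c S (-a) := fun j => by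
  rw [digit_neg hQ, v.map_neg]
  exact ha j

theorem InG.sub (hQ : Q.Monic) (ha : InG v Q s c S a) (hb : InG v Q s c S b) :
    InG v Q s c S (a - b) := by
  rw [sub_eq_add_neg]
  exact ha.add hQ (hb.neg hQ)

theorem InG.sum (hQ : Q.Monic) {ι : Type*} {t : Finset ι} {a : ι → K[X]}
    (ha : ∀ i ∈ t, InG v Q s c S (a i)) : InG v Q s c S (∑ i ∈ t, a i) := by
  classical
  induction t using Finset.induction_on with
  | empty => exact inG_zero hQ
  | insert i t hi ih =>
    rw [Finset.sum_insert hi]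
    exact (ha i (by simp)).add hQ (ih fun j hj => ha j (by simp [hj]))

theorem InG.mono (ha : InG v Q s c S a) (hc : c' ≤ c) (hS : S ⊆ S') : InG v Q s c' S' a :=
  fun j => ⟨coe_le_trans (ha j).1 (by linarith),
    fun hj => coe_lt_trans ((ha j).2 fun hj' => hj (hS hj')) (by linarith)⟩

theorem inG_mul_pow (hQ : Q.Monic) (ha : a.degree < Q.degree) {i : ℕ}
    (h1 : ((c - i * s : ℝ) : WithTop ℝ) ≤ v a)
    (h2 : i ∉ S → ((c - i * s : ℝ) : WithTop ℝ) < v a) : InG v Q s c S (a * Q ^ i) := fun j => by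
  rw [digit_mul_pow hQ ha]
  split_ifs with hj
  · subst hj
    exact ⟨h1, h2⟩
  · rw [v.map_zero]
    exact ⟨le_top, fun _ => WithTop.coe_lt_top _⟩

theorem inG_of_degree_lt (hQ : Q.Monic) (ha : a.degree < Q.degree) (h1 : (c : WithTop ℝ) ≤ v a) :
    InG v Q s c {0} a := by
  have := inG_mul_pow (v := v) (S := {0}) (s := s) (c := c) hQ ha (i := 0) (by simpa using h1)
    (by simp)
  simpa using this

theorem inG_of_degree_lt' (hQ : Q.Monic) (ha : a.degree < Q.degree) (h1 : (c : WithTop ℝ) < v a) :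
    InG v Q s c ∅ a := by
  have := inG_mul_pow (v := v) (S := ∅) (s := s) (c := c) hQ ha (i := 0) (by simpa using h1.le)
    (by simpa using h1)
  simpa using this

theorem exists_sum_digit (hQ : Q.Monic) (hpos : 0 < Q.natDegree) (h : K[X]) :
    ∑ j ∈ Finset.range (h.natDegree + 1), digit Q h j * Q ^ j = h :=
  sum_digit hQ (by nlinarith)

/-- Reduces an additive property to terms a * Q ^ i. The bounds on v h and the stability under
products and translations are proved this way. -/
theorem InG.induction (hQ : Q.Monic) (hpos : 0 < Q.natDegree) (hh : InG v Q s c S h)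
    (p : K[X] → Prop) (hp0 : p 0) (hadd : ∀ a b, p a → p b → p (a + b))
    (hp : ∀ (a : K[X]) (i : ℕ), a.degree < Q.degree → ((c - i * s : ℝ) : WithTop ℝ) ≤ v a →
      (i ∉ S → ((c - i * s : ℝ) : WithTop ℝ) < v a) → p (a * Q ^ i)) : p h := by
  rw [← exists_sum_digit hQ hpos h]
  exact Finset.sum_induction _ p hadd hp0 fun i _ =>
    hp _ i (degree_digit_lt hQ h i) (hh i).1 (hh i).2

theorem InG.coe_le (hQ : Q.Monic) (hpos : 0 < Q.natDegree) (hs : (s : WithTop ℝ) ≤ v Q)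
    (hh : InG v Q s c S h) : (c : WithTop ℝ) ≤ v h := by
  refine hh.induction hQ hpos (fun h => (c : WithTop ℝ) ≤ v h) (by simp [v.map_zero])
    (fun a b => v.map_le_add) ?_
  intro a i _ h1 _
  exact coe_le_trans (coe_le_mul h1 (coe_le_pow hs i)) (by linarith)

theorem InG.coe_lt (hQ : Q.Monic) (hpos : 0 < Q.natDegree) (hs : (s : WithTop ℝ) ≤ v Q)
    (hh : InG v Q s c ∅ h) : (c : WithTop ℝ) < v h := by
  refine hh.induction hQ hpos (fun h => (c : WithTop ℝ) < v h) (by simp [v.map_zero])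
    (fun a b => v.map_lt_add) ?_
  intro a i _ _ h2
  exact coe_lt_trans (coe_lt_mul (h2 (by simp)) (coe_le_pow hs i)) (by linarith)

/-- Products of polynomials of degree less than `deg Q` are, up to terms of higher value, their
remainders modulo `Q`, when `Q` is given the value `s`. -/
structure KeyPair (v : AddValuation K[X] (WithTop ℝ)) (Q : K[X]) (s : ℝ) : Prop where
  monic : Q.Monic
  pos : 0 < Q.natDegree
  le : (s : WithTop ℝ) ≤ v Q
  ne_top : ∀ a : K[X], a ≠ 0 → a.degree < Q.degree → v a ≠ ⊤
  mul : ∀ a b : K[X], a ≠ 0 → b ≠ 0 → a.degree < Q.degree → b.degree < Q.degree →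
    v (a * b) < v (a * b /ₘ Q) + s

namespace KeyPair

theorem mono (hQ : KeyPair v Q s) {s' : ℝ} (h : s ≤ s') (h' : (s' : WithTop ℝ) ≤ v Q) :
    KeyPair v Q s' where
  monic := hQ.monic
  pos := hQ.pos
  le := h'
  ne_top := hQ.ne_top
  mul a b ha hb hda hdb := (hQ.mul a b ha hb hda hdb).trans_le
    (add_le_add le_rfl (WithTop.coe_le_coe.2 h))

theorem lt_div (hQ : KeyPair v Q s) (ha : a.degree < Q.degree) (hb : b.degree < Q.degree)
    (hx : (x : WithTop ℝ) ≤ v (a * b)) : ((x - s : ℝ) : WithTop ℝ) < v (a * b /ₘ Q) := by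
  by_cases h : a * b = 0
  · rw [h, zero_divByMonic, v.map_zero]
    exact WithTop.coe_lt_top _
  have := hx.trans_lt (hQ.mul a b (left_ne_zero_of_mul h) (right_ne_zero_of_mul h) ha hb)
  cases hv : v (a * b /ₘ Q) with
  | top => exact WithTop.coe_lt_top _
  | coe t =>
    rw [hv] at this
    norm_cast at this ⊢
    linarith

/-- Since s ≤ v Q, the multiple of Q that is discarded has value greater than v (a * b). -/
theorem map_mod (hQ : KeyPair v Q s) (ha : a.degree < Q.degree) (hb : b.degree < Q.degree) :
    v ((a * b) %ₘ Q) = v (a * b) := by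
  by_cases h : a * b = 0
  · rw [h, zero_modByMonic]
  have h1 := hQ.mul a b (left_ne_zero_of_mul h) (right_ne_zero_of_mul h) ha hb
  have h2 : v (a * b) < v (Q * (a * b /ₘ Q)) := by
    rw [v.map_mul Q, add_comm]
    exact h1.trans_le (add_le_add le_rfl hQ.le)
  rw [modByMonic_eq_sub_mul_div]
  exact v.map_sub_eq_of_lt_left h2

theorem degree_div_lt (hQ : KeyPair v Q s) (ha : a.degree < Q.degree) (hb : b.degree < Q.degree) :
    (a * b /ₘ Q).degree < Q.degree := by
  by_cases h : a * b = 0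
  · rw [h, zero_divByMonic, degree_zero]
    exact bot_lt_iff_ne_bot.2 (degree_ne_bot.2 hQ.monic.ne_zero)
  have ha' := natDegree_lt_natDegree (left_ne_zero_of_mul h) ha
  have hb' := natDegree_lt_natDegree (right_ne_zero_of_mul h) hb
  refine degree_lt_degree ?_
  rw [natDegree_divByMonic _ hQ.monic,
    natDegree_mul (left_ne_zero_of_mul h) (right_ne_zero_of_mul h)]
  omega

/-- The error is the single term (a * b /ₘ Q) * Q, whose coefficient has value greater than x - s.
Giving Q the slope s' shifts the bound by s' - s; this gain absorbs the reduction errors in the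
limit arguments. -/
theorem inG_mul_degree_lt (hQ : KeyPair v Q s) {s' : ℝ}
    (ha : a.degree < Q.degree) (hb : b.degree < Q.degree) (hx : (x : WithTop ℝ) ≤ v (a * b)) :
    InG v Q s' (x + (s' - s)) ∅ (a * b - (a * b) %ₘ Q) := by
  have h1 : a * b - (a * b) %ₘ Q = (a * b /ₘ Q) * Q ^ 1 := by
    linear_combination -modByMonic_add_div (a * b) Q
  have h2 := hQ.lt_div ha hb hx
  rw [h1]
  have h3 : ((x + (s' - s) - (1 : ℕ) * s' : ℝ) : WithTop ℝ) < v (a * b /ₘ Q) :=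
    coe_lt_trans h2 (by push_cast; linarith)
  exact inG_mul_pow hQ.monic (hQ.degree_div_lt ha hb) h3.le fun _ => h3

theorem mul_pow_inG (hQ : KeyPair v Q s) {i : ℕ} (ha : InG v Q s c S a)
    (hS : ∀ j ∈ S, j + i ∈ S') : InG v Q s (c + i * s) S' (a * Q ^ i) := by
  refine ha.induction hQ.monic hQ.pos (fun a => InG v Q s (c + i * s) S' (a * Q ^ i))
    (by rw [zero_mul]; exact inG_zero hQ.monic)
    (fun a b ha hb => by rw [add_mul]; exact ha.add hQ.monic hb) ?_
  intro b j hb h1 h2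
  rw [mul_assoc, ← pow_add]
  refine inG_mul_pow hQ.monic hb (coe_le_trans h1 (by push_cast; linarith)) fun hj =>
    coe_lt_trans (h2 fun hj' => hj (hS j hj')) (by push_cast; linarith)

/-- Digits multiply like coefficients once a product of two digits is replaced by its remainder
modulo Q. The error satisfies only strict inequalities, so it does not affect S''. -/
theorem inG_mul (hQ : KeyPair v Q s) (ha : InG v Q s c S a) (hb : InG v Q s c' S' b)
    (hS : ∀ i ∈ S, ∀ j ∈ S', i + j ∈ S'') : InG v Q s (c + c') S'' (a * b) := by
  refine ha.induction hQ.monic hQ.pos (fun a => InG v Q s (c + c') S'' (a * b))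
    (by rw [zero_mul]; exact inG_zero hQ.monic)
    (fun a b ha hb => by rw [add_mul]; exact ha.add hQ.monic hb) ?_
  intro a i ha h1 h1'
  refine hb.induction hQ.monic hQ.pos (fun b => InG v Q s (c + c') S'' (a * Q ^ i * b))
    (by rw [mul_zero]; exact inG_zero hQ.monic)
    (fun a b ha hb => by rw [mul_add]; exact ha.add hQ.monic hb) ?_
  intro b j hb h2 h2'
  have h3 : a * Q ^ i * (b * Q ^ j) = (a * b) %ₘ Q * Q ^ (i + j) +
      (a * b - (a * b) %ₘ Q) * Q ^ (i + j) := by ring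
  have h4 := coe_le_mul h1 h2
  rw [h3]
  refine InG.add hQ.monic ?_ ?_
  · refine inG_mul_pow hQ.monic (degree_modByMonic_lt _ hQ.monic) ?_ ?_
    · rw [hQ.map_mod ha hb]
      exact coe_le_trans h4 (by push_cast; linarith)
    · intro hij
      rw [hQ.map_mod ha hb]
      by_cases hi : i ∈ S
      · exact coe_lt_trans (coe_lt_mul' h1 (h2' fun hj => hij (hS i hi j hj)))
          (by push_cast; linarith)
      · exact coe_lt_trans (coe_lt_mul (h1' hi) h2) (by push_cast; linarith)
  · have := hQ.mul_pow_inG (S' := S'') (i := i + j)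
      (hQ.inG_mul_degree_lt ha hb h4) (by simp)
    exact this.mono (by push_cast; linarith) subset_rfl

theorem inG_pow (hQ : KeyPair v Q s) {T : ℕ → Set ℕ} (ha : InG v Q s c (T 1) a)
    (h0 : 0 ∈ T 0) (hT : ∀ i, ∀ j ∈ T i, ∀ k ∈ T 1, j + k ∈ T (i + 1)) (i : ℕ) :
    InG v Q s (i * c) (T i) (a ^ i) := by
  induction i with
  | zero =>
    have : (1 : K[X]).degree < Q.degree := by
      rw [degree_one]
      exact natDegree_pos_iff_degree_pos.1 hQ.pos
    refine (inG_of_degree_lt hQ.monic (c := 0) this ?_).mono (by simp) (by simpa using h0)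
    simp [v.map_one]
  | succ i ih =>
    rw [pow_succ]
    exact (hQ.inG_mul ih ha (hT i)).mono (by push_cast; linarith) subset_rfl

/-- If q is the quotient of a * b by Q + z, then a * b /ₘ Q = q + q * z /ₘ Q. For q ≠ 0 the second
summand has value greater than v q, because v z ≥ s; the two quotients then have the same value. -/
theorem translate (hQ : KeyPair v Q s) (hz : z.degree < Q.degree) (hvz : (s : WithTop ℝ) ≤ v z) :
    KeyPair v (Q + z) s := by
  have hdeg : (Q + z).degree = Q.degree := degree_add_eq_left_of_degree_lt hz
  have hm : (Q + z).Monic := hQ.monic.add_of_left hz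
  refine ⟨hm, ?_, v.map_le_add hQ.le hvz, fun a ha hda => hQ.ne_top a ha (hdeg ▸ hda), ?_⟩
  · rw [natDegree_eq_of_degree_eq hdeg]
    exact hQ.pos
  intro a b ha hb hda hdb
  rw [hdeg] at hda hdb
  set q := a * b /ₘ (Q + z) with hq
  set r := (a * b) %ₘ (Q + z) with hr
  have hqr : r + (Q + z) * q = a * b := modByMonic_add_div _ _
  have hrd : r.degree < Q.degree := hdeg ▸ degree_modByMonic_lt _ hm
  have hab : a * b ≠ 0 := mul_ne_zero ha hb
  have hqd : q.degree < Q.degree := by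
    by_cases hq0 : q = 0
    · rw [hq0, degree_zero]
      exact bot_lt_iff_ne_bot.2 (degree_ne_bot.2 hQ.monic.ne_zero)
    refine degree_lt_degree ?_
    have := natDegree_lt_natDegree ha hda
    have := natDegree_lt_natDegree hb hdb
    rw [hq, natDegree_divByMonic _ hm, natDegree_mul ha hb, natDegree_eq_of_degree_eq hdeg]
    omega
  -- Such a quotient is the digit of index 1, so it can be computed additively.
  have key : ∀ {c d : K[X]}, c.degree < Q.degree → d.degree < Q.degree →
      c * d /ₘ Q = digit Q (c * d) 1 := fun {c d} hc hd => by
    rw [digit, pow_one, (modByMonic_eq_self_iff hQ.monic).2 (hQ.degree_div_lt hc hd)]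
  have h1 : a * b /ₘ Q = q + q * z /ₘ Q := by
    rw [key hda hdb, key hqd hz, ← hqr,
      show r + (Q + z) * q = r * Q ^ 0 + q * Q ^ 1 + q * z by ring, digit_add hQ.monic,
      digit_add hQ.monic, digit_mul_pow hQ.monic hrd, digit_mul_pow hQ.monic hqd]
    simp
  have h2 := hQ.mul a b ha hb hda hdb
  rw [h1] at h2
  by_cases hq0 : q = 0
  · rw [hq0]
    rw [v.map_zero, top_add]
    refine lt_top_iff_ne_top.2 ?_
    rw [v.map_mul]
    exact WithTop.add_ne_top.2 ⟨hQ.ne_top a ha hda, hQ.ne_top b hb hdb⟩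
  obtain ⟨t, ht⟩ := WithTop.ne_top_iff_exists.1 (hQ.ne_top q hq0 hqd)
  have h3 : v q < v (q * z /ₘ Q) := by
    rw [← ht]
    have := hQ.lt_div hqd hz (coe_le_mul ht.le hvz)
    exact coe_lt_trans this (by linarith)
  rwa [v.map_add_eq_of_lt_left h3] at h2

/-- A term a * Q ^ i is expanded again through the powers of Q; T i records the digits of Q ^ i
along P that may attain the minimum. -/
theorem inG_translate_aux (hQ : KeyPair v Q s) (hP : KeyPair v P s) (hdeg : P.degree = Q.degree)
    {T : ℕ → Set ℕ} (hT : ∀ i : ℕ, InG v P s (i * s) (T i) (Q ^ i))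
    (hS : ∀ i ∈ S, T i ⊆ S') (hh : InG v Q s c S h) : InG v P s c S' h := by
  refine hh.induction hQ.monic hQ.pos (fun h => InG v P s c S' h) (inG_zero hP.monic)
    (fun a b ha hb => ha.add hP.monic hb) ?_
  intro a i ha h1 h2
  rw [← hdeg] at ha
  by_cases hi : i ∈ S
  · exact (hP.inG_mul (S'' := S') (inG_of_degree_lt hP.monic ha h1) (hT i) (by
      rintro _ rfl j hj
      rw [zero_add]
      exact hS i hi hj)).mono (by linarith) subset_rfl
  · exact (hP.inG_mul (S'' := S') (inG_of_degree_lt' hP.monic ha (h2 hi)) (hT i) (by simp)).mono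
      (by linarith) subset_rfl

theorem inG_self (hQ : KeyPair v Q s) : InG v Q s s {1} Q := by
  have : (1 : K[X]).degree < Q.degree := by
    rw [degree_one]
    exact natDegree_pos_iff_degree_pos.1 hQ.pos
  have := inG_mul_pow (v := v) (s := s) (c := s) (S := {1}) hQ.monic this (i := 1)
    (by simp [v.map_one]) (by simp)
  simpa using this

/-- Translation `Q ↦ Q + z = P` with `v z ≥ s`. -/
theorem inG_translate (hQ : KeyPair v Q s) (hP : KeyPair v P s)
    (hz : (P - Q).degree < Q.degree) (hvz : (s : WithTop ℝ) ≤ v (P - Q))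
    (hS : ∀ i ∈ S, ∀ j ≤ i, j ∈ S') (hh : InG v Q s c S h) : InG v P s c S' h := by
  have hdeg : P.degree = Q.degree := by
    have := degree_add_eq_left_of_degree_lt hz
    rwa [_root_.add_sub_cancel] at this
  refine hQ.inG_translate_aux hP hdeg (T := fun i => Set.Iic i) ?_ (fun i hi j hj => hS i hi j hj) hh
  refine hP.inG_pow (T := fun i => Set.Iic i) ?_ (by simp) ?_
  · have h1 := hP.inG_self.mono (S' := Set.Iic 1) le_rfl (by simp)
    have h2 := (inG_of_degree_lt (s := s) hP.monic (hdeg ▸ hz) hvz).mono (S' := Set.Iic 1)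
      le_rfl (by simp)
    have := h1.sub hP.monic h2
    rwa [sub_sub_cancel] at this
  · intro i j hj k hk
    simp only [Set.mem_Iic] at *
    omega

/-- Translation `Q ↦ Q + z = P` with `v z > s`. -/
theorem inG_translate_lt (hQ : KeyPair v Q s) (hP : KeyPair v P s)
    (hz : (P - Q).degree < Q.degree) (hvz : (s : WithTop ℝ) < v (P - Q))
    (hh : InG v Q s c S h) : InG v P s c S h := by
  have hdeg : P.degree = Q.degree := by
    have := degree_add_eq_left_of_degree_lt hz
    rwa [_root_.add_sub_cancel] at this
  refine hQ.inG_translate_aux hP hdeg (T := fun i => {i}) ?_ (fun i hi j hj => by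
    rw [Set.mem_singleton_iff.1 hj]; exact hi) hh
  refine hP.inG_pow (T := fun i => {i}) ?_ (by simp) ?_
  · have h2 := (inG_of_degree_lt' (s := s) hP.monic (hdeg ▸ hz) hvz).mono (S' := {1})
      le_rfl (by simp)
    have := hP.inG_self.sub hP.monic h2
    rwa [sub_sub_cancel] at this
  · rintro i _ rfl _ rfl
    simp

end KeyPair

end Gauss

end KeyPoly

namespace KeyPoly

/-! ### The top index of the initial form; Gauss's lemma and division. -/

section Top

variable {K : Type*} [Field K] {v : AddValuation K[X] (WithTop ℝ)} {P Q a b h z : K[X]}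
  {s c c' x y e : ℝ} {r r' : ℕ}

/-- The minimum of `v h_j + j s` over the digits `h_j` of `h` is `c`, and `r` is the largest index
at which it is attained. -/
def Top (v : AddValuation K[X] (WithTop ℝ)) (Q : K[X]) (s c : ℝ) (r : ℕ) (h : K[X]) : Prop :=
  InG v Q s c (Set.Iic r) h ∧ ¬ InG v Q s c (Set.Iio r) h

theorem inG_Iio_iff (hh : InG v Q s c (Set.Iic r) h) :
    InG v Q s c (Set.Iio r) h ↔ ((c - r * s : ℝ) : WithTop ℝ) < v (digit Q h r) := by
  refine ⟨fun h' => (h' r).2 (by simp), fun h' j => ⟨(hh j).1, fun hj => ?_⟩⟩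
  rcases eq_or_ne j r with rfl | hjr
  · exact h'
  · refine (hh j).2 ?_
    simp only [Set.mem_Iio, Set.mem_Iic] at *
    omega

theorem Top.digit_eq (hh : Top v Q s c r h) : v (digit Q h r) = ((c - r * s : ℝ) : WithTop ℝ) := by
  have := hh.2
  rw [inG_Iio_iff hh.1, not_lt] at this
  exact this.antisymm (hh.1 r).1

theorem top_of_digit_eq (h1 : InG v Q s c (Set.Iic r) h)
    (h2 : v (digit Q h r) = ((c - r * s : ℝ) : WithTop ℝ)) : Top v Q s c r h := by
  refine ⟨h1, ?_⟩
  rw [inG_Iio_iff h1, h2]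
  exact lt_irrefl _

theorem Top.inG (hh : Top v Q s c r h) : InG v Q s c Set.univ h :=
  hh.1.mono le_rfl (Set.subset_univ _)

namespace KeyPair

theorem sub_digit_inG (hQ : KeyPair v Q s) (hh : InG v Q s c (Set.Iic r) h) :
    InG v Q s c (Set.Iio r) (h - digit Q h r * Q ^ r) := fun j => by
  rw [digit_sub hQ.monic, digit_mul_pow hQ.monic (degree_digit_lt hQ.monic _ _)]
  split_ifs with hj
  · subst hj
    rw [_root_.sub_self, v.map_zero]
    exact ⟨le_top, fun _ => WithTop.coe_lt_top _⟩
  · rw [_root_.sub_zero]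
    refine ⟨(hh j).1, fun hj' => (hh j).2 ?_⟩
    simp only [Set.mem_Iio, Set.mem_Iic] at *
    omega

/-- Gauss's lemma: up to terms for which the minimum is attained only below r + r', the product is
that of the two top terms, and reducing the product of the top digits modulo Q preserves its value.
-/
theorem top_mul (hQ : KeyPair v Q s) (ha : Top v Q s c r a) (hb : Top v Q s c' r' b) :
    Top v Q s (c + c') (r + r') (a * b) := by
  refine ⟨hQ.inG_mul ha.1 hb.1 fun i hi j hj => ?_, fun hab => ?_⟩
  · simp only [Set.mem_Iic] at *
    omega
  have hda := degree_digit_lt hQ.monic a r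
  have hdb := degree_digit_lt hQ.monic b r'
  have h1 : InG v Q s (c + c') (Set.Iio (r + r')) ((a - digit Q a r * Q ^ r) * b) := by
    refine hQ.inG_mul (hQ.sub_digit_inG ha.1) hb.1 fun i hi j hj => ?_
    simp only [Set.mem_Iic, Set.mem_Iio] at *
    omega
  have h2 : InG v Q s (c + c') (Set.Iio (r + r'))
      (digit Q a r * Q ^ r * (b - digit Q b r' * Q ^ r')) := by
    refine hQ.inG_mul (S := {r}) ?_ (hQ.sub_digit_inG hb.1) fun i hi j hj => ?_
    · exact inG_mul_pow hQ.monic hda ha.digit_eq.ge (by simp)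
    · simp only [Set.mem_Iio, Set.mem_singleton_iff] at *
      omega
  have h4 : ((c - r * s + (c' - r' * s) : ℝ) : WithTop ℝ) = v (digit Q a r * digit Q b r') := by
    rw [v.map_mul, ha.digit_eq, hb.digit_eq, WithTop.coe_add]
  have h3 : InG v Q s (c + c') (Set.Iio (r + r')) ((digit Q a r * digit Q b r' -
      (digit Q a r * digit Q b r') %ₘ Q) * Q ^ (r + r')) := by
    refine (hQ.mul_pow_inG (S' := Set.Iio (r + r')) (i := r + r')
      (hQ.inG_mul_degree_lt hda hdb h4.le) (by simp)).mono ?_ subset_rfl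
    push_cast; linarith
  have h5 : InG v Q s (c + c') (Set.Iio (r + r'))
      ((digit Q a r * digit Q b r') %ₘ Q * Q ^ (r + r')) := by
    have := ((hab.sub hQ.monic h1).sub hQ.monic h2).sub hQ.monic h3
    convert this using 1
    ring
  have h6 := (h5 (r + r')).2 (by simp)
  rw [digit_mul_pow hQ.monic (degree_modByMonic_lt _ hQ.monic), if_pos rfl, hQ.map_mod hda hdb,
    ← h4] at h6
  norm_cast at h6
  push_cast at h6
  linarith

/-- The translation is invertible under the same hypotheses, so a smaller top index along P would
translate back to one along Q. -/
theorem top_translate (hQ : KeyPair v Q s) (hP : KeyPair v P s)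
    (hz : (P - Q).degree < Q.degree) (hvz : (s : WithTop ℝ) ≤ v (P - Q))
    (hh : Top v Q s c r h) : Top v P s c r h := by
  have hdeg : P.degree = Q.degree := by
    have := degree_add_eq_left_of_degree_lt hz
    rwa [_root_.add_sub_cancel] at this
  refine ⟨hQ.inG_translate hP hz hvz (fun i hi j hj => ?_) hh.1, fun hh' => hh.2 ?_⟩
  · exact le_trans hj hi
  · refine hP.inG_translate hQ ?_ ?_ (fun i hi j hj => ?_) hh'
    · rwa [← degree_neg, neg_sub, hdeg]
    · rwa [v.map_sub_swap]
    · exact lt_of_le_of_lt hj hi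

theorem exists_top (hQ : KeyPair v Q s) (hh : h ≠ 0) : ∃ (c : ℝ) (r : ℕ), Top v Q s c r h := by
  classical
  have hfin : ∀ j, digit Q h j ≠ 0 → ∃ t : ℝ, v (digit Q h j) = t := fun j hj => by
    obtain ⟨t, ht⟩ := WithTop.ne_top_iff_exists.1
      (hQ.ne_top _ hj (degree_digit_lt hQ.monic h j))
    exact ⟨t, ht.symm⟩
  choose! f hf using hfin
  set T := (Finset.range (h.natDegree + 1)).filter fun j => digit Q h j ≠ 0 with hT
  have hmem : ∀ j, digit Q h j ≠ 0 → j ∈ T := fun j hj => by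
    rw [hT, Finset.mem_filter, Finset.mem_range]
    refine ⟨?_, hj⟩
    by_contra hlt
    refine hj (digit_eq_zero hQ.monic ?_)
    have := hQ.pos
    nlinarith
  have hTne : T.Nonempty := by
    by_contra hT'
    rw [Finset.not_nonempty_iff_eq_empty] at hT'
    refine hh ?_
    rw [← exists_sum_digit hQ.monic hQ.pos h]
    refine Finset.sum_eq_zero fun j _ => ?_
    by_cases hj : digit Q h j = 0
    · rw [hj, zero_mul]
    · have := hmem j hj
      rw [hT'] at this
      simp at this
  obtain ⟨j₀, hj₀, hmin⟩ := T.exists_min_image (fun j => f j + j * s) hTne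
  set R := T.filter fun j => f j + j * s = f j₀ + j₀ * s with hR
  obtain ⟨r, hr, hmax⟩ := R.exists_max_image id ⟨j₀, by simp [hR, hj₀]⟩
  rw [hR, Finset.mem_filter] at hr
  have hr0 : digit Q h r ≠ 0 := (Finset.mem_filter.1 hr.1).2
  refine ⟨f j₀ + j₀ * s, r, top_of_digit_eq (fun j => ?_) ?_⟩
  · by_cases hj : digit Q h j = 0
    · rw [hj, v.map_zero]
      exact ⟨le_top, fun _ => WithTop.coe_lt_top _⟩
    have h1 := hmin j (hmem j hj)
    rw [hf j hj, WithTop.coe_le_coe, WithTop.coe_lt_coe]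
    refine ⟨by linarith, fun hjr => ?_⟩
    refine lt_of_le_of_ne (by linarith) fun heq => hjr ?_
    refine hmax j ?_
    rw [hR, Finset.mem_filter]
    exact ⟨hmem j hj, by linarith⟩
  · rw [hf r hr0]
    congr 1
    linarith [hr.2]

theorem coe_le (hQ : KeyPair v Q s) {S : Set ℕ} (hh : InG v Q s c S h) : (c : WithTop ℝ) ≤ v h :=
  InG.coe_le hQ.monic hQ.pos hQ.le hh

theorem coe_lt (hQ : KeyPair v Q s) (hh : InG v Q s c ∅ h) : (c : WithTop ℝ) < v h :=
  InG.coe_lt hQ.monic hQ.pos hQ.le hh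

theorem top_zero (hQ : KeyPair v Q s) (hh : Top v Q s c 0 h) : v h = c := by
  have h1 := hQ.sub_digit_inG hh.1
  rw [pow_zero, mul_one, show Set.Iio 0 = (∅ : Set ℕ) by ext; simp] at h1
  have h2 := hQ.coe_lt h1
  have h3 := hh.digit_eq
  rw [Nat.cast_zero, zero_mul, _root_.sub_zero] at h3
  rw [← h3] at h2 ⊢
  exact (v.map_eq_of_lt_sub h2)

/-- A unit of `K[X] / (Q)` has an inverse represented by a polynomial of degree less than `deg Q`. -/
theorem exists_inv (hQ : KeyPair v Q s) (ha : a ≠ 0) (hda : a.degree < Q.degree) :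
    ∃ b : K[X], b.degree < Q.degree ∧ (b * a) %ₘ Q = 1 ∧ v b + v a = 0 := by
  have h1deg : (1 : K[X]).degree < Q.degree := by
    rw [degree_one]
    exact natDegree_pos_iff_degree_pos.1 hQ.pos
  -- Two proper factors of Q have degree less than deg Q and their product has quotient 1 by Q,
  -- which would force v Q < s.
  have hirr : Irreducible Q := by
    refine (hQ.monic.irreducible_iff_natDegree).2 ⟨fun h => ?_, fun f g hf hg hfg => ?_⟩
    · have := hQ.pos
      rw [h] at this
      simp at this
    by_contra! hne
    have hdeg : f.natDegree + g.natDegree = Q.natDegree := by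
      rw [← hfg, hf.natDegree_mul hg]
    have h1 := hQ.mul f g hf.ne_zero hg.ne_zero
      (degree_lt_degree (by have := hne.2; omega)) (degree_lt_degree (by have := hne.1; omega))
    have h2 : Q /ₘ Q = 1 := by
      have := mul_divByMonic_cancel_left 1 hQ.monic
      rwa [mul_one] at this
    rw [hfg, h2, v.map_one, zero_add] at h1
    exact absurd hQ.le (not_le.2 h1)
  have hcop : IsCoprime a Q := by
    refine IsCoprime.symm ((hirr.coprime_iff_not_dvd).2 fun hdvd => ?_)
    exact absurd (degree_le_of_dvd hdvd ha) (not_le.2 hda)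
  obtain ⟨u, w, huw⟩ := hcop
  have hb : (u %ₘ Q).degree < Q.degree := degree_modByMonic_lt _ hQ.monic
  have hmod : (u %ₘ Q * a) %ₘ Q = 1 := by
    rw [← (modByMonic_eq_self_iff hQ.monic).2 h1deg]
    refine modByMonic_eq_of_dvd_sub hQ.monic ⟨-(u /ₘ Q) * a - w, ?_⟩
    linear_combination a * modByMonic_add_div u Q + huw
  refine ⟨u %ₘ Q, hb, hmod, ?_⟩
  rw [← v.map_mul, ← hQ.map_mod hb hda, hmod, v.map_one]

/-- Division by a polynomial whose initial form along `Q` is monic of degree `m`. -/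
theorem mul_lt_of_top (hQ : KeyPair v Q s) {G : K[X]} {m : ℕ} (hG : G.Monic)
    (hdeg : G.natDegree = m * Q.natDegree) (hm : 0 < m) (hTop : Top v Q s (m * s) m G) {t : ℝ}
    (ht : m * s < t) {ca cb : ℝ} (ha : InG v Q s ca Set.univ a) (hva : v a = ca)
    (hb : InG v Q s cb Set.univ b) (hvb : v b = cb)
    (hq : a * b /ₘ G ≠ 0 → ∃ (cq : ℝ) (rq : ℕ), Top v Q s cq rq (a * b /ₘ G) ∧
      v (a * b /ₘ G) = cq) :
    v (a * b) < v (a * b /ₘ G) + t := by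
  have hvab : v (a * b) = ((ca + cb : ℝ) : WithTop ℝ) := by
    rw [v.map_mul, hva, hvb, WithTop.coe_add]
  by_cases hq0 : a * b /ₘ G = 0
  · rw [hq0, v.map_zero, top_add, hvab]
    exact WithTop.coe_lt_top _
  obtain ⟨cq, rq, h1, h2⟩ := hq hq0
  have h3 := hQ.top_mul h1 hTop
  have h4 := hQ.inG_mul (S'' := Set.univ) ha hb (by simp)
  have h5 : digit Q (a * b) (rq + m) = digit Q (a * b /ₘ G * G) (rq + m) := by
    have h6 : digit Q ((a * b) %ₘ G) (rq + m) = 0 := by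
      have hne : G ≠ 1 := by
        rintro rfl
        rw [natDegree_one] at hdeg
        have := mul_pos hm hQ.pos
        omega
      refine digit_eq_zero hQ.monic ((natDegree_modByMonic_lt _ hG hne).trans_le ?_)
      rw [hdeg]
      nlinarith
    conv_lhs => rw [← modByMonic_add_div (a * b) G, digit_add hQ.monic, h6, zero_add, mul_comm]
  have h7 := (h4 (rq + m)).1
  rw [h5, h3.digit_eq, WithTop.coe_le_coe] at h7
  rw [hvab, h2, ← WithTop.coe_add, WithTop.coe_lt_coe]
  linarith

end KeyPair

end Top

/-! ### Approximation by polynomials of degree less than deg Q. -/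

section Near

variable {K : Type*} [Field K] {v : AddValuation K[X] (WithTop ℝ)} {P Q a b w A B : K[X]}
  {s σ c c' x y e : ℝ}

/-- `A` is approximated by a polynomial `a` of degree less than `deg Q`, where `v a ≥ x`, up to
terms of value greater than `x + e`. -/
def Near (v : AddValuation K[X] (WithTop ℝ)) (Q : K[X]) (s e x : ℝ) (A : K[X]) : Prop :=
  ∃ a : K[X], a.degree < Q.degree ∧ (x : WithTop ℝ) ≤ v a ∧ InG v Q s (x + e) ∅ (A - a)

theorem near_of_degree_lt (hQ : Q.Monic) (ha : a.degree < Q.degree) (hx : (x : WithTop ℝ) ≤ v a) :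
    Near v Q s e x a :=
  ⟨a, ha, hx, by rw [_root_.sub_self]; exact inG_zero hQ⟩

theorem Near.add (hQ : Q.Monic) (hA : Near v Q s e x A) (hB : Near v Q s e x B) :
    Near v Q s e x (A + B) := by
  obtain ⟨a, ha, hxa, hA⟩ := hA
  obtain ⟨b, hb, hxb, hB⟩ := hB
  refine ⟨a + b, (degree_add_le _ _).trans_lt (max_lt ha hb), v.map_le_add hxa hxb, ?_⟩
  have := hA.add hQ hB
  convert this using 1
  ring

theorem Near.sum (hQ : Q.Monic) {ι : Type*} {t : Finset ι} {A : ι → K[X]}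
    (hA : ∀ i ∈ t, Near v Q s e x (A i)) : Near v Q s e x (∑ i ∈ t, A i) := by
  classical
  induction t using Finset.induction_on with
  | empty =>
    refine near_of_degree_lt hQ ?_ ?_
    · rw [Finset.sum_empty, degree_zero]
      exact bot_lt_iff_ne_bot.2 (degree_ne_bot.2 hQ.ne_zero)
    · simp [v.map_zero]
  | insert i t hi ih =>
    rw [Finset.sum_insert hi]
    exact (hA i (by simp)).add hQ (ih fun j hj => hA j (by simp [hj]))

/-- The product inequality is known at slope σ while errors are measured at slope s. Each reduction
gains s - σ, and this gain does not decrease when multiplications are repeated. -/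
theorem KeyPair.near_mul (hQ : KeyPair v Q σ) (hs : σ ≤ s) (hs' : (s : WithTop ℝ) ≤ v Q)
    (hA : Near v Q s (s - σ) x A) (hw : w.degree < Q.degree) (hy : (y : WithTop ℝ) ≤ v w) :
    Near v Q s (s - σ) (x + y) (A * w) := by
  obtain ⟨a, ha, hxa, hA⟩ := hA
  have hle := coe_le_mul hxa hy
  refine ⟨(a * w) %ₘ Q, degree_modByMonic_lt _ hQ.monic, ?_, ?_⟩
  · rwa [hQ.map_mod ha hw]
  · have h1 := hQ.inG_mul_degree_lt (s' := s) ha hw hle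
    have h2 := (hQ.mono hs hs').inG_mul (S'' := ∅) hA (inG_of_degree_lt hQ.monic hw hy) (by simp)
    have h3 := (h2.mono (c' := x + y + (s - σ)) (by linarith) subset_rfl).add hQ.monic h1
    convert h3 using 1
    ring

theorem KeyPair.near_mul_pow (hQ : KeyPair v Q σ) (hs : σ ≤ s) (hs' : (s : WithTop ℝ) ≤ v Q)
    (hA : Near v Q s (s - σ) x A) (hw : w.degree < Q.degree) (hy : (y : WithTop ℝ) ≤ v w) (i : ℕ) :
    Near v Q s (s - σ) (x + i * y) (A * w ^ i) := by
  induction i with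
  | zero => simpa using hA
  | succ i ih =>
    have := hQ.near_mul hs hs' ih hw hy
    rw [pow_succ, ← mul_assoc]
    convert this using 1
    push_cast; ring

theorem zero_le_natCast (v : AddValuation K[X] (WithTop ℝ)) (k : ℕ) :
    ((0 : ℝ) : WithTop ℝ) ≤ v (k : K[X]) := by
  induction k with
  | zero => simp [v.map_zero]
  | succ k ih =>
    rw [Nat.cast_succ]
    exact v.map_le_add ih (by simp [v.map_one])

theorem degree_natCast_lt (hQ : 0 < Q.natDegree) (k : ℕ) : (k : K[X]).degree < Q.degree := by
  rw [← C_eq_natCast]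
  exact degree_C_le.trans_lt (natDegree_pos_iff_degree_pos.1 hQ)

theorem KeyPair.near_natCast_mul (hQ : KeyPair v Q σ) (hs : σ ≤ s) (hs' : (s : WithTop ℝ) ≤ v Q)
    (hA : Near v Q s (s - σ) x A) (k : ℕ) : Near v Q s (s - σ) x (k * A) := by
  have := hQ.near_mul hs hs' hA (degree_natCast_lt hQ.pos k) (zero_le_natCast v k)
  rwa [add_zero, mul_comm] at this

end Near

end KeyPoly

namespace KeyPoly

/-! ### Binomial coefficients modulo p and leading digits. -/

section CharP

variable {K : Type*} [Field K] (p : ℕ) [Fact p.Prime] [CharP K p]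

/-- Compare the coefficients of X ^ (p ^ b) in (X + 1) ^ (p ^ b * u) = (X ^ (p ^ b) + 1) ^ u: the
binomial coefficient equals u in K. -/
theorem choose_prime_pow_mul_ne_zero (b : ℕ) {u : ℕ} (hu : ¬ p ∣ u) :
    (((p ^ b * u).choose (p ^ b) : ℕ) : K) ≠ 0 := by
  have h1 : ((X + 1 : K[X]) ^ (p ^ b * u)) = expand K (p ^ b) ((X + 1) ^ u) := by
    rw [pow_mul, add_pow_char_pow]
    simp
  have h2 := congrArg (fun g => g.coeff (p ^ b)) h1
  have hp : 0 < p ^ b := pow_pos (Fact.out : p.Prime).pos b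
  simp only [coeff_X_add_one_pow] at h2
  rw [coeff_expand hp, if_pos dvd_rfl, Nat.div_self hp, coeff_X_add_one_pow, Nat.choose_one_right]
    at h2
  rw [h2, Ne, CharP.cast_eq_zero_iff K p]
  exact hu

include p in
-- An inverse that is itself a natural number has value at least 0, so multiplying by it weakens no
-- bound.
theorem exists_natCast_mul_eq_one {k : ℕ} (hk : (k : K) ≠ 0) :
    ∃ k' : ℕ, ((k' : ℕ) : K[X]) * ((k : ℕ) : K[X]) = 1 := by
  have hp : p.Prime := Fact.out
  rw [Ne, CharP.cast_eq_zero_iff K p] at hk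
  obtain ⟨k', -, hk'⟩ := Nat.exists_mul_mod_eq_one_of_coprime
    ((Nat.Prime.coprime_iff_not_dvd hp).2 hk).symm hp.one_lt
  refine ⟨k', ?_⟩
  rw [← Nat.cast_mul, mul_comm, ← Nat.div_add_mod (k * k') p, hk']
  push_cast
  rw [CharP.cast_eq_zero K[X] p]
  simp

end CharP

section Leading

variable {K : Type*} [Field K] {P G : K[X]}

theorem digit_natDegree_eq_one (hP : P.Monic) (hpos : 0 < P.natDegree) {m : ℕ} (hG : G.Monic)
    (hdeg : G.natDegree = m * P.natDegree) : digit P G m = 1 := by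
  have h1 : G /ₘ P ^ m = 1 := by
    have h2 : (G /ₘ P ^ m).natDegree = 0 := by
      rw [natDegree_divByMonic _ (hP.pow m), hP.natDegree_pow, hdeg, Nat.sub_self]
    have h3 : (G /ₘ P ^ m).leadingCoeff = 1 := by
      rw [leadingCoeff_divByMonic_of_monic (hP.pow m), hG.leadingCoeff]
      rw [degree_eq_natDegree hG.ne_zero, degree_eq_natDegree (hP.pow m).ne_zero,
        hP.natDegree_pow, hdeg]
    exact (Monic.natDegree_eq_zero h3).1 h2
  rw [digit, h1, (modByMonic_eq_self_iff hP).2]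
  rw [degree_one]
  exact natDegree_pos_iff_degree_pos.1 hpos

theorem degree_sum_mul_pow_lt (hP : P.Monic) (g : ℕ → K[X]) (m : ℕ)
    (hg : ∀ j < m, (g j).degree < P.degree) :
    (∑ j ∈ Finset.range m, g j * P ^ j).degree < (P ^ m).degree := by
  induction m with
  | zero => simp
  | succ m ih =>
    rw [Finset.sum_range_succ]
    refine (degree_add_le _ _).trans_lt (max_lt ?_ ?_)
    · refine (ih fun j hj => hg j (by omega)).trans_le ?_
      rw [pow_succ, degree_mul]
      exact le_add_of_nonneg_right (zero_le_degree_iff.2 hP.ne_zero)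
    · rw [pow_succ, mul_comm, degree_mul, degree_mul]
      refine WithBot.add_lt_add_left ?_ (hg m (by omega))
      rw [Ne, degree_eq_bot]
      exact (hP.pow m).ne_zero

theorem monic_sum_mul_pow (hP : P.Monic) (g : ℕ → K[X]) (m : ℕ)
    (hg : ∀ j < m, (g j).degree < P.degree) (hm : g m = 1) :
    (∑ j ∈ Finset.range (m + 1), g j * P ^ j).Monic ∧
      (∑ j ∈ Finset.range (m + 1), g j * P ^ j).natDegree = m * P.natDegree := by
  have h := degree_sum_mul_pow_lt hP g m hg
  rw [Finset.sum_range_succ, hm, one_mul, add_comm]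
  refine ⟨(hP.pow m).add_of_left h, ?_⟩
  rw [natDegree_eq_of_degree_eq (degree_add_eq_left_of_degree_lt h), hP.natDegree_pow]

end Leading

/-! ### Sequences of key polynomials with values increasing to a limit. -/

section Limit

open Filter Topology

variable {K : Type*} [Field K] {v : AddValuation K[X] (WithTop ℝ)} {P : ℕ → K[X]} {β : ℕ → ℝ}
  {B : ℝ} {G h : K[X]} {c : ℝ} {r m t₀ : ℕ}

/-- A sequence of polynomials of the same degree, with strictly increasing values `β t`
converging to `B`. -/
structure LimSeq (v : AddValuation K[X] (WithTop ℝ)) (P : ℕ → K[X]) (β : ℕ → ℝ) (B : ℝ) :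
    Prop where
  key : ∀ t, KeyPair v (P t) (β 0)
  val : ∀ t, v (P t) = β t
  strictMono : StrictMono β
  tendsto : Tendsto β atTop (𝓝 B)
  degree_sub_lt : ∀ t t', (P t - P t').degree < (P 0).degree

/-- There is a monic polynomial of degree `m` in `P t` whose values along the sequence are those of
`P t ^ m`. -/
def Deep (v : AddValuation K[X] (WithTop ℝ)) (P : ℕ → K[X]) (β : ℕ → ℝ) (m : ℕ) : Prop :=
  ∃ (G : K[X]) (t₀ : ℕ), G.Monic ∧ G.natDegree = m * (P 0).natDegree ∧
    ∀ t ≥ t₀, InG v (P t) (β t) (m * β t) Set.univ G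

theorem InG.raise {Q : K[X]} {s s' : ℝ} (hs : s ≤ s') (hh : InG v Q s c Set.univ h) :
    InG v Q s' c Set.univ h := fun j =>
  ⟨coe_le_trans (hh j).1 (by
    have : (j : ℝ) * s ≤ j * s' := mul_le_mul_of_nonneg_left hs (Nat.cast_nonneg j)
    linarith), fun hj => absurd (Set.mem_univ j) hj⟩

namespace LimSeq

variable (H : LimSeq v P β B)
include H

theorem lt_lim (t : ℕ) : β t < B :=
  (H.strictMono (Nat.lt_succ_self t)).trans_le
    (H.strictMono.monotone.ge_of_tendsto H.tendsto _)

theorem degree_eq (t : ℕ) : (P t).degree = (P 0).degree := by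
  have := degree_add_eq_left_of_degree_lt (H.degree_sub_lt t 0)
  rwa [_root_.add_sub_cancel] at this

theorem natDegree_eq (t : ℕ) : (P t).natDegree = (P 0).natDegree :=
  natDegree_eq_of_degree_eq (H.degree_eq t)

theorem keyAt {t t' : ℕ} (h : t' ≤ t) : KeyPair v (P t) (β t') :=
  (H.key t).mono (H.strictMono.monotone (Nat.zero_le t')) (by
    rw [H.val, WithTop.coe_le_coe]
    exact H.strictMono.monotone h)

theorem le_val_sub {t t' : ℕ} (h : t ≤ t') : (β t : WithTop ℝ) ≤ v (P t' - P t) := by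
  refine v.map_le_sub ?_ (H.val t).ge
  rw [H.val, WithTop.coe_le_coe]
  exact H.strictMono.monotone h

theorem degree_sub_lt' (t t' t'' : ℕ) : (P t - P t').degree < (P t'').degree := by
  rw [H.degree_eq t'']
  exact H.degree_sub_lt t t'

/-- The left side tends to 0, the right side to B - β t₀ > 0. Thus a gain of one slope difference
outweighs N times the distance left to the limit. -/
theorem eventually_gap (N : ℝ) (t₀ : ℕ) : ∀ᶠ t in atTop, N * (B - β t) ≤ β t - β t₀ := by
  have h1 : Tendsto (fun t => N * (B - β t) - (β t - β t₀)) atTop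
      (𝓝 (N * (B - B) - (B - β t₀))) :=
    ((tendsto_const_nhds.sub H.tendsto).const_mul N).sub (H.tendsto.sub tendsto_const_nhds)
  have h2 : N * (B - B) - (B - β t₀) < 0 := by
    have := H.lt_lim t₀
    linarith
  filter_upwards [h1.eventually (gt_mem_nhds h2)] with t ht
  linarith

theorem le_of_forall {k : ℝ} (hh : ∀ t ≥ t₀, ((c + k * β t : ℝ) : WithTop ℝ) ≤ v h) :
    ((c + k * B : ℝ) : WithTop ℝ) ≤ v h := by
  cases hv : v h with
  | top => exact le_top
  | coe x =>
    rw [WithTop.coe_le_coe]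
    refine le_of_tendsto ((H.tendsto.const_mul k).const_add c) ?_
    filter_upwards [eventually_ge_atTop t₀] with t ht
    have := hh t ht
    rwa [hv, WithTop.coe_le_coe] at this

theorem inG_translate {t₁ t₂ t : ℕ} (h₁ : t ≤ t₁) (h₂ : t ≤ t₂)
    (hh : InG v (P t₁) (β t) c Set.univ h) : InG v (P t₂) (β t) c Set.univ h := by
  refine (H.keyAt h₁).inG_translate (H.keyAt h₂) (H.degree_sub_lt' _ _ _) ?_ (by simp) hh
  refine v.map_le_sub ?_ ?_
  · rw [H.val, WithTop.coe_le_coe]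
    exact H.strictMono.monotone h₂
  · rw [H.val, WithTop.coe_le_coe]
    exact H.strictMono.monotone h₁

theorem top_translate {t t' : ℕ} (htt : t ≤ t') (hh : Top v (P t) (β t) c r h) :
    Top v (P t') (β t) c r h :=
  (H.keyAt le_rfl).top_translate (H.keyAt htt) (H.degree_sub_lt' _ _ _) (H.le_val_sub htt) hh

/-- Translation keeps the top index and raising the slope cannot increase it, so an index minimal
over all t persists, with a top digit of constant value. -/
theorem exists_forall_top (hh : h ≠ 0) :
    ∃ (r : ℕ) (c : ℝ) (t₀ : ℕ), ∀ t ≥ t₀, Top v (P t) (β t) (c + r * β t) r h := by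
  classical
  have hex : ∃ r : ℕ, ∃ (t : ℕ) (c : ℝ), Top v (P t) (β t) c r h := by
    obtain ⟨c, r, hr⟩ := (H.keyAt (le_refl 0)).exists_top hh
    exact ⟨r, 0, c, hr⟩
  obtain ⟨t₀, c₀, h₀⟩ := Nat.find_spec hex
  set r := Nat.find hex with hr
  refine ⟨r, c₀ - r * β t₀, t₀, fun t ht => ?_⟩
  obtain ⟨c', r', h'⟩ := (H.keyAt (le_refl t)).exists_top hh
  have hle : r ≤ r' := Nat.find_min' hex ⟨t, c', h'⟩
  have h₁ := H.top_translate ht h₀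
  have hββ := H.strictMono.monotone ht
  rcases hle.eq_or_lt with heq | hlt
  · rw [← heq] at h'
    have e1 := h₁.digit_eq
    rw [h'.digit_eq, WithTop.coe_inj] at e1
    convert h' using 1
    linarith
  · exfalso
    have e1 := (h'.1 r).1
    rw [h₁.digit_eq, WithTop.coe_le_coe] at e1
    have e2 := (h₁.1 r').2 (by simpa using hlt)
    rw [h'.digit_eq, WithTop.coe_lt_coe] at e2
    have e3 : (r : ℝ) + 1 ≤ r' := by exact_mod_cast hlt
    nlinarith

/-- Cut h after the r-th power of P t₁ and multiply by an inverse of the top digit modulo P t₁. For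
t₁ late enough, the discarded terms and the reduction errors have Gauss value at least r * B, hence
are harmless at every later slope. -/
theorem deep_of_top (hh : ∀ t ≥ t₀, Top v (P t) (β t) (c + r * β t) r h) : Deep v P β r := by
  obtain ⟨t₁, hgap, ht₁⟩ := ((H.eventually_gap r t₀).and (eventually_ge_atTop t₀)).exists
  have hQ := H.keyAt (le_refl t₁)
  have hQ₀ := H.key t₁
  set Q := P t₁ with hQdef
  have h0 : β 0 ≤ β t₀ := H.strictMono.monotone (Nat.zero_le _)
  have h01 : β t₀ ≤ β t₁ := H.strictMono.monotone ht₁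
  have hT₁ := hh t₁ ht₁
  have hT₀ := H.top_translate ht₁ (hh t₀ le_rfl)
  set g := digit Q h with hg
  have hgd : ∀ j, (g j).degree < Q.degree := degree_digit_lt hQ.monic h
  have hvg : v (g r) = c := by
    rw [hg, hT₁.digit_eq]
    congr 1
    ring
  have hgr : g r ≠ 0 := by
    intro h0
    rw [h0, v.map_zero] at hvg
    exact WithTop.top_ne_coe hvg
  obtain ⟨b, hbd, hbmod, hvb⟩ := hQ.exists_inv hgr (hgd r)
  have hvb' : v b = ((-c : ℝ) : WithTop ℝ) := by
    cases hv : v b with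
    | top => rw [hv, top_add] at hvb; exact absurd hvb WithTop.top_ne_zero
    | coe x =>
      rw [hv, hvg] at hvb
      norm_cast at hvb ⊢
      linarith
  set D' := ∑ j ∈ Finset.range (r + 1), g j * Q ^ j with hD'
  have hd' : ∀ j, digit Q (h - D') j = if j ≤ r then 0 else g j := fun j => by
    rw [digit_sub hQ.monic, hD', digit_sum hQ.monic]
    simp_rw [digit_mul_pow hQ.monic (hgd _)]
    rw [Finset.sum_ite_eq]
    split_ifs with h1 h2 h2
    · exact _root_.sub_self _
    · rw [Finset.mem_range] at h1; omega
    · rw [Finset.mem_range] at h1; omega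
    · exact _root_.sub_zero _
  -- For j ≥ r + 1, replacing the slope β t₀ by β t₁ gains at least β t₁ - β t₀ over index r, which
  -- covers r * (B - β t₁) by hgap.
  have hrest : InG v Q (β t₁) (c + r * B) Set.univ (h - D') := fun j => by
    rw [hd']
    refine ⟨?_, fun hj => absurd (Set.mem_univ j) hj⟩
    split_ifs with hj
    · rw [v.map_zero]; exact le_top
    · refine coe_le_trans (hT₀.1 j).1 ?_
      have : (r : ℝ) + 1 ≤ j := by exact_mod_cast not_le.1 hj
      nlinarith
  set A : ℕ → K[X] := fun j => (b * g j) %ₘ Q with hA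
  have hAd : ∀ j, (A j).degree < Q.degree := fun j => degree_modByMonic_lt _ hQ.monic
  obtain ⟨hGm, hGd⟩ := monic_sum_mul_pow hQ.monic A r (fun j _ => hAd j) hbmod
  set G := ∑ j ∈ Finset.range (r + 1), A j * Q ^ j with hG
  have herr : InG v Q (β t₁) (r * B) Set.univ (b * D' - G) := by
    rw [hD', hG, Finset.mul_sum, ← Finset.sum_sub_distrib]
    refine InG.sum hQ.monic fun j _ => ?_
    rw [show b * (g j * Q ^ j) - A j * Q ^ j = (b * g j - A j) * Q ^ j by ring]
    have h1 := coe_le_mul hvb'.ge (hT₁.1 j).1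
    have h2 := hQ₀.inG_mul_degree_lt (s' := β t₁) hbd (hgd j) h1
    have h3 := hQ.mul_pow_inG (S' := Set.univ) (i := j) h2 (by simp)
    refine h3.mono ?_ subset_rfl
    nlinarith
  have hbG : InG v Q (β t₁) (r * B) Set.univ (b * h - G) := by
    have h1 := (hQ.inG_mul (S'' := Set.univ) (inG_of_degree_lt hQ.monic hbd hvb'.ge) hrest
      (by simp)).mono (c' := r * B) (by linarith) subset_rfl
    convert h1.add hQ.monic herr using 1
    ring
  refine ⟨G, t₁, hGm, by rw [hGd, H.natDegree_eq], fun t ht => ?_⟩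
  have hQt := H.keyAt (le_refl t)
  have h1 : InG v (P t) (β t) (r * β t) Set.univ (b * h - G) := by
    refine ((H.inG_translate le_rfl ht hbG).raise (H.strictMono.monotone ht)).mono ?_
      subset_rfl
    exact mul_le_mul_of_nonneg_left (H.lt_lim t).le (Nat.cast_nonneg r)
  have hbt : b.degree < (P t).degree := by
    rwa [H.degree_eq t, ← H.degree_eq t₁]
  have h2 : InG v (P t) (β t) (r * β t) Set.univ (b * h) :=
    (hQt.inG_mul (S'' := Set.univ) (inG_of_degree_lt hQt.monic hbt hvb'.ge)
      (hh t (ht₁.trans ht)).inG (by simp)).mono (by linarith) subset_rfl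
  have := h2.sub hQt.monic h1
  rwa [sub_sub_cancel] at this

/-- Below the least degree of a `Deep` polynomial, values are eventually computed by constant
digits. -/
theorem exists_forall_top_zero (hmin : ∀ r, 0 < r → r < m → ¬ Deep v P β r) (hh : h ≠ 0)
    (hdeg : h.natDegree < m * (P 0).natDegree) :
    ∃ (c : ℝ) (t₀ : ℕ), v h = c ∧ ∀ t ≥ t₀, Top v (P t) (β t) c 0 h := by
  obtain ⟨r, c, t₀, hT⟩ := H.exists_forall_top hh
  -- A positive index r would be a `Deep` degree, and the bound on the degree of h forces r < m.
  have hr : r = 0 := by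
    by_contra hr
    refine hmin r (Nat.pos_of_ne_zero hr) ?_ (H.deep_of_top hT)
    by_contra hrm
    have h1 := (hT t₀ le_rfl).digit_eq
    rw [digit_eq_zero (H.key t₀).monic, v.map_zero] at h1
    · exact WithTop.top_ne_coe h1
    · rw [H.natDegree_eq]
      exact hdeg.trans_le (Nat.mul_le_mul_right _ (not_lt.1 hrm))
  subst hr
  simp only [Nat.cast_zero, zero_mul, _root_.add_zero] at hT
  exact ⟨c, t₀, (H.keyAt le_rfl).top_zero (hT t₀ le_rfl), hT⟩

/-- This carries the induction across a limit step. Below the degree of G the top index is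
eventually 0, while G has top index m with digit 1; m * β t < m * B ≤ v G is the strict inequality
required by `KeyPair.mul_lt_of_top`. -/
theorem keyPair_of_deep (hm : 0 < m) (hmin : ∀ r, 0 < r → r < m → ¬ Deep v P β r)
    (hfin : ∀ a : K[X], a ≠ 0 → a.natDegree < m * (P 0).natDegree → v a ≠ ⊤)
    (hG : G.Monic) (hdeg : G.natDegree = m * (P 0).natDegree) (hle : ((m * B : ℝ) : WithTop ℝ) ≤ v G)
    {s : ℝ} (hs : v G = s) : KeyPair v G s := by
  have hd := (H.key 0).pos
  have hone : ∀ t, digit (P t) G m = 1 := fun t =>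
    digit_natDegree_eq_one (H.key t).monic (H.key t).pos hG (by rw [hdeg, H.natDegree_eq t])
  have hTG : ∃ t₀, ∀ t ≥ t₀, Top v (P t) (β t) (m * β t) m G := by
    obtain ⟨r, c, t₀, hT⟩ := H.exists_forall_top hG.ne_zero
    have hr : r ≤ m := by
      by_contra hrm
      have h1 := (hT t₀ le_rfl).digit_eq
      rw [digit_eq_zero (H.key t₀).monic, v.map_zero] at h1
      · exact WithTop.top_ne_coe h1
      · rw [H.natDegree_eq, hdeg]
        exact Nat.mul_lt_mul_of_pos_right (not_le.1 hrm) hd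
    -- Index 0 would give v G = c, whereas the digit 1 at index m gives c ≤ m * β t₀ < m * B ≤ v G.
    have hr0 : r ≠ 0 := by
      rintro rfl
      have h1 := (H.keyAt le_rfl).top_zero (by simpa using hT t₀ le_rfl)
      have h2 := ((hT t₀ le_rfl).1 m).1
      rw [hone, v.map_one] at h2
      rw [h1, WithTop.coe_le_coe] at hle
      norm_cast at h2
      have h3 := H.lt_lim t₀
      have h4 : (0 : ℝ) < m := by exact_mod_cast hm
      nlinarith
    have hrm : r = m := by
      by_contra hne
      exact hmin r (Nat.pos_of_ne_zero hr0) (lt_of_le_of_ne hr hne) (H.deep_of_top hT)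
    subst hrm
    refine ⟨t₀, fun t ht => ?_⟩
    have h1 := (hT t ht).digit_eq
    rw [hone, v.map_one] at h1
    norm_cast at h1
    convert hT t ht using 1
    linarith
  obtain ⟨t₀, hTG⟩ := hTG
  refine ⟨hG, by rw [hdeg]; positivity, hs.ge, fun a ha hda => hfin a ha ?_, ?_⟩
  · rw [← hdeg]
    exact natDegree_lt_natDegree ha hda
  intro a b ha hb hda hdb
  have hda' := natDegree_lt_natDegree ha hda
  have hdb' := natDegree_lt_natDegree hb hdb
  obtain ⟨ca, ta, hva, hTa⟩ := H.exists_forall_top_zero hmin ha (hdeg ▸ hda')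
  obtain ⟨cb, tb, hvb, hTb⟩ := H.exists_forall_top_zero hmin hb (hdeg ▸ hdb')
  have hqd : (a * b /ₘ G).natDegree < m * (P 0).natDegree := by
    rw [natDegree_divByMonic _ hG, natDegree_mul ha hb]
    omega
  have hq : ∃ tq, ∀ t ≥ tq, a * b /ₘ G ≠ 0 → ∃ (cq : ℝ) (rq : ℕ),
      Top v (P t) (β t) cq rq (a * b /ₘ G) ∧ v (a * b /ₘ G) = cq := by
    by_cases hq0 : a * b /ₘ G = 0
    · exact ⟨0, fun t _ h => absurd hq0 h⟩
    obtain ⟨cq, tq, hvq, hTq⟩ := H.exists_forall_top_zero hmin hq0 hqd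
    exact ⟨tq, fun t ht _ => ⟨cq, 0, hTq t ht, hvq⟩⟩
  obtain ⟨tq, hq⟩ := hq
  obtain ⟨t, h1, h2, h3, h4⟩ : ∃ t, t₀ ≤ t ∧ ta ≤ t ∧ tb ≤ t ∧ tq ≤ t :=
    ⟨t₀ + ta + tb + tq, by omega, by omega, by omega, by omega⟩
  refine (H.keyAt (le_refl t)).mul_lt_of_top hG (by rw [hdeg, H.natDegree_eq t]) hm (hTG t h1) ?_
    (hTa t h2).inG hva (hTb t h3).inG hvb (hq t h4)
  have h5 := hle
  rw [hs, WithTop.coe_le_coe] at h5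
  refine lt_of_lt_of_le ?_ h5
  exact mul_lt_mul_of_pos_left (H.lt_lim t) (by exact_mod_cast hm)

end LimSeq

end Limit

end KeyPoly

namespace KeyPoly

/-! ### Reading off coefficients that are only close to digits. -/

section Extract

variable {K : Type*} [Field K] {v : AddValuation K[X] (WithTop ℝ)} {Q : K[X]} {s e C : ℝ}

/-- By hC, replacing each A i by its approximation changes the sum only by terms within the bound C;
the approximations are the digits of the new sum. -/
theorem KeyPair.inG_coeff (hQ : KeyPair v Q s) {N : ℕ} {A : ℕ → K[X]} {x : ℕ → ℝ}
    (hA : ∀ i < N, Near v Q s e (x i) (A i)) (hC : ∀ i < N, C ≤ x i + e + i * s)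
    (h : InG v Q s C Set.univ (∑ i ∈ Finset.range N, A i * Q ^ i)) {i : ℕ} (hi : i < N) :
    InG v Q s (C - i * s) Set.univ (A i) := by
  choose! a ha hxa hAa using hA
  have h1 : InG v Q s C Set.univ (∑ j ∈ Finset.range N, (A j - a j) * Q ^ j) := by
    refine InG.sum hQ.monic fun j hj => ?_
    rw [Finset.mem_range] at hj
    exact (hQ.mul_pow_inG (S' := Set.univ) (hAa j hj) (by simp)).mono (hC j hj) subset_rfl
  have h2 := h.sub hQ.monic h1
  rw [← Finset.sum_sub_distrib] at h2
  have h3 := (h2 i).1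
  rw [digit_sum hQ.monic, Finset.sum_eq_single i] at h3
  · rw [← sub_mul, sub_sub_cancel, digit_mul_pow hQ.monic (ha i hi), if_pos rfl] at h3
    have h4 := (inG_of_degree_lt (s := s) hQ.monic (ha i hi) h3).mono (S' := Set.univ) le_rfl
      (Set.subset_univ _)
    have h5 := h4.add hQ.monic ((hAa i hi).mono (c' := C - i * s) (by linarith [hC i hi])
      (Set.subset_univ _))
    rwa [_root_.add_sub_cancel] at h5
  · intro j hj hji
    rw [Finset.mem_range] at hj
    rw [← sub_mul, sub_sub_cancel, digit_mul_pow hQ.monic (ha j hj), if_neg (Ne.symm hji)]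
  · intro hi'
    exact absurd (Finset.mem_range.2 hi) hi'

theorem KeyPair.inG_natCast_mul (hQ : KeyPair v Q s) {S : Set ℕ} {h : K[X]} {c : ℝ}
    (hh : InG v Q s c S h) (k : ℕ) : InG v Q s c S (k * h) := by
  have := hQ.inG_mul (S'' := S) (inG_of_degree_lt hQ.monic (degree_natCast_lt hQ.pos k)
    (zero_le_natCast v k)) hh (by simp)
  rwa [zero_add] at this

end Extract

/-! ### Hasse derivatives and weakly affine polynomials. -/

section Taylor

open Filter Topology

variable {K : Type*} [Field K] {v : AddValuation K[X] (WithTop ℝ)} {P : ℕ → K[X]} {β : ℕ → ℝ}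
  {B : ℝ} {G : K[X]} {m t₀ t : ℕ}

/-- The expansion of `G` in powers of `Q`, as a polynomial with coefficients in `K[X]`. -/
noncomputable def expansion (Q G : K[X]) (m : ℕ) : K[X][X] :=
  ∑ j ∈ Finset.range (m + 1), monomial j (digit Q G j)

theorem expansion_coeff (Q : K[X]) {j : ℕ} (hj : j ≤ m) :
    (expansion Q G m).coeff j = digit Q G j := by
  rw [expansion, finsetSum_coeff]
  simp_rw [coeff_monomial]
  rw [Finset.sum_ite_eq' , if_pos (Finset.mem_range.2 (by omega))]

theorem natDegree_expansion_le (Q G : K[X]) (m : ℕ) : (expansion Q G m).natDegree ≤ m := by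
  refine natDegree_sum_le_of_forall_le _ _ fun j hj => ?_
  rw [Finset.mem_range] at hj
  exact (natDegree_monomial_le _).trans (by omega)

theorem eval_hasseDeriv_expansion (Q w : K[X]) (k : ℕ) :
    (hasseDeriv k (expansion Q G m)).eval w =
      ∑ j ∈ Finset.range (m + 1), (j.choose k : K[X]) * digit Q G j * w ^ (j - k) := by
  rw [expansion, map_sum, eval_finsetSum]
  refine Finset.sum_congr rfl fun j _ => ?_
  rw [hasseDeriv_monomial, eval_monomial]

/-- The Taylor coefficients at `Q - P` of the expansion of `G` in powers of `Q`. -/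
noncomputable def taylorCoeff (Q G : K[X]) (m : ℕ) (P : K[X]) (i : ℕ) : K[X] :=
  (hasseDeriv i (expansion Q G m)).eval (Q - P)

/-- Taylor's formula at Q - P with increment P, and the composition rule for Hasse derivatives. For
k = 0 it turns the expansion in Q into one in P with coefficients that are not exactly digits. -/
theorem eval_hasseDeriv_eq_sum (Q G P : K[X]) {k : ℕ} (hk : k ≤ m) :
    (hasseDeriv k (expansion Q G m)).eval Q = ∑ i ∈ Finset.range (m - k + 1),
      ((i + k).choose k : K[X]) * taylorCoeff Q G m P (i + k) * P ^ i := by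
  have h1 : (hasseDeriv k (expansion Q G m)).eval Q =
      (taylor (Q - P) (hasseDeriv k (expansion Q G m))).eval P := by
    rw [taylor_eval, _root_.add_sub_cancel]
  have h2 : (taylor (Q - P) (hasseDeriv k (expansion Q G m))).natDegree < m - k + 1 := by
    rw [natDegree_taylor]
    have := natDegree_hasseDeriv_le (expansion Q G m) k
    have := natDegree_expansion_le Q G m
    omega
  rw [h1, eval_eq_sum_range' h2]
  refine Finset.sum_congr rfl fun i _ => ?_
  rw [taylor_coeff, ← LinearMap.comp_apply, hasseDeriv_comp, LinearMap.smul_apply,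
    ← Nat.cast_smul_eq_nsmul K[X], eval_smul, _root_.smul_eq_mul, taylorCoeff, Nat.choose_symm_add]

namespace LimSeq

variable (H : LimSeq v P β B)
include H

/-- Each summand is an integer times a digit times a power of P t₀ - P t, all factors of degree less
than deg (P t); only reduction errors, with gain s - β 0, occur. -/
theorem near_taylorCoeff (hG : InG v (P t₀) (β t₀) (m * β t₀) Set.univ G) (ht : t₀ ≤ t)
    {s : ℝ} (hs : β 0 ≤ s) (hs' : s ≤ β t) (i : ℕ) :
    Near v (P t) s (s - β 0) ((m - i) * β t₀) (taylorCoeff (P t₀) G m (P t) i) := by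
  have hs'' : (s : WithTop ℝ) ≤ v (P t) := by
    rw [H.val]
    exact WithTop.coe_le_coe.2 hs'
  have hQ := H.key t
  rw [taylorCoeff, eval_hasseDeriv_expansion]
  refine Near.sum hQ.monic fun j _ => ?_
  rcases lt_or_ge j i with hji | hij
  · rw [Nat.choose_eq_zero_of_lt hji, Nat.cast_zero, zero_mul, zero_mul]
    refine near_of_degree_lt hQ.monic ?_ (by rw [v.map_zero]; exact le_top)
    rw [degree_zero]
    exact bot_lt_iff_ne_bot.2 (degree_ne_bot.2 hQ.monic.ne_zero)
  rw [mul_assoc]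
  refine hQ.near_natCast_mul hs hs'' ?_ _
  have hd : (digit (P t₀) G j).degree < (P t).degree := by
    rw [H.degree_eq t, ← H.degree_eq t₀]
    exact degree_digit_lt (H.key t₀).monic G j
  have hw : (β t₀ : WithTop ℝ) ≤ v (P t₀ - P t) := by
    rw [v.map_sub_swap]
    exact H.le_val_sub ht
  have := hQ.near_mul_pow hs hs'' (near_of_degree_lt hQ.monic hd (hG j).1)
    (H.degree_sub_lt' t₀ t t) hw (j - i)
  convert this using 1
  rw [Nat.cast_sub hij]
  ring

theorem eval_expansion (hdeg : G.natDegree = m * (P 0).natDegree) :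
    (hasseDeriv 0 (expansion (P t₀) G m)).eval (P t₀) = G := by
  rw [eval_hasseDeriv_expansion]
  simp only [Nat.choose_zero_right, Nat.cast_one, one_mul, Nat.sub_zero]
  refine sum_digit (H.key t₀).monic ?_
  rw [hdeg, H.natDegree_eq t₀]
  exact Nat.mul_lt_mul_of_pos_right (Nat.lt_succ_self m) (H.key 0).pos

/-- The bound m * β t on G passes to its coefficients because the gain β t - β 0 is at least (m - i)
* (β t - β t₀), by hgap. -/
theorem inG_taylorCoeff (hdeg : G.natDegree = m * (P 0).natDegree)
    (hG : ∀ t ≥ t₀, InG v (P t) (β t) (m * β t) Set.univ G)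
    (hgap : m * (B - β t₀) ≤ β t₀ - β 0) (ht : t₀ ≤ t) {i : ℕ} (hi : i ≤ m) :
    InG v (P t) (β t) ((m - i) * β t) Set.univ (taylorCoeff (P t₀) G m (P t) i) := by
  have h1 := eval_hasseDeriv_eq_sum (P t₀) G (P t) (Nat.zero_le m)
  rw [H.eval_expansion hdeg] at h1
  have h2 := hG t ht
  rw [h1] at h2
  have h3 : β t₀ ≤ β t := H.strictMono.monotone ht
  have h0 : β 0 ≤ β t := H.strictMono.monotone (Nat.zero_le t)
  have h4 := (H.keyAt (le_refl t)).inG_coeff (e := β t - β 0)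
    (x := fun i => (m - i) * β t₀) (fun i _ => ?_) (fun i hi => ?_) h2 (Nat.lt_succ_of_le hi)
  · simp only [_root_.add_zero, Nat.choose_zero_right, Nat.cast_one, one_mul] at h4
    convert h4 using 1
    ring
  · simp only [_root_.add_zero, Nat.choose_zero_right, Nat.cast_one, one_mul]
    exact H.near_taylorCoeff (hG t₀ le_rfl) ht h0 le_rfl i
  · have h5 : (0 : ℝ) ≤ m := Nat.cast_nonneg m
    have h6 : (0 : ℝ) ≤ i := Nat.cast_nonneg i
    have h7 := H.lt_lim t
    nlinarith [mul_nonneg h6 (sub_nonneg.2 h3), mul_nonneg h5 (sub_nonneg.2 h7.le)]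

/-- Differentiation multiplies the coefficients by integers, of value at least 0, and lowers the
index by k. -/
theorem inG_hasseDeriv (hdeg : G.natDegree = m * (P 0).natDegree)
    (hG : ∀ t ≥ t₀, InG v (P t) (β t) (m * β t) Set.univ G)
    (hgap : m * (B - β t₀) ≤ β t₀ - β 0) (ht : t₀ ≤ t) {k : ℕ} (hk : k ≤ m) :
    InG v (P t) (β t) ((m - k) * β t) Set.univ
      ((hasseDeriv k (expansion (P t₀) G m)).eval (P t₀)) := by
  rw [eval_hasseDeriv_eq_sum (P t₀) G (P t) hk]
  have hQ := H.keyAt (le_refl t)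
  refine InG.sum hQ.monic fun i hi => ?_
  rw [Finset.mem_range] at hi
  have h1 := hQ.inG_natCast_mul (H.inG_taylorCoeff hdeg hG hgap ht (i := i + k) (by omega))
    ((i + k).choose k)
  refine (hQ.mul_pow_inG (S' := Set.univ) h1 (by simp)).mono ?_ subset_rfl
  push_cast
  linarith

theorem exists_gap (hG : ∀ t ≥ t₀, InG v (P t) (β t) (m * β t) Set.univ G) :
    ∃ t₁, (∀ t ≥ t₁, InG v (P t) (β t) (m * β t) Set.univ G) ∧
      m * (B - β t₁) ≤ β t₁ - β 0 := by
  obtain ⟨t₁, h1, h2⟩ := ((H.eventually_gap m 0).and (eventually_ge_atTop t₀)).exists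
  exact ⟨t₁, fun t ht => hG t (h2.trans ht), h1⟩

theorem digit_eq_one (hGm : G.Monic) (hdeg : G.natDegree = m * (P 0).natDegree) (t : ℕ) :
    digit (P t) G m = 1 :=
  digit_natDegree_eq_one (H.key t).monic (H.key t).pos hGm (by rw [hdeg, H.natDegree_eq t])

/-- With q the p-part of m, the Hasse derivative of order m - q has degree q in P t₀ and leading
coefficient binom(m, q), invertible in K. Consequently the least positive `Deep` degree is a power
of p. -/
theorem deep_prime_pow (p : ℕ) [Fact p.Prime] [CharP K p] (hm : 0 < m) (hD : Deep v P β m) :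
    Deep v P β (p ^ padicValNat p m) := by
  have hp : p.Prime := Fact.out
  obtain ⟨G, t₀, hGm, hdeg, hG⟩ := hD
  obtain ⟨t₀, hG, hgap⟩ := H.exists_gap hG
  obtain ⟨u, hu⟩ : p ^ padicValNat p m ∣ m := pow_padicValNat_dvd
  set q := p ^ padicValNat p m with hq
  have hpu : ¬ p ∣ u := by
    rintro ⟨u', rfl⟩
    refine pow_succ_padicValNat_not_dvd (p := p) hm.ne' ⟨u', ?_⟩
    rw [pow_succ, mul_assoc]
    exact hu
  have hqm : q ≤ m := Nat.le_of_dvd hm ⟨u, hu⟩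
  have hchoose : ((m.choose (m - q) : ℕ) : K) ≠ 0 := by
    rw [Nat.choose_symm hqm, hu]
    exact choose_prime_pow_mul_ne_zero p _ hpu
  obtain ⟨k', hk'⟩ := exists_natCast_mul_eq_one p hchoose
  set D := (hasseDeriv (m - q) (expansion (P t₀) G m)).eval (P t₀) with hDdef
  have hQ₀ := H.key t₀
  -- With P = Q = P t₀ the Taylor coefficients are the digits themselves.
  have hD : (k' : K[X]) * D = ∑ i ∈ Finset.range (q + 1),
      ((k' : K[X]) * (((i + (m - q)).choose (m - q) : ℕ) * digit (P t₀) G (i + (m - q)))) *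
        P t₀ ^ i := by
    rw [hDdef, eval_hasseDeriv_eq_sum (P t₀) G (P t₀) (Nat.sub_le m q), Finset.mul_sum,
      show m - (m - q) + 1 = q + 1 by omega]
    refine Finset.sum_congr rfl fun i hi => ?_
    rw [Finset.mem_range] at hi
    rw [taylorCoeff, _root_.sub_self, ← coeff_zero_eq_eval_zero, hasseDeriv_coeff, zero_add,
      Nat.choose_self, Nat.cast_one, one_mul, expansion_coeff _ (by omega)]
    ring
  have hmon := monic_sum_mul_pow hQ₀.monic
    (fun i => (k' : K[X]) * (((i + (m - q)).choose (m - q) : ℕ) * digit (P t₀) G (i + (m - q)))) q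
    (fun i _ => ?_) ?_
  · rw [← hD] at hmon
    refine ⟨(k' : K[X]) * D, t₀, hmon.1, by rw [hmon.2, H.natDegree_eq], fun t ht => ?_⟩
    have := (H.keyAt (le_refl t)).inG_natCast_mul
      (H.inG_hasseDeriv hdeg hG hgap ht (Nat.sub_le m q)) k'
    refine this.mono ?_ subset_rfl
    rw [Nat.cast_sub hqm]
    linarith
  · have hd := degree_digit_lt hQ₀.monic G (i + (m - q))
    rw [← mul_assoc, ← Nat.cast_mul, ← C_eq_natCast]
    refine lt_of_le_of_lt ?_ hd
    rw [degree_mul]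
    exact (add_le_add degree_C_le le_rfl).trans (by rw [zero_add])
  · rw [show q + (m - q) = m by omega, H.digit_eq_one hGm hdeg, mul_one, hk']

/-- The coefficients whose index is not a power of `p` are eventually negligible. -/
theorem eventually_taylorCoeff (p : ℕ) [Fact p.Prime] [CharP K p]
    (hmin : ∀ r, 0 < r → r < m → ¬ Deep v P β r) (hdeg : G.natDegree = m * (P 0).natDegree)
    (hG : ∀ t ≥ t₀, InG v (P t) (β t) (m * β t) Set.univ G)
    (hgap : m * (B - β t₀) ≤ β t₀ - β 0) {j : ℕ} (hj : 0 < j) (hjm : j < m)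
    (hjp : ¬ ∃ k : ℕ, j = p ^ k) :
    ∀ᶠ t in atTop, ((m * B - j * β t : ℝ) : WithTop ℝ) ≤
      v (taylorCoeff (P t₀) G m (P t) j) := by
  have hp : p.Prime := Fact.out
  obtain ⟨u, hu⟩ : p ^ padicValNat p j ∣ j := pow_padicValNat_dvd
  set q := p ^ padicValNat p j with hq
  have hpu : ¬ p ∣ u := by
    rintro ⟨u', rfl⟩
    refine pow_succ_padicValNat_not_dvd (p := p) hj.ne' ⟨u', ?_⟩
    rw [pow_succ, mul_assoc]
    exact hu
  have hq0 : 0 < q := pow_pos hp.pos _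
  have hqj : q < j := lt_of_le_of_ne (Nat.le_of_dvd hj ⟨u, hu⟩) fun h => hjp ⟨_, h.symm⟩
  have hchoose : ((j.choose q : ℕ) : K) ≠ 0 := by
    rw [hu]
    exact choose_prime_pow_mul_ne_zero p _ hpu
  obtain ⟨k', hk'⟩ := exists_natCast_mul_eq_one p hchoose
  -- In D the coefficient of index j reappears at index j - q, multiplied by the invertible integer
  -- binom(j, q).
  set D := (hasseDeriv q (expansion (P t₀) G m)).eval (P t₀) with hDdef
  have hQ₀ := H.key t₀
  have hDin : ∀ t ≥ t₀, InG v (P t) (β t) ((m - q) * β t) Set.univ D := fun t ht =>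
    H.inG_hasseDeriv hdeg hG hgap ht (hqj.trans hjm).le
  -- D lies below degree m in the sequence, so if non-zero its Gauss value is eventually v D. The
  -- bounds (m - q) * β t give v D ≥ (m - q) * B in the limit, which then bounds all digits at a
  -- single t₁.
  have hD1 : ∃ t₁ ≥ t₀, InG v (P t₁) (β t₁) ((m - q) * B) Set.univ D := by
    by_cases hD0 : D = 0
    · exact ⟨t₀, le_rfl, by rw [hD0]; exact inG_zero hQ₀.monic⟩
    have hDd : D.natDegree < m * (P 0).natDegree := by
      have h1 : D = ∑ i ∈ Finset.range (m - q + 1),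
          (((i + q).choose q : ℕ) * digit (P t₀) G (i + q)) * P t₀ ^ i := by
        rw [hDdef, eval_hasseDeriv_eq_sum (P t₀) G (P t₀) (hqj.trans hjm).le]
        refine Finset.sum_congr rfl fun i hi => ?_
        rw [Finset.mem_range] at hi
        rw [taylorCoeff, _root_.sub_self, ← coeff_zero_eq_eval_zero, hasseDeriv_coeff, zero_add,
          Nat.choose_self, Nat.cast_one, one_mul, expansion_coeff _ (by omega)]
      have h2 := degree_sum_mul_pow_lt hQ₀.monic
        (fun i => (((i + q).choose q : ℕ) * digit (P t₀) G (i + q))) (m - q + 1) fun i _ => by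
          have hd := degree_digit_lt hQ₀.monic G (i + q)
          rw [← C_eq_natCast]
          refine lt_of_le_of_lt ?_ hd
          rw [degree_mul]
          exact (add_le_add degree_C_le le_rfl).trans (by rw [zero_add])
      rw [← h1] at h2
      have h3 := natDegree_lt_natDegree hD0 h2
      rw [hQ₀.monic.natDegree_pow, H.natDegree_eq] at h3
      exact h3.trans_le (Nat.mul_le_mul_right _ (by omega))
    obtain ⟨c, t₁, hvc, hT⟩ := H.exists_forall_top_zero hmin hD0 hDd
    refine ⟨max t₀ t₁, le_max_left _ _, ?_⟩
    refine (hT _ (le_max_right _ _)).inG.mono ?_ subset_rfl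
    have h1 := H.le_of_forall (c := 0) (k := m - q) (h := D) (t₀ := t₀) fun t ht => by
      rw [zero_add]
      exact (H.keyAt (le_refl t)).coe_le (hDin t ht)
    rw [hvc, zero_add, WithTop.coe_le_coe] at h1
    exact h1
  obtain ⟨t₁, ht₁, hD1⟩ := hD1
  -- As j - q ≥ 1, the gap with N = q makes the bound (m - q) * B - (j - q) * β t₁ at least m * B -
  -- j * β t.
  filter_upwards [H.eventually_gap q t₁, eventually_ge_atTop t₁] with t hgt ht
  have hQ := H.keyAt ht
  have h0 : β 0 ≤ β t₁ := H.strictMono.monotone (Nat.zero_le _)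
  have h01 : β t₀ ≤ β t₁ := H.strictMono.monotone ht₁
  have h1t : β t₁ ≤ β t := H.strictMono.monotone ht
  have hD2 := H.inG_translate (t₂ := t) le_rfl ht hD1
  rw [hDdef, eval_hasseDeriv_eq_sum (P t₀) G (P t) (hqj.trans hjm).le] at hD2
  have hi : j - q < m - q + 1 := by omega
  have h4 := hQ.inG_coeff (e := β t₁ - β 0)
    (x := fun i => (m - (i + q : ℕ)) * β t₀) (fun i _ => ?_) (fun i hi => ?_) hD2 hi
  · rw [show j - q + q = j by omega] at h4
    have h5 := hQ.inG_natCast_mul h4 k'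
    rw [← mul_assoc, hk', one_mul] at h5
    refine coe_le_trans (hQ.coe_le h5) ?_
    rw [Nat.cast_sub hqj.le]
    have h6 : (q : ℝ) + 1 ≤ j := by exact_mod_cast hqj
    nlinarith
  · exact (H.key t).near_natCast_mul h0 hQ.le
      (H.near_taylorCoeff (hG t₀ le_rfl) (ht₁.trans ht) h0 h1t (i + q)) _
  · have h5 : (0 : ℝ) ≤ q := Nat.cast_nonneg q
    have h6 : (0 : ℝ) ≤ i := Nat.cast_nonneg i
    have h7 := H.lt_lim t₀
    push_cast
    nlinarith [mul_nonneg h6 (sub_nonneg.2 h01), mul_nonneg h5 (sub_nonneg.2 h7.le)]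

/-- A monic polynomial of the least possible degree `m` in `P t` can be replaced by a weakly affine
one. -/
theorem exists_weaklyAffine (p : ℕ) [Fact p.Prime] [CharP K p] (hm : 0 < m)
    (hmin : ∀ r, 0 < r → r < m → ¬ Deep v P β r) (hD : Deep v P β m) :
    ∃ (t : ℕ) (c : ℕ → K[X]), (∀ j, (c j).degree < (P 0).degree) ∧ c m = 1 ∧
      (∀ j < m, 0 < j → (¬ ∃ k : ℕ, j = p ^ k) → c j = 0) ∧
      ((m * B : ℝ) : WithTop ℝ) ≤ v (∑ j ∈ Finset.range (m + 1), c j * P t ^ j) := by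
  classical
  obtain ⟨G, t₀, hGm, hdeg, hG⟩ := hD
  obtain ⟨t₀, hG, hgap⟩ := H.exists_gap hG
  have hall : ∀ᶠ t in atTop, ∀ j ∈ Finset.range m, 0 < j → (¬ ∃ k : ℕ, j = p ^ k) →
      ((m * B - j * β t : ℝ) : WithTop ℝ) ≤ v (taylorCoeff (P t₀) G m (P t) j) := by
    rw [Filter.eventually_all_finset]
    intro j hj
    by_cases h : 0 < j ∧ ¬ ∃ k : ℕ, j = p ^ k
    · filter_upwards [H.eventually_taylorCoeff p hmin hdeg hG hgap h.1 (Finset.mem_range.1 hj) h.2]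
        with t ht _ _
      exact ht
    · exact Filter.Eventually.of_forall fun t h1 h2 => absurd ⟨h1, h2⟩ h
  obtain ⟨t, hneg, ht⟩ := (hall.and (eventually_ge_atTop t₀)).exists
  have hQ := H.keyAt (le_refl t)
  have h0 : β 0 ≤ β t := H.strictMono.monotone (Nat.zero_le _)
  have h01 : β t₀ ≤ β t := H.strictMono.monotone ht
  have hnear := H.near_taylorCoeff (hG t₀ le_rfl) ht h0 le_rfl
  choose a ha hxa hAa using hnear
  set A := taylorCoeff (P t₀) G m (P t) with hA
  have hAm : A m = 1 := by
    rw [hA, taylorCoeff, eval_hasseDeriv_expansion, Finset.sum_eq_single m]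
    · rw [Nat.choose_self, Nat.sub_self, pow_zero, H.digit_eq_one hGm hdeg]
      simp
    · intro j hj hjm
      rw [Finset.mem_range] at hj
      rw [Nat.choose_eq_zero_of_lt (by omega)]
      simp
    · intro h
      exact absurd (Finset.mem_range.2 (Nat.lt_succ_self m)) h
  -- Terms with a forbidden exponent are dropped (bounded by hneg), the other coefficients below m
  -- become their approximations (bounded by hAa); the total change has value at least m * B.
  refine ⟨t, fun j => if j = m then 1 else if 0 < j ∧ ¬ ∃ k : ℕ, j = p ^ k then 0 else a j,
    fun j => ?_, if_pos rfl, fun j hj h1 h2 => ?_, ?_⟩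
  · have hd := H.degree_eq t
    simp only
    split_ifs
    · rw [degree_one]
      exact natDegree_pos_iff_degree_pos.1 (H.key 0).pos
    · rw [degree_zero]
      exact bot_lt_iff_ne_bot.2 (degree_ne_bot.2 (H.key 0).monic.ne_zero)
    · rw [← hd]
      exact ha j
  · simp only
    rw [if_neg hj.ne, if_pos ⟨h1, h2⟩]
  · set c : ℕ → K[X] :=
      fun j => if j = m then 1 else if 0 < j ∧ ¬ ∃ k : ℕ, j = p ^ k then 0 else a j with hc
    have hsum : G = ∑ j ∈ Finset.range (m + 1), A j * P t ^ j := by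
      have h1 := eval_hasseDeriv_eq_sum (P t₀) G (P t) (Nat.zero_le m)
      rw [H.eval_expansion hdeg] at h1
      simpa using h1
    have hvG : ((m * B : ℝ) : WithTop ℝ) ≤ v G := by
      have := H.le_of_forall (c := 0) (k := m) (h := G) (t₀ := t₀) fun t ht => by
        rw [zero_add]
        exact (H.keyAt (le_refl t)).coe_le (hG t ht)
      rwa [zero_add] at this
    have hdiff : ((m * B : ℝ) : WithTop ℝ) ≤
        v (∑ j ∈ Finset.range (m + 1), (A j - c j) * P t ^ j) := by
      refine v.map_le_sum fun j hj => ?_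
      rw [Finset.mem_range] at hj
      have hpow := coe_le_pow (v := v) (a := P t) (x := β t) hQ.le j
      by_cases hjm : j = m
      · subst hjm
        simp [hc, hAm, v.map_zero]
      by_cases hjb : 0 < j ∧ ¬ ∃ k : ℕ, j = p ^ k
      · have h1 := hneg j (Finset.mem_range.2 (by omega)) hjb.1 hjb.2
        have h2 : c j = 0 := by simp only [hc]; rw [if_neg hjm, if_pos hjb]
        rw [h2, _root_.sub_zero]
        exact coe_le_trans (coe_le_mul h1 hpow) (by linarith)
      · have h2 : c j = a j := by simp only [hc]; rw [if_neg hjm, if_neg hjb]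
        rw [h2]
        refine coe_le_trans (coe_le_mul (hQ.coe_le (hAa j)) hpow) ?_
        have h6 : (0 : ℝ) ≤ j := Nat.cast_nonneg j
        nlinarith [mul_nonneg h6 (sub_nonneg.2 h01)]
    have h3 : ∑ j ∈ Finset.range (m + 1), c j * P t ^ j =
        G - ∑ j ∈ Finset.range (m + 1), (A j - c j) * P t ^ j := by
      rw [hsum, ← Finset.sum_sub_distrib]
      exact Finset.sum_congr rfl fun j _ => by ring
    rw [h3]
    exact v.map_le_sub hvG hdiff

end LimSeq

end Taylor

end KeyPoly

namespace KeyPoly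

/-! ### Degrees of standard monomials. -/

section Degree

variable {K : Type*} [Field K] {F : Family K} {l i j k : Ordinal.{0}} {γ : Ordinal.{0} →₀ ℕ}
  {n : ℕ}

theorem next_of_essential (h : IsEssential F l i) : next F l i = i + 1 := if_pos h

theorem next_of_not_essential (h : ¬ IsEssential F l i) : next F l i = i + ω := if_neg h

theorem exists_nat_of_lt_add_omega (h : i < l + ω) (hl : l ≤ i) : ∃ t : ℕ, i = l + t := by
  rw [← Ordinal.add_sub_cancel_of_le hl] at h ⊢
  have h1 : i - l < ω := (add_lt_add_iff_left l).1 h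
  obtain ⟨t, ht⟩ := Ordinal.lt_omega0.1 h1
  exact ⟨t, by rw [ht]⟩

theorem exists_le_of_lt_add_omega (h : i < l + ω) : ∃ t : ℕ, i ≤ l + t := by
  rcases le_total i l with hil | hil
  · exact ⟨0, by simpa using hil⟩
  · obtain ⟨t, rfl⟩ := exists_nat_of_lt_add_omega h hil
    exact ⟨t, le_rfl⟩

theorem not_essential_add (h : ¬ IsEssential F l i) (s : ℕ) : ¬ IsEssential F l (i + s) := by
  rintro ⟨t, ht, h'⟩
  refine h ⟨s + t, by omega, ?_⟩
  rwa [Nat.cast_add, ← add_assoc]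

theorem add_lt_of_not_essential (hi : i < l) (h : ¬ IsEssential F l i) (t : ℕ) : i + t < l := by
  induction t with
  | zero => simpa using hi
  | succ t ih =>
    refine lt_of_le_of_ne ?_ fun heq => h ⟨t + 1, by omega, Or.inl heq⟩
    rw [Nat.cast_add, Nat.cast_one, ← add_assoc]
    exact Order.add_one_le_of_lt ih

theorem next_le (hi : i < l) : next F l i ≤ l := by
  by_cases h : IsEssential F l i
  · rw [next_of_essential h]
    exact Order.add_one_le_of_lt hi
  · rw [next_of_not_essential h]
    by_contra hlt
    rw [not_le] at hlt
    obtain ⟨t, ht⟩ := exists_nat_of_lt_add_omega hlt hi.le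
    exact (add_lt_of_not_essential hi h t).ne ht.symm

theorem nat_add_omega (s : ℕ) : i + (s : Ordinal.{0}) + ω = i + ω := by
  rw [add_assoc, Ordinal.natCast_add_omega0]

/-- Only an inessential j leaves room below its `next`; the indices in between are j + s with s
finite, and share the limit j + ω. -/
theorem next_eq_of_between (hjk : j < k) (hk : k < next F l j) :
    ¬ IsEssential F l k ∧ next F l k = next F l j := by
  have hj : ¬ IsEssential F l j := fun h => by
    rw [next_of_essential h] at hk
    exact absurd (Order.add_one_le_of_lt hjk) (not_le.2 hk)
  rw [next_of_not_essential hj] at hk ⊢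
  obtain ⟨s, rfl⟩ := exists_nat_of_lt_add_omega hk hjk.le
  refine ⟨not_essential_add hj s, ?_⟩
  rw [next_of_not_essential (not_essential_add hj s), nat_add_omega]

theorem lt_next_self : i < next F l i := by
  unfold next
  split_ifs
  · exact Order.lt_add_one_iff.2 le_rfl
  · exact lt_add_of_pos_right i Ordinal.omega0_pos

/-- The degrees of the `Q_i`, `i ≤ l`, are controlled by the `α_i`. -/
structure DegData (F : Family K) (l : Ordinal.{0}) : Prop where
  monic : ∀ i ≤ l, (F.Q i).Monic
  pos : ∀ i ≤ l, 0 < (F.Q i).natDegree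
  mono : ∀ i j, i ≤ j → j ≤ l → (F.Q i).natDegree ≤ (F.Q j).natDegree
  succ : ∀ i, i + 1 ≤ l → F.α (i + 1) * (F.Q i).natDegree ≤ (F.Q (i + 1)).natDegree
  limit : ∀ i, i + ω ≤ l → F.α (i + ω) * (F.Q i).natDegree ≤ (F.Q (i + ω)).natDegree

namespace DegData

theorem next (H : DegData F l) (hi : i < l) :
    F.α (next F l i) * (F.Q i).natDegree ≤ (F.Q (KeyPoly.next F l i)).natDegree := by
  have hle := next_le (F := F) hi
  by_cases h : IsEssential F l i
  · rw [next_of_essential h] at hle ⊢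
    exact H.succ i hle
  · rw [next_of_not_essential h] at hle ⊢
    exact H.limit i hle

/-- Induction over bounds closed under `next`. Let i be the last index that occurs below l' and μ
the first index with the same `next`. The tail condition leaves only i from μ on, so the sum is less
than deg Q_μ + γ_i deg Q_i ≤ α_{i+} deg Q_i ≤ deg Q_{i+}. -/
theorem sum_lt_aux (H : DegData F l) (hγ : IsStandardIndex F n l γ) (l' : Ordinal.{0})
    (hl' : l' ≤ l) (hclosed : ∀ i < l', KeyPoly.next F l i ≤ l') :
    ∑ i ∈ γ.support.filter (· < l'), γ i * (F.Q i).natDegree < (F.Q l').natDegree := by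
  classical
  induction l' using WellFoundedLT.induction with
  | ind l' ih =>
  set s := γ.support.filter (· < l') with hs
  rcases s.eq_empty_or_nonempty with he | hne
  · rw [he, Finset.sum_empty]
    exact H.pos l' hl'
  set i := s.max' hne with hi
  have his : i ∈ s := s.max'_mem hne
  have hil' : i < l' := (Finset.mem_filter.1 his).2
  have hγi : γ i ≠ 0 := Finsupp.mem_support_iff.1 (Finset.mem_filter.1 his).1
  have hil : i < l := hil'.trans_le hl'
  obtain ⟨μ, ⟨hμi, hμn⟩, hμmin⟩ := WellFounded.has_min (wellFounded_lt (α := Ordinal.{0}))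
    {j | j ≤ i ∧ KeyPoly.next F l j = KeyPoly.next F l i} ⟨i, le_rfl, rfl⟩
  -- An index j < μ with `next` beyond μ would share its `next` with μ, against the minimality of μ.
  have hμclosed : ∀ j < μ, KeyPoly.next F l j ≤ μ := fun j hj => by
    by_contra hlt
    rw [not_le] at hlt
    have h1 := (next_eq_of_between hj hlt).2
    exact hμmin j ⟨hj.le.trans hμi, by rw [← h1, hμn]⟩ hj
  have hμl' : μ < l' := hμi.trans_lt hil'
  have hrec := ih μ hμl' (hμl'.le.trans hl') hμclosed
  have honly : ∀ j ∈ s, μ ≤ j → j = i := fun j hj hμj => by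
    have hji : j ≤ i := s.le_max' j hj
    have hγj : γ j ≠ 0 := Finsupp.mem_support_iff.1 (Finset.mem_filter.1 hj).1
    by_contra hne
    have hlt : j < i := lt_of_le_of_ne hji hne
    have hnj : KeyPoly.next F l j = KeyPoly.next F l i := by
      rcases hμj.eq_or_lt with rfl | hμj
      · exact hμn
      · rw [(next_eq_of_between hμj (hji.trans_lt (hμn ▸ lt_next_self))).2, hμn]
    have hiness := (next_eq_of_between hlt (hnj.symm ▸ lt_next_self)).1
    exact hne (hγ.tail i hil hiness ⟨hji.trans_lt lt_next_self, hnj, hγj⟩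
      ⟨lt_next_self, rfl, hγi⟩)
  have hsplit : s = insert i (γ.support.filter (· < μ)) := by
    ext j
    rw [Finset.mem_insert]
    constructor
    · intro hj
      rcases lt_or_ge j μ with h | h
      · exact Or.inr (Finset.mem_filter.2 ⟨(Finset.mem_filter.1 hj).1, h⟩)
      · exact Or.inl (honly j hj h)
    · rintro (rfl | hj)
      · exact his
      · rw [Finset.mem_filter] at hj ⊢
        exact ⟨hj.1, hj.2.trans hμl'⟩
  rw [hsplit, Finset.sum_insert (by simp [not_lt.2 hμi])]
  have h1 := H.mono μ i hμi hil.le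
  have h2 := H.next hil
  have h3 := H.mono _ l' (hclosed i hil') hl'
  have h4 : (γ i + 1) * (F.Q i).natDegree ≤ F.α (KeyPoly.next F l i) * (F.Q i).natDegree :=
    Nat.mul_le_mul_right _ (hγ.lt_next i hil)
  rw [add_mul, one_mul] at h4
  omega

theorem sum_lt (H : DegData F l) (hγ : IsStandardIndex F n l γ) (hl : γ l = 0) :
    (γ.sum fun i k => k * (F.Q i).natDegree) < (F.Q l).natDegree := by
  have := H.sum_lt_aux hγ l le_rfl fun i hi => next_le hi
  rwa [Finset.filter_true_of_mem fun i hi => ?_] at this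
  rw [Finsupp.mem_support_iff] at hi
  refine lt_of_le_of_ne (hγ.support_le i hi) ?_
  rintro rfl
  exact hi hl

theorem degree_mon_lt (H : DegData F l) {m : K[X]} (hm : IsStandardMonomial F n l m) :
    m.degree < (F.Q l).degree := by
  obtain ⟨a, γ, hγ, hl, rfl⟩ := hm
  refine degree_lt_degree (lt_of_le_of_lt ?_ (H.sum_lt hγ hl))
  refine (natDegree_C_mul_le _ _).trans ((natDegree_prod_le _ _).trans ?_)
  exact Finset.sum_le_sum fun i _ => natDegree_pow_le

theorem step (H : DegData F l) (hm : (F.Q (l + 1)).Monic)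
    (hα : F.α (l + 1) * (F.Q l).natDegree ≤ (F.Q (l + 1)).natDegree)
    (hle : (F.Q l).natDegree ≤ (F.Q (l + 1)).natDegree) : DegData F (l + 1) := by
  have key : ∀ {i}, i ≤ l + 1 → i ≤ l ∨ i = l + 1 := fun {i} hi => by
    rcases hi.eq_or_lt with h | h
    · exact Or.inr h
    · exact Or.inl (Order.lt_add_one_iff.1 h)
  refine ⟨fun i hi => ?_, fun i hi => ?_, fun i j hij hj => ?_, fun i hi => ?_, fun i hi => ?_⟩
  · rcases key hi with h | rfl
    · exact H.monic i h
    · exact hm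
  · rcases key hi with h | rfl
    · exact H.pos i h
    · exact (H.pos l le_rfl).trans_le hle
  · rcases key hj with h | rfl
    · exact H.mono i j hij h
    · rcases key hij with h | rfl
      · exact (H.mono i l h le_rfl).trans hle
      · exact le_rfl
  · rcases key hi with h | h
    · exact H.succ i h
    · have : i = l := by
        rw [← Order.succ_eq_add_one, ← Order.succ_eq_add_one] at h
        exact Order.succ_injective h
      subst this
      exact hα
  · rcases key hi with h | h
    · exact H.limit i h
    · exfalso
      have h1 : Order.IsSuccLimit (i + ω) := Ordinal.isSuccLimit_add i Ordinal.isSuccLimit_omega0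
      rw [h] at h1
      exact Order.not_isSuccLimit_succ l (by rwa [Order.succ_eq_add_one])

theorem add_nat (H : DegData F l) (N : ℕ) (hm : ∀ t ≤ N, (F.Q (l + t)).Monic)
    (hdeg : ∀ t ≤ N, (F.Q (l + t)).natDegree = (F.Q l).natDegree)
    (hα : ∀ t ≤ N, 0 < t → F.α (l + t) = 1) : DegData F (l + N) := by
  induction N with
  | zero => simpa using H
  | succ N ih =>
    have ih' := ih (fun t ht => hm t (by omega)) (fun t ht => hdeg t (by omega))
      fun t ht => hα t (by omega)
    have hcast : l + ((N + 1 : ℕ) : Ordinal.{0}) = l + N + 1 := by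
      rw [Nat.cast_add, Nat.cast_one, add_assoc]
    have h1 := hm (N + 1) le_rfl
    have h2 := hdeg (N + 1) le_rfl
    have h3 := hα (N + 1) le_rfl (by omega)
    have h4 := hdeg N (by omega)
    rw [hcast] at h1 h2 h3 ⊢
    exact ih'.step h1 (by rw [h3, h2, h4, one_mul]) (by rw [h2, h4])

theorem add_omega (H : ∀ t : ℕ, DegData F (l + t)) (hm : (F.Q (l + ω)).Monic)
    (hα : ∀ t : ℕ, F.α (l + ω) * (F.Q (l + t)).natDegree ≤ (F.Q (l + ω)).natDegree)
    (hle : ∀ t : ℕ, (F.Q (l + t)).natDegree ≤ (F.Q (l + ω)).natDegree) : DegData F (l + ω) := by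
  have key : ∀ {i}, i ≤ l + ω → (∃ t : ℕ, i ≤ l + t) ∨ i = l + ω := fun {i} hi => by
    rcases hi.eq_or_lt with h | h
    · exact Or.inr h
    · exact Or.inl (exists_le_of_lt_add_omega h)
  refine ⟨fun i hi => ?_, fun i hi => ?_, fun i j hij hj => ?_, fun i hi => ?_, fun i hi => ?_⟩
  · rcases key hi with ⟨t, h⟩ | rfl
    · exact (H t).monic i h
    · exact hm
  · rcases key hi with ⟨t, h⟩ | rfl
    · exact (H t).pos i h
    · exact ((H 0).pos _ le_rfl).trans_le (hle 0)
  · rcases key hj with ⟨t, h⟩ | rfl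
    · exact (H t).mono i j hij h
    · rcases key hij with ⟨t, h⟩ | rfl
      · exact ((H t).mono i _ h le_rfl).trans (hle t)
      · exact le_rfl
  · have hlt : i < l + ω := (Order.lt_add_one_iff.2 le_rfl).trans_le hi
    obtain ⟨t, ht⟩ := exists_le_of_lt_add_omega hlt
    refine (H (t + 1)).succ i ?_
    rw [Nat.cast_add, Nat.cast_one, ← add_assoc]
    exact add_le_add ht le_rfl
  · rcases key hi with ⟨t, h⟩ | h
    · exact (H t).limit i h
    · rw [h]
      have hlt : i < l + ω := by
        rw [← h]
        exact lt_add_of_pos_right i Ordinal.omega0_pos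
      obtain ⟨t, ht⟩ := exists_le_of_lt_add_omega hlt
      exact (Nat.mul_le_mul_left _ ((H t).mono i _ ht le_rfl)).trans (hα t)

end DegData

end Degree

/-! ### Standard expansions: uniqueness by degree, and passage from l to l + t. -/

section Expansion

variable {K : Type*} [Field K] {Γ : Type*} [LinearOrder Γ]
  {v : K[X] → WithTop Γ} {F : Family K} {l : Ordinal.{0}} {n : ℕ}
  {β : Γ} {h : K[X]}

theorem DegData.degree_homogeneous_lt (H : DegData F l) (hh : IsHomogeneous v F n l β h) :
    h.degree < (F.Q l).degree := by
  obtain ⟨s, hs, rfl, -⟩ := hh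
  have hbot : (⊥ : WithBot ℕ) < (F.Q l).degree :=
    bot_lt_iff_ne_bot.2 (degree_ne_bot.2 (H.monic l le_rfl).ne_zero)
  refine Multiset.sum_induction (fun m : K[X] => m.degree < (F.Q l).degree) s
    (fun a b ha hb => (degree_add_le _ _).trans_lt (max_lt ha hb)) (by simpa using hbot) ?_
  exact fun m hm => H.degree_mon_lt (hs m hm).1

theorem DegData.degree_expansion_lt (H : DegData F l) (hh : IsExpansion v F n l h) :
    h.degree < (F.Q l).degree := by
  obtain ⟨B, T, hT, rfl⟩ := hh
  have hbot : (⊥ : WithBot ℕ) < (F.Q l).degree :=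
    bot_lt_iff_ne_bot.2 (degree_ne_bot.2 (H.monic l le_rfl).ne_zero)
  refine Finset.sum_induction T (fun m : K[X] => m.degree < (F.Q l).degree)
    (fun a b ha hb => (degree_add_le _ _).trans_lt (max_lt ha hb)) (by simpa using hbot) ?_
  exact fun b hb => H.degree_homogeneous_lt (hT b hb)

/-- The coefficients have degree less than deg Q_l, so a standard expansion is the Q_l-adic one, and
h is its own digit of index 0. -/
theorem DegData.isExpansion_of_degree_lt (H : DegData F l) (hh : HasStandardExpansion v F n l h)
    (hdeg : h.degree < (F.Q l).degree) : IsExpansion v F n l h := by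
  obtain ⟨s, c, hc, hsum⟩ := hh
  have hQ := H.monic l le_rfl
  have h1 : digit (F.Q l) h 0 = c 0 := by
    rw [hsum, digit_sum hQ, Finset.sum_eq_single 0]
    · rw [digit_mul_pow hQ (H.degree_expansion_lt (hc 0 (Nat.zero_le s))), if_pos rfl]
    · intro j hj hj0
      rw [Finset.mem_range] at hj
      rw [digit_mul_pow hQ (H.degree_expansion_lt (hc j (by omega))), if_neg (Ne.symm hj0)]
    · intro h0
      exact absurd (Finset.mem_range.2 (Nat.succ_pos s)) h0
  rw [digit, pow_zero, divByMonic_one, (modByMonic_eq_self_iff hQ).2 hdeg] at h1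
  rw [h1]
  exact hc 0 (Nat.zero_le s)

section Shift

variable {t : ℕ}

/-- An i from which l is reached in finitely many steps is essential for both; for the others only
indices below l matter. -/
theorem isEssential_add_iff {i : Ordinal.{0}} (hi : i < l) :
    IsEssential F (l + t) i ↔ IsEssential F l i := by
  constructor
  · rintro ⟨s, hs, h⟩
    have key : l ≤ i + s → i + s ≤ l + t → IsEssential F l i := fun h1 h2 => by
      have h3 : l < i + ω := h1.trans_lt ((add_lt_add_iff_left i).2 (Ordinal.natCast_lt_omega0 s))
      obtain ⟨r, hr⟩ := exists_nat_of_lt_add_omega h3 hi.le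
      refine ⟨r, Nat.pos_of_ne_zero ?_, Or.inl hr.symm⟩
      rintro rfl
      rw [Nat.cast_zero, _root_.add_zero] at hr
      exact hi.ne hr.symm
    rcases lt_or_ge (i + (s : Ordinal.{0})) l with hlt | hge
    · rcases h with h | h
      · exfalso
        rw [h] at hlt
        exact absurd (le_add_of_nonneg_right zero_le) (not_le.2 hlt)
      · exact ⟨s, hs, Or.inr ⟨hlt, h.2⟩⟩
    · exact key hge (h.elim (fun h => h.le) fun h => h.1.le)
  · rintro ⟨s, hs, h | h⟩
    · refine ⟨s + t, by omega, Or.inl ?_⟩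
      rw [Nat.cast_add, ← add_assoc, h]
    · exact ⟨s, hs, Or.inr ⟨h.1.trans_le (le_add_of_nonneg_right zero_le), h.2⟩⟩

theorem next_add {i : Ordinal.{0}} (hi : i < l) : next F (l + t) i = next F l i := by
  unfold next
  rw [propext (isEssential_add_iff hi)]

theorem essential_between {i : Ordinal.{0}} (h1 : l ≤ i) (h2 : i < l + t) :
    IsEssential F (l + t) i ∧ ∃ s : ℕ, s < t ∧ i + 1 = l + ((s + 1 : ℕ) : Ordinal.{0}) := by
  obtain ⟨s, rfl⟩ := exists_nat_of_lt_add_omega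
    (h2.trans ((add_lt_add_iff_left l).2 (Ordinal.natCast_lt_omega0 t))) h1
  have hst : s < t := by
    have := (add_lt_add_iff_left l).1 h2
    exact_mod_cast this
  refine ⟨⟨t - s, by omega, Or.inl ?_⟩, s, hst, ?_⟩
  · rw [add_assoc, ← Nat.cast_add]
    congr 2
    omega
  · rw [add_assoc]
    push_cast
    rfl

/-- The new indices have exponent 0 and α equal to 1, so their condition is 0 < 1; below l, `next`
does not change. -/
theorem IsStandardMonomial.add_nat {m : K[X]} (hm : IsStandardMonomial F n l m)
    (hα : ∀ s : ℕ, 0 < s → s ≤ t → F.α (l + (s : Ordinal.{0})) = 1) :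
    IsStandardMonomial F n (l + t) m := by
  obtain ⟨a, γ, hγ, hl, rfl⟩ := hm
  have hzero : ∀ i, l ≤ i → γ i = 0 := fun i hi => by
    by_contra h0
    have := (hγ.support_le i h0).antisymm hi
    rw [this] at h0
    exact h0 hl
  have hlt : l ≤ l + (t : Ordinal.{0}) := le_add_of_nonneg_right zero_le
  refine ⟨a, γ, ⟨fun i hi => (hγ.support_le i hi).trans hlt, fun i hi => ?_, hγ.degree_le,
    fun i hi hi' => ?_⟩, hzero _ hlt, rfl⟩
  · rcases lt_or_ge i l with h | h
    · rw [next_add h]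
      exact hγ.lt_next i h
    · obtain ⟨h1, s, hs, h2⟩ := essential_between (F := F) h hi
      rw [next_of_essential h1, h2, hα (s + 1) (by omega) (by omega), hzero i h]
      exact one_pos
  · rcases lt_or_ge i l with h | h
    · rw [isEssential_add_iff h] at hi'
      rw [next_add h]
      refine (hγ.tail i h hi').anti fun j hj => ?_
      have hjl : j < l := by
        by_contra hjl
        exact hj.2.2 (hzero j (not_lt.1 hjl))
      exact ⟨hj.1, by rw [← hj.2.1, next_add hjl], hj.2.2⟩
    · exact absurd (essential_between (F := F) h hi).1 hi'

theorem IsHomogeneous.add_nat (hh : IsHomogeneous v F n l β h)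
    (hα : ∀ s : ℕ, 0 < s → s ≤ t → F.α (l + (s : Ordinal.{0})) = 1) :
    IsHomogeneous v F n (l + t) β h := by
  obtain ⟨s, hs, h1, h2⟩ := hh
  exact ⟨s, fun m hm => ⟨(hs m hm).1.add_nat hα, (hs m hm).2⟩, h1, h2⟩

theorem IsExpansion.add_nat (hh : IsExpansion v F n l h)
    (hα : ∀ s : ℕ, 0 < s → s ≤ t → F.α (l + (s : Ordinal.{0})) = 1) :
    IsExpansion v F n (l + t) h := by
  obtain ⟨B, T, hT, hsum⟩ := hh
  exact ⟨B, T, fun b hb => (hT b hb).add_nat hα, hsum⟩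

end Shift

end Expansion

end KeyPoly

namespace KeyPoly

/-! ### Initial forms of f near the sequence. -/

section Shape

variable {K : Type*} [Field K] {v : AddValuation K[X] (WithTop ℝ)} {P : ℕ → K[X]} {β : ℕ → ℝ}
  {B : ℝ} {f S S' : K[X]} {b c : ℝ} {δ t : ℕ}

/-- The initial form of `f` with respect to a polynomial close to the sequence is a multiple of a
power. -/
theorem LimSeq.inG_singleton (H : LimSeq v P β B)
    (hT : ∀ t, Top v (P t) (β t) (c + δ * β t) δ f) (hb0 : β 0 ≤ b) (hbt : b < β t)
    (hS : (S - P t).degree < (P 0).degree) (hvS : (b : WithTop ℝ) < v (S - P t)) :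
    KeyPair v S b ∧ InG v S b (c + δ * b) {δ} f ∧ v (digit S f δ) = c := by
  have hdt := H.degree_eq t
  have hPb : KeyPair v (P t) b := (H.key t).mono hb0 (by
    rw [H.val, WithTop.coe_le_coe]
    exact hbt.le)
  have hSb : KeyPair v S b := by
    have := hPb.translate (hS.trans_eq hdt.symm) hvS.le
    rwa [_root_.add_sub_cancel] at this
  have h1 := hT t
  have h2 := H.top_translate (Nat.zero_le t) (hT 0)
  have h3 : v (digit (P t) f δ) = c := by
    rw [h1.digit_eq]
    congr 1
    ring
  -- Indices below δ are excluded by the bounds at the larger slope β t, those above δ by the strict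
  -- bounds at the smaller slope β 0.
  have h4 : InG v (P t) b (c + δ * b) {δ} f := fun j => by
    rcases lt_trichotomy j δ with hj | rfl | hj
    · have h5 : (j : ℝ) + 1 ≤ δ := by exact_mod_cast hj
      have h6 := coe_lt_of_le (h1.1 j).1 (y := c + δ * b - j * b) (by nlinarith)
      exact ⟨h6.le, fun _ => h6⟩
    · rw [h3]
      refine ⟨?_, fun h => absurd rfl h⟩
      rw [WithTop.coe_le_coe]
      linarith
    · have h5 : (δ : ℝ) + 1 ≤ j := by exact_mod_cast hj
      have h6 := coe_lt_trans ((h2.1 j).2 (by simpa using hj)) (y := c + δ * b - j * b)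
        (by nlinarith)
      exact ⟨h6.le, fun _ => h6⟩
  refine ⟨hSb, hPb.inG_translate_lt hSb (hS.trans_eq hdt.symm) hvS h4, ?_⟩
  have h5 : Top v (P t) b (c + δ * b) δ f := by
    refine top_of_digit_eq (h4.mono le_rfl (by simp)) ?_
    rw [h3]
    congr 1
    ring
  rw [(hPb.top_translate hSb (hS.trans_eq hdt.symm) hvS.le h5).digit_eq]
  congr 1
  ring

/-- Used to verify `InitIsPower`. Along S the initial form of f is the single term g * S ^ δ, and
(S' + z) ^ δ is expanded by the binomial theorem. The digits of index δ along S and S' differ by a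
term of greater value, so g may be exchanged for the latter. -/
theorem KeyPair.digit_sub_lt (hS : KeyPair v S b) (hS' : KeyPair v S' b) {z : K[X]}
    (hz : S' + z = S) (hzd : z.degree < S'.degree) (hvz : (b : WithTop ℝ) ≤ v z)
    (hf : InG v S b (c + δ * b) {δ} f) (hδ : v (digit S f δ) = c) :
    v (digit S' f δ) = c ∧ ∀ j < δ, ((c + (δ - j) * b : ℝ) : WithTop ℝ) <
      v (digit S' f j - (δ.choose j : K[X]) * digit S' f δ * z ^ (δ - j)) := by
  have hdeg : S.degree = S'.degree := by
    rw [← hz]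
    exact degree_add_eq_left_of_degree_lt hzd
  set g := digit S f δ with hg
  have hgd : g.degree < S.degree := degree_digit_lt hS.monic f δ
  have h1 : InG v S b (c + δ * b) ∅ (f - g * S ^ δ) := fun j => by
    rw [digit_sub hS.monic, digit_mul_pow hS.monic hgd]
    split_ifs with hj
    · subst hj
      rw [_root_.sub_self, v.map_zero]
      exact ⟨le_top, fun _ => WithTop.coe_lt_top _⟩
    · rw [_root_.sub_zero]
      exact ⟨(hf j).1, fun _ => (hf j).2 (by simpa using hj)⟩
  have h2 : InG v S' b (c + δ * b) ∅ (f - g * S ^ δ) := by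
    refine hS.inG_translate hS' ?_ ?_ (by simp) h1
    · rw [← hz, sub_add_cancel_left, degree_neg, hz, hdeg]
      exact hzd
    · rw [← hz, sub_add_cancel_left, v.map_neg]
      exact hvz
  have hA : ∀ j, Near v S' b 0 (c + (δ - j : ℕ) * b) ((δ.choose j : K[X]) * (g * z ^ (δ - j))) := by
    intro j
    have := hS'.near_natCast_mul le_rfl hS'.le (hS'.near_mul_pow le_rfl hS'.le
      (near_of_degree_lt hS'.monic (hdeg ▸ hgd) hδ.ge) hzd hvz (δ - j)) (δ.choose j)
    rwa [_root_.sub_self] at this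
  choose a had _ hAa using hA
  have hsum : g * S ^ δ = ∑ j ∈ Finset.range (δ + 1),
      (δ.choose j : K[X]) * (g * z ^ (δ - j)) * S' ^ j := by
    rw [← hz, add_pow, Finset.mul_sum]
    refine Finset.sum_congr rfl fun j _ => ?_
    ring
  have h3 : InG v S' b (c + δ * b) ∅ (f - ∑ j ∈ Finset.range (δ + 1), a j * S' ^ j) := by
    have h4 : InG v S' b (c + δ * b) ∅ (∑ j ∈ Finset.range (δ + 1),
        ((δ.choose j : K[X]) * (g * z ^ (δ - j)) - a j) * S' ^ j) := by
      refine InG.sum hS'.monic fun j hj => ?_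
      rw [Finset.mem_range] at hj
      refine (hS'.mul_pow_inG (S' := ∅) (i := j) (hAa j) (by simp)).mono ?_ subset_rfl
      rw [Nat.cast_sub (by omega)]
      linarith
    have h5 := h2.add hS'.monic h4
    convert h5 using 1
    rw [hsum]
    simp_rw [sub_mul]
    rw [Finset.sum_sub_distrib]
    ring
  have h4 : ∀ j ≤ δ, ((c + (δ - j) * b : ℝ) : WithTop ℝ) <
      v (digit S' f j - (δ.choose j : K[X]) * (g * z ^ (δ - j))) := by
    intro j hj
    have h5 := (h3 j).2 (by simp)
    rw [digit_sub hS'.monic, digit_sum hS'.monic, Finset.sum_eq_single j, digit_mul_pow hS'.monic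
      (had j), if_pos rfl] at h5
    · have h6 := hS'.coe_lt (hAa j)
      rw [Nat.cast_sub hj] at h6
      have h7 := v.map_lt_add (coe_lt_trans h5 (y := c + (δ - j) * b) (by linarith))
        (coe_lt_trans (v.map_sub_swap _ _ ▸ h6) (y := c + (δ - j) * b) (by linarith))
      convert h7 using 2
      ring
    · intro i _ hij
      rw [digit_mul_pow hS'.monic (had i), if_neg (Ne.symm hij)]
    · intro h
      exact absurd (Finset.mem_range.2 (by omega)) h
  have h5 := h4 δ le_rfl
  rw [Nat.choose_self, Nat.cast_one, one_mul, Nat.sub_self, pow_zero, mul_one, _root_.sub_self,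
    zero_mul, _root_.add_zero] at h5
  refine ⟨?_, fun j hj => ?_⟩
  · rw [← hδ] at h5 ⊢
    exact v.map_eq_of_lt_sub h5
  · have h6 := coe_lt_mul' (zero_le_natCast v (δ.choose j))
      (coe_lt_mul h5 (coe_le_pow hvz (δ - j)))
    rw [Nat.cast_sub hj.le] at h6
    have h7 : ((c + (δ - j) * b : ℝ) : WithTop ℝ) <
      v (-((δ.choose j : K[X]) * ((digit S' f δ - g) * z ^ (δ - j)))) := by
      rw [v.map_neg]
      exact coe_lt_trans h6 (by linarith)
    have h8 := v.map_lt_add (h4 j hj.le) h7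
    convert h8 using 2
    ring

end Shape

/-! ### Passage from values in Γ to real values. -/

section Real

variable {K : Type*} [Field K] {Γ : Type*} [AddCommGroup Γ] [LinearOrder Γ]
  (φ : Γ →+o ℝ)

/-- The extension of `φ` to infinite values. -/
noncomputable def toReal : WithTop Γ →+ WithTop ℝ := φ.toAddMonoidHom.withTopMap

@[simp]
theorem toReal_coe (g : Γ) : toReal φ g = (φ g : WithTop ℝ) := rfl

@[simp]
theorem toReal_top : toReal φ ⊤ = ⊤ := rfl

theorem delta_spec {v : K[X] → WithTop Γ} {P h : K[X]} :
    delta v P h ≤ h.natDegree ∧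
    (∀ j ≤ h.natDegree, v (digit P h (delta v P h)) + delta v P h • v P ≤
      v (digit P h j) + j • v P) ∧
    ∀ j ≤ h.natDegree, delta v P h < j → v (digit P h (delta v P h)) + delta v P h • v P <
      v (digit P h j) + j • v P := by
  classical
  have hne : (Finset.range (h.natDegree + 1)).Nonempty := ⟨0, by simp⟩
  have hle : ∀ j ≤ h.natDegree, newtonMin v P h ≤ v (digit P h j) + j • v P := fun j hj =>
    Finset.inf_le (f := fun j => v (digit P h j) + j • v P) (Finset.mem_range.2 (by omega))
  obtain ⟨i, hi, hieq⟩ := Finset.exists_mem_eq_inf _ hne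
    fun j => v (digit P h j) + j • v P
  set R := (Finset.range (h.natDegree + 1)).filter fun j =>
    v (digit P h j) + j • v P = newtonMin v P h with hR
  have hRne : R.Nonempty := ⟨i, Finset.mem_filter.2 ⟨hi, hieq.symm⟩⟩
  have hdel : delta v P h = R.sup id := by
    rw [delta, hR]
  obtain ⟨r, hr, hreq⟩ := Finset.exists_mem_eq_sup R hRne id
  rw [hdel, hreq, id]
  rw [hR, Finset.mem_filter, Finset.mem_range] at hr
  refine ⟨by omega, fun j hj => hr.2.trans_le (hle j hj), fun j hj hrj => ?_⟩
  rw [hr.2]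
  refine lt_of_le_of_ne (hle j hj) fun heq => ?_
  have h1 : j ≤ R.sup id := Finset.le_sup (f := id) (Finset.mem_filter.2
    ⟨Finset.mem_range.2 (by omega), heq.symm⟩)
  rw [hreq, id] at h1
  omega

variable {φ}

theorem toReal_strictMono (hφ : Function.Injective φ) : StrictMono (toReal φ) := by
  intro a b hab
  cases a with
  | top => exact absurd hab not_top_lt
  | coe a =>
    cases b with
    | top => exact WithTop.coe_lt_top _
    | coe b =>
      rw [WithTop.coe_lt_coe] at hab
      rw [toReal_coe, toReal_coe, WithTop.coe_lt_coe]
      exact lt_of_le_of_ne (OrderHomClass.mono φ hab.le) fun h => hab.ne (hφ h)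

variable [IsOrderedAddMonoid Γ]

variable (φ) in
/-- The real valued valuation deduced from `u`. -/
noncomputable def realVal (hφ : Function.Injective φ) (u : AddValuation K[X] (WithTop Γ)) :
    AddValuation K[X] (WithTop ℝ) :=
  u.map (toReal φ) rfl (toReal_strictMono hφ).monotone

variable {hφ : Function.Injective φ} {u : AddValuation K[X] (WithTop Γ)} {f h P z : K[X]}

theorem realVal_apply (h : K[X]) : realVal φ hφ u h = toReal φ (u h) := rfl

theorem coe_le_realVal {g : Γ} : ((φ g : ℝ) : WithTop ℝ) ≤ realVal φ hφ u h ↔ (g : WithTop Γ) ≤ u h :=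
  (toReal_strictMono hφ).le_iff_le (a := (g : WithTop Γ))

theorem coe_lt_realVal {g : Γ} : ((φ g : ℝ) : WithTop ℝ) < realVal φ hφ u h ↔ (g : WithTop Γ) < u h :=
  (toReal_strictMono hφ).lt_iff_lt (a := (g : WithTop Γ))

theorem realVal_eq_top : realVal φ hφ u h = ⊤ ↔ u h = ⊤ :=
  (toReal_strictMono hφ).injective.eq_iff (b := ⊤)

theorem realVal_eq_coe {g : Γ} : realVal φ hφ u h = (φ g : ℝ) ↔ u h = g :=
  (toReal_strictMono hφ).injective.eq_iff (b := (g : WithTop Γ))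

theorem exists_of_realVal_eq {x : ℝ} (hx : realVal φ hφ u h = x) :
    ∃ g : Γ, u h = g ∧ φ g = x := by
  cases hu : u h with
  | top =>
    rw [realVal_apply, hu, toReal_top] at hx
    exact absurd hx WithTop.top_ne_coe
  | coe g =>
    rw [realVal_apply, hu, toReal_coe, WithTop.coe_inj] at hx
    exact ⟨g, rfl, hx⟩

theorem coe_add_nsmul_lt_iff {c b : ℝ} {δ j : ℕ} {w : WithTop ℝ} :
    (c : WithTop ℝ) + δ • (b : WithTop ℝ) < w + j • (b : WithTop ℝ) ↔
      ((c + (δ - j) * b : ℝ) : WithTop ℝ) < w := by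
  cases w with
  | top =>
    rw [top_add]
    refine ⟨fun _ => WithTop.coe_lt_top _, fun _ => ?_⟩
    rw [← WithTop.coe_nsmul, ← WithTop.coe_add]
    exact WithTop.coe_lt_top _
  | coe w =>
    rw [← WithTop.coe_nsmul, ← WithTop.coe_nsmul, ← WithTop.coe_add, ← WithTop.coe_add,
      WithTop.coe_lt_coe, WithTop.coe_lt_coe, _root_.nsmul_eq_mul, _root_.nsmul_eq_mul]
    constructor <;> intro h <;> linarith

theorem coe_add_nsmul_le_iff {c b : ℝ} {δ j : ℕ} {w : WithTop ℝ} :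
    (c : WithTop ℝ) + δ • (b : WithTop ℝ) ≤ w + j • (b : WithTop ℝ) ↔
      ((c + (δ - j) * b : ℝ) : WithTop ℝ) ≤ w := by
  cases w with
  | top => simp
  | coe w =>
    rw [← WithTop.coe_nsmul, ← WithTop.coe_nsmul, ← WithTop.coe_add, ← WithTop.coe_add,
      WithTop.coe_le_coe, WithTop.coe_le_coe, _root_.nsmul_eq_mul, _root_.nsmul_eq_mul]
    constructor <;> intro h <;> linarith

theorem lt_iff_realVal {a a' : K[X]} {c b : ℝ} {δ j : ℕ} (ha : realVal φ hφ u a = c)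
    (hz : realVal φ hφ u z = b) : u a + δ • u z < u a' + j • u z ↔
      ((c + (δ - j) * b : ℝ) : WithTop ℝ) < realVal φ hφ u a' := by
  rw [← (toReal_strictMono hφ).lt_iff_lt, map_add, map_add, map_nsmul, map_nsmul,
    ← realVal_apply (hφ := hφ), ← realVal_apply (hφ := hφ), ← realVal_apply (hφ := hφ), ha, hz,
    coe_add_nsmul_lt_iff]

theorem le_iff_realVal {a a' : K[X]} {c b : ℝ} {δ j : ℕ} (ha : realVal φ hφ u a = c)
    (hz : realVal φ hφ u z = b) : u a + δ • u z ≤ u a' + j • u z ↔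
      ((c + (δ - j) * b : ℝ) : WithTop ℝ) ≤ realVal φ hφ u a' := by
  rw [← (toReal_strictMono hφ).le_iff_le, map_add, map_add, map_nsmul, map_nsmul,
    ← realVal_apply (hφ := hφ), ← realVal_apply (hφ := hφ), ← realVal_apply (hφ := hφ), ha, hz,
    coe_add_nsmul_le_iff]

/-- Links the index read off the Newton polygon to the Gauss function at the slope v P. A non-zero h
has some digit of finite value, so the minimum is finite. -/
theorem top_delta {s : ℝ} (hP : KeyPair (realVal φ hφ u) P s) (hs : realVal φ hφ u P = s)
    (hh : h ≠ 0) : ∃ c : ℝ, Top (realVal φ hφ u) P s (c + delta u P h * s) (delta u P h) h := by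
  obtain ⟨c₀, r₀, hT⟩ := hP.exists_top hh
  obtain ⟨hd0, hd1, hd2⟩ := delta_spec (P := P) (h := h) (v := u)
  set r := delta u P h with hr
  have hr₀ : r₀ ≤ h.natDegree := by
    by_contra hlt
    have h1 := hT.digit_eq
    rw [digit_eq_zero hP.monic, AddValuation.map_zero] at h1
    · exact WithTop.top_ne_coe h1
    · have := hP.pos
      nlinarith
  have hbig : ∀ j, h.natDegree < j → digit P h j = 0 := fun j hj =>
    digit_eq_zero hP.monic (by have := hP.pos; nlinarith)
  cases hv : realVal φ hφ u (digit P h r) with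
  | top =>
    exfalso
    have h1 := hd1 r₀ hr₀
    rw [realVal_eq_top.1 hv, top_add, top_le_iff] at h1
    obtain ⟨g, hg, -⟩ := exists_of_realVal_eq hT.digit_eq
    obtain ⟨g', hg', -⟩ := exists_of_realVal_eq hs
    rw [hg, hg', ← WithTop.coe_nsmul, ← WithTop.coe_add] at h1
    exact WithTop.coe_ne_top h1
  | coe c =>
    refine ⟨c, top_of_digit_eq (fun j => ?_) ?_⟩
    · rcases lt_or_ge h.natDegree j with hj | hj
      · rw [hbig j hj, AddValuation.map_zero]
        exact ⟨le_top, fun _ => WithTop.coe_lt_top _⟩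
      · have h1 := (le_iff_realVal hv hs).1 (hd1 j hj)
        refine ⟨coe_le_trans h1 (by linarith), fun hj' => ?_⟩
        exact coe_lt_trans ((lt_iff_realVal hv hs).1 (hd2 j hj (by simpa using hj'))) (by linarith)
    · rw [hv]
      congr 1
      ring

end Real

end KeyPoly

namespace KeyPoly

/-! ### Case 2b as a convergent sequence; degree deg Q_l does not reach the bound. -/

section Values

open Filter Topology

variable {K : Type*} [Field K] {Γ : Type*} [AddCommGroup Γ] [LinearOrder Γ]
  [IsOrderedAddMonoid Γ] {φ : Γ →+o ℝ} {u : AddValuation K[X] (WithTop Γ)} {F : Family K}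
  {l : Ordinal.{0}} {n : ℕ} {f : K[X]} {z : ℕ → K[X]} {βbar : Γ}

/-- A least upper bound in Γ might a priori exceed the real supremum. A late step g of the sequence
would then be smaller than the difference, and βbar - g would be a smaller upper bound in Γ. -/
theorem tendsto_of_isLUB (hφ : Function.Injective φ) {γ : ℕ → Γ} (hγ : StrictMono γ)
    (hlub : IsLUB (Set.range fun t => γ (t + 1)) βbar) :
    Tendsto (fun t => φ (γ t)) atTop (𝓝 (φ βbar)) := by
  have hφm : StrictMono φ := (OrderHomClass.mono φ).strictMono_of_injective hφ
  have hmono : StrictMono fun t => φ (γ t) := hφm.comp hγ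
  have hle : ∀ t, γ t ≤ βbar := fun t =>
    (hγ (Nat.lt_succ_self t)).le.trans (hlub.1 ⟨t, rfl⟩)
  have hbdd : BddAbove (Set.range fun t => φ (γ t)) :=
    ⟨φ βbar, by rintro _ ⟨t, rfl⟩; exact hφm.monotone (hle t)⟩
  have htend := tendsto_atTop_ciSup hmono.monotone hbdd
  set s := ⨆ t, φ (γ t) with hs
  have hts : ∀ t, φ (γ t) ≤ s := fun t => le_ciSup hbdd t
  have hsB : s ≤ φ βbar := ciSup_le fun t => hφm.monotone (hle t)
  rcases hsB.eq_or_lt with h | h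
  · rwa [← h]
  exfalso
  obtain ⟨t, ht⟩ := (htend.eventually (lt_mem_nhds (show s - (φ βbar - s) < s by linarith))).exists
  set g := γ (t + 1) - γ t with hg
  have hg0 : 0 < g := sub_pos.2 (hγ (Nat.lt_succ_self t))
  have hφg : φ g = φ (γ (t + 1)) - φ (γ t) := map_sub φ _ _
  have hub : βbar ≤ βbar - g := hlub.2 (by
    rintro _ ⟨t', rfl⟩
    rw [← hφm.le_iff_le, map_sub, hφg]
    have h1 := hts (t' + 1)
    have h2 := hts (t + 1)
    linarith)
  exact absurd hub (not_le.2 (sub_lt_self _ hg0))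

theorem IsHomogeneous.val_eq {β : Γ} {S : K[X]} (h : IsHomogeneous u F n l β S) : u S = β := by
  obtain ⟨s, hs, rfl, h2⟩ := h
  refine le_antisymm (not_lt.1 h2) ?_
  refine Multiset.sum_induction (fun m : K[X] => (β : WithTop Γ) ≤ u m) s
    (fun a b ha hb => u.map_le_add ha hb) (by simp [u.map_zero]) ?_
  exact fun m hm => (hs m hm).2.ge

theorem val_sum_eq_min {B : Finset Γ} {T : Γ → K[X]} (hT : ∀ b ∈ B, u (T b) = b)
    (hB : B.Nonempty) : u (∑ b ∈ B, T b) = B.min' hB := by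
  have hm := B.min'_mem hB
  rw [← Finset.add_sum_erase _ _ hm, u.map_add_eq_of_lt_left, hT _ hm]
  rw [hT _ hm]
  refine u.map_lt_sum WithTop.coe_ne_top fun b hb => ?_
  rw [hT b (Finset.mem_of_mem_erase hb), WithTop.coe_lt_coe]
  exact B.min'_lt_of_mem_erase_min' hB hb

theorem partialSum_zero : partialSum F l z 0 = F.Q l := by
  simp [partialSum]

theorem partialSum_succ (t : ℕ) : partialSum F l z (t + 1) = partialSum F l z t + z t := by
  rw [partialSum, Finset.sum_range_succ, ← add_assoc]
  rfl

/-- A later partial sum differs from the s-th by something of value u (z s). Since the supremum is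
not attained, some later one has strictly greater value than the s-th, whose value is therefore u (z
s). -/
theorem IsCase2b.exists_values (hc : IsCase2b u f F l z βbar) :
    ∃ γ : ℕ → Γ, StrictMono γ ∧ (∀ t, u (partialSum F l z t) = γ t) ∧ (∀ t, u (z t) = γ t) ∧
      IsLUB (Set.range fun t => γ (t + 1)) βbar := by
  have hz : StrictMono fun k => u (z k) :=
    strictMono_nat_of_lt_succ fun k => (hc.inT (k + 1)).val_lt k (Nat.lt_succ_self k)
  have hlt : ∀ t, u (partialSum F l z (t + 1)) < βbar := fun t =>
    lt_of_le_of_ne (hc.isLUB_seq.1 ⟨t, rfl⟩) fun h =>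
      hc.not_attained ⟨z, t, hc.inT t, h.symm⟩
  have h01 : u (partialSum F l z 0) ≤ u (partialSum F l z 1) := by
    rw [partialSum_succ 0]
    refine u.map_le_add le_rfl ?_
    rw [(hc.inT 0).val_zero, partialSum_zero]
  have hlt' : ∀ t, u (partialSum F l z t) < βbar := fun t => by
    cases t with
    | zero => exact h01.trans_lt (hlt 0)
    | succ t => exact hlt t
  have hsub : ∀ s t, s < t → u (partialSum F l z t - partialSum F l z s) = u (z s) := by
    intro s t hst
    induction t, hst using Nat.le_induction with
    | base => rw [partialSum_succ, add_sub_cancel_left]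
    | succ t hst ih =>
      rw [partialSum_succ, show partialSum F l z t + z t - partialSum F l z s =
        (partialSum F l z t - partialSum F l z s) + z t by ring, u.map_add_eq_of_lt_left, ih]
      rw [ih]
      exact hz hst
  have hex : ∀ s, ∃ t, s < t ∧ u (partialSum F l z s) < u (partialSum F l z t) := by
    intro s
    -- Exceeding the largest value up to s forces the index found to be later than s.
    obtain ⟨i, -, hi⟩ := (Finset.range (s + 1)).exists_max_image
      (fun i => u (partialSum F l z i)) ⟨0, by simp⟩
    obtain ⟨_, ⟨t, rfl⟩, ht⟩ := (lt_isLUB_iff hc.isLUB_seq).1 (hlt' i)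
    refine ⟨t + 1, ?_, (hi s (by simp)).trans_lt ht⟩
    by_contra hle
    exact absurd (hi (t + 1) (Finset.mem_range.2 (by omega))) (not_le.2 ht)
  have heq : ∀ s, u (partialSum F l z s) = u (z s) := fun s => by
    obtain ⟨t, hst, ht⟩ := hex s
    rw [← hsub s t hst, u.map_sub_eq_of_lt_right ht]
  have hfin : ∀ t, ∃ g : Γ, u (z t) = g := fun t => by
    obtain ⟨g, hg⟩ := (hc.inT t).homogeneous t le_rfl
    exact ⟨g, hg.val_eq⟩
  choose γ hγ using hfin
  refine ⟨γ, fun s t hst => ?_, fun t => (heq t).trans (hγ t), hγ, ?_⟩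
  · have := hz hst
    simp only [hγ] at this
    exact WithTop.coe_lt_coe.1 this
  · have h1 := hc.isLUB_seq
    simp only [heq, hγ] at h1
    refine ⟨?_, fun b hb => ?_⟩
    · rintro _ ⟨t, rfl⟩
      exact WithTop.coe_le_coe.1 (h1.1 ⟨t, rfl⟩)
    · refine WithTop.coe_le_coe.1 (h1.2 ?_)
      rintro _ ⟨t, rfl⟩
      exact WithTop.coe_le_coe.2 (hb ⟨t, rfl⟩)

/-- The data of Case 2b, with real values. -/
structure CaseData (φ : Γ →+o ℝ) (hφ : Function.Injective φ) (u : AddValuation K[X] (WithTop Γ))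
    (f : K[X]) (F : Family K) (l : Ordinal.{0}) (z : ℕ → K[X]) (βbar : Γ) (γ : ℕ → Γ) (c : ℝ) :
    Prop where
  limSeq : LimSeq (realVal φ hφ u) (partialSum F l z) (fun t => φ (γ t)) (φ βbar)
  val : ∀ t, u (partialSum F l z t) = γ t
  lt_bar : ∀ t, γ t < βbar
  exists_lt : ∀ b < βbar, ∃ t, b < γ t
  top : ∀ t, Top (realVal φ hφ u) (partialSum F l z t) (φ (γ t))
    (c + delta u (F.Q l) f * φ (γ t)) (delta u (F.Q l) f) f

theorem DegData.degree_partialSum_sub (D : DegData F l) {β : ℕ → Γ} {t : ℕ}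
    (hz : ∀ k < t, IsHomogeneous u F n l (β k) (z k)) :
    (partialSum F l z t - F.Q l).degree < (F.Q l).degree := by
  rw [partialSum, add_sub_cancel_left]
  have hbot : (⊥ : WithBot ℕ) < (F.Q l).degree :=
    bot_lt_iff_ne_bot.2 (degree_ne_bot.2 (D.monic l le_rfl).ne_zero)
  refine Finset.sum_induction z (fun m : K[X] => m.degree < (F.Q l).degree)
    (fun a b ha hb => (degree_add_le _ _).trans_lt (max_lt ha hb)) (by simpa using hbot) ?_
  exact fun b hb => D.degree_homogeneous_lt (hz b (Finset.mem_range.1 hb))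

/-- The top index of f stays δ: indices above δ remain excluded when the slope rises, and those
below are bounded because the initial form is a δ-th power. -/
theorem IsCase2b.exists_caseData {hφ : Function.Injective φ} (hc : IsCase2b u f F l z βbar)
    (D : DegData F l) (hkey : ∀ s : ℝ, realVal φ hφ u (F.Q l) = s → KeyPair (realVal φ hφ u) (F.Q l) s)
    (hf : f ≠ 0) : ∃ (γ : ℕ → Γ) (c : ℝ), CaseData φ hφ u f F l z βbar γ c := by
  obtain ⟨γ, hγ, hval, hvalz, hlub⟩ := hc.exists_values
  have hφm : StrictMono φ := (OrderHomClass.mono φ).strictMono_of_injective hφ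
  have hv0 : realVal φ hφ u (F.Q l) = (φ (γ 0) : ℝ) := by
    rw [realVal_eq_coe, ← hval 0, partialSum_zero]
  have hQ := hkey _ hv0
  have hhom : ∀ k, IsHomogeneous u F f.natDegree l (γ k) (z k) := fun k => by
    obtain ⟨g, hg⟩ := (hc.inT k).homogeneous k le_rfl
    have h1 := hg.val_eq
    rw [hvalz, WithTop.coe_inj] at h1
    rwa [h1]
  have hdeg : ∀ t, (partialSum F l z t - F.Q l).degree < (F.Q l).degree := fun t =>
    D.degree_partialSum_sub fun k _ => hhom k
  have hle : ∀ t, γ 0 ≤ γ t := fun t => hγ.monotone (Nat.zero_le t)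
  have H : LimSeq (realVal φ hφ u) (partialSum F l z) (fun t => φ (γ t)) (φ βbar) := by
    refine ⟨fun t => ?_, fun t => ?_, hφm.comp hγ, tendsto_of_isLUB hφ hγ hlub, fun t t' => ?_⟩
    · have := hQ.translate (hdeg t) ?_
      · rwa [_root_.add_sub_cancel] at this
      · rw [coe_le_realVal]
        refine u.map_le_sub ?_ ?_
        · rw [hval, WithTop.coe_le_coe]
          exact hle t
        · rw [← partialSum_zero (z := z), hval]
    · rw [realVal_eq_coe, hval]
    · rw [partialSum_zero, show partialSum F l z t - partialSum F l z t' =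
        (partialSum F l z t - F.Q l) - (partialSum F l z t' - F.Q l) by ring]
      exact (degree_sub_le _ _).trans_lt (max_lt (hdeg t) (hdeg t'))
  obtain ⟨c, hT0⟩ := top_delta hQ hv0 hf
  set δ := delta u (F.Q l) f with hδ
  refine ⟨γ, c, H, hval, fun t => ?_, fun b hb => ?_, fun t => ?_⟩
  · exact (hγ (Nat.lt_succ_self t)).trans_le (hlub.1 ⟨t, rfl⟩)
  · obtain ⟨_, ⟨t, rfl⟩, ht⟩ := (lt_isLUB_iff hlub).1 hb
    exact ⟨t + 1, ht⟩
  induction t with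
  | zero => rwa [partialSum_zero]
  | succ t ih =>
    have h1 := H.top_translate (Nat.le_succ t) ih
    have hvd : realVal φ hφ u (digit (partialSum F l z (t + 1)) f δ) = c := by
      rw [h1.digit_eq]
      congr 1
      ring
    have hvz : realVal φ hφ u (z (t + 1)) = (φ (γ (t + 1)) : ℝ) := by
      rw [realVal_eq_coe, hvalz]
    have hstep : φ (γ t) < φ (γ (t + 1)) := hφm (hγ (Nat.lt_succ_self t))
    refine top_of_digit_eq (fun j => ?_) ?_
    · rcases lt_trichotomy j δ with hj | rfl | hj
      · refine ⟨?_, fun h => absurd hj.le h⟩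
        -- Membership in T constrains initial forms only before its last term, so the condition at t
        -- + 1 is taken from a longer expansion.
        have h2 := (lt_iff_realVal hvd hvz).1
          ((hc.inT (t + 2)).init (t + 1) (by omega) j hj)
        have h3 := coe_le_mul (zero_le_natCast (realVal φ hφ u) (δ.choose j))
          (coe_le_mul hvd.ge (coe_le_pow hvz.ge (δ - j)))
        rw [Nat.cast_sub hj.le] at h3
        have h4 := (realVal φ hφ u).map_le_add h2.le (coe_le_trans h3
          (y := c + (δ - j) * φ (γ (t + 1))) (by linarith))
        rw [mul_assoc, sub_add_cancel] at h4
        exact coe_le_trans h4 (by linarith)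
      · rw [hvd]
        refine ⟨?_, fun h => absurd (Set.mem_Iic.2 le_rfl) h⟩
        rw [WithTop.coe_le_coe]
        linarith
      · have h2 := (h1.1 j).2 (by simpa using hj)
        have h5 : (δ : ℝ) + 1 ≤ j := by exact_mod_cast hj
        have h3 := coe_lt_trans h2 (y := c + δ * φ (γ (t + 1)) - j * φ (γ (t + 1))) (by nlinarith)
        exact ⟨h3.le, fun _ => h3⟩
    · rw [hvd]
      congr 1
      ring

namespace CaseData

variable {hφ : Function.Injective φ} {γ : ℕ → Γ} {c : ℝ}

/-- No polynomial of degree `deg Q_l` reaches the bound `β̄`. -/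
theorem not_le_val (C : CaseData φ hφ u f F l z βbar γ c) (hc : IsCase2b u f F l z βbar)
    (D : DegData F l) {G : K[X]} (hG : IsExpansion u F f.natDegree l (G - F.Q l))
    (hle : (βbar : WithTop Γ) ≤ u G) : False := by
  classical
  have hφm : StrictMono φ := (OrderHomClass.mono φ).strictMono_of_injective hφ
  have H := C.limSeq
  set v := realVal φ hφ u with hv
  set δ := delta u (F.Q l) f with hδ
  obtain ⟨B, T, hT, hsum⟩ := hG
  have hTval : ∀ b ∈ B, u (T b) = b := fun b hb => (hT b hb).val_eq
  have hTdeg : ∀ b ∈ B, (T b).degree < (F.Q l).degree := fun b hb =>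
    D.degree_homogeneous_lt (hT b hb)
  have hQ0 : u (F.Q l) = γ 0 := by rw [← C.val 0, partialSum_zero]
  have hy : u (G - F.Q l) = γ 0 := by
    rw [u.map_sub_eq_of_lt_right, hQ0]
    rw [hQ0]
    exact (WithTop.coe_lt_coe.2 (C.lt_bar 0)).trans_le hle
  have hBne : B.Nonempty := by
    by_contra h
    rw [Finset.not_nonempty_iff_eq_empty] at h
    rw [hsum, h, Finset.sum_empty, u.map_zero] at hy
    exact WithTop.top_ne_coe hy
  have hmin : B.min' hBne = γ 0 := by
    rw [hsum, val_sum_eq_min hTval hBne, WithTop.coe_inj] at hy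
    exact hy
  -- The homogeneous parts of G - Q_l of value below βbar, in increasing order, will form an element
  -- of T; omitting the others keeps the value at least βbar.
  set B' := B.filter (· < βbar) with hB'
  have h0B' : γ 0 ∈ B' := Finset.mem_filter.2 ⟨hmin ▸ B.min'_mem hBne, C.lt_bar 0⟩
  obtain ⟨m, hm⟩ : ∃ m, B'.card = m + 1 :=
    ⟨B'.card - 1, by have := Finset.card_pos.2 ⟨_, h0B'⟩; omega⟩
  set e := B'.orderEmbOfFin hm with he
  -- The enumeration is continued by its last value, to be defined on ℕ.
  set b : ℕ → Γ := fun k => e ⟨min k m, by omega⟩ with hb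
  have hbmem : ∀ k, b k ∈ B' := fun k => B'.orderEmbOfFin_mem hm _
  have hbB : ∀ k, b k ∈ B := fun k => (Finset.mem_filter.1 (hbmem k)).1
  have hbbar : ∀ k, b k < βbar := fun k => (Finset.mem_filter.1 (hbmem k)).2
  have hb0 : ∀ k, γ 0 ≤ b k := fun k => hmin ▸ B.min'_le _ (hbB k)
  have hblt : ∀ {i k}, i < k → k ≤ m → b i < b k := fun {i k} hik hk => by
    refine e.strictMono ?_
    rw [Fin.mk_lt_mk]
    omega
  have hbsurj : ∀ x ∈ B', ∃ k ≤ m, b k = x := fun x hx => by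
    have : x ∈ Set.range e := by
      rw [he, Finset.range_orderEmbOfFin]
      exact hx
    obtain ⟨i, hi⟩ := this
    refine ⟨i, by omega, ?_⟩
    have h1 : (⟨min (i : ℕ) m, by omega⟩ : Fin (m + 1)) = i := Fin.ext (min_eq_left (by omega))
    exact (congrArg e h1).trans hi
  set z' : ℕ → K[X] := fun k => T (b k) with hz'
  have hhom : ∀ k, IsHomogeneous u F f.natDegree l (b k) (z' k) := fun k => hT _ (hbB k)
  have hrem : ∀ k ≤ m, G - partialSum F l z' (k + 1) = ∑ x ∈ B.filter (b k < ·), T x := by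
    intro k hk
    have h1 : ∑ i ∈ Finset.range (k + 1), z' i = ∑ x ∈ B.filter (¬ b k < ·), T x := by
      have h2 : B.filter (¬ b k < ·) = (Finset.range (k + 1)).image b := by
        ext x
        rw [Finset.mem_filter, Finset.mem_image, not_lt]
        constructor
        · rintro ⟨hx, hxk⟩
          obtain ⟨i, hi, rfl⟩ := hbsurj x (Finset.mem_filter.2 ⟨hx, hxk.trans_lt (hbbar k)⟩)
          refine ⟨i, Finset.mem_range.2 ?_, rfl⟩
          by_contra hik
          exact absurd (hblt (show k < i by omega) hi) (not_lt.2 hxk)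
        · rintro ⟨i, hi, rfl⟩
          rw [Finset.mem_range] at hi
          refine ⟨hbB i, ?_⟩
          rcases (Nat.lt_succ_iff.1 hi).eq_or_lt with rfl | hik
          · exact le_rfl
          · exact (hblt hik hk).le
      rw [h2, Finset.sum_image]
      intro i hi j hj hij
      rw [Finset.mem_coe, Finset.mem_range] at hi hj
      rcases lt_trichotomy i j with h | h | h
      · exact absurd hij (hblt h (by omega)).ne
      · exact h
      · exact absurd hij (hblt h (by omega)).ne'
    rw [partialSum, h1, ← _root_.sub_sub, hsum, ← Finset.sum_filter_add_sum_filter_not B (b k < ·)]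
    ring
  have hvz' : ∀ k, v (z' k) = (φ (b k) : ℝ) := fun k => by
    rw [realVal_eq_coe]
    exact hTval _ (hbB k)
  -- Both this partial sum and a late term of the given sequence have value greater than b k, so
  -- their difference does too and `LimSeq.inG_singleton` applies at that slope.
  have hshape : ∀ k ≤ m, KeyPair v (partialSum F l z' (k + 1)) (φ (b k)) ∧
      InG v (partialSum F l z' (k + 1)) (φ (b k)) (c + δ * φ (b k)) {δ} f ∧
      v (digit (partialSum F l z' (k + 1)) f δ) = c := by
    intro k hk
    obtain ⟨t, ht⟩ := C.exists_lt _ (hbbar k)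
    refine H.inG_singleton (t := t) C.top (hφm.monotone (hb0 k)) (hφm ht) ?_ ?_
    · have h1 := D.degree_partialSum_sub (t := k + 1) fun i _ => hhom i
      have h2 := H.degree_sub_lt t 0
      rw [partialSum_zero] at h2 ⊢
      rw [show partialSum F l z' (k + 1) - partialSum F l z t =
        (partialSum F l z' (k + 1) - F.Q l) - (partialSum F l z t - F.Q l) by ring]
      exact (degree_sub_le _ _).trans_lt (max_lt h1 h2)
    · rw [coe_lt_realVal]
      have h1 : (b k : WithTop Γ) < u (-(G - partialSum F l z' (k + 1))) := by
        rw [u.map_neg, hrem k hk]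
        refine u.map_lt_sum WithTop.coe_ne_top fun x hx => ?_
        rw [Finset.mem_filter] at hx
        rw [hTval x hx.1, WithTop.coe_lt_coe]
        exact hx.2
      have h2 : (b k : WithTop Γ) < u G := (WithTop.coe_lt_coe.2 (hbbar k)).trans_le hle
      have h3 : (b k : WithTop Γ) < u (-partialSum F l z t) := by
        rw [u.map_neg, C.val, WithTop.coe_lt_coe]
        exact ht
      have h4 := u.map_lt_add (u.map_lt_add h1 h2) h3
      convert h4 using 2
      ring
  have hInT : InT u f F l z' m := by
    refine ⟨fun k _ => ⟨b k, hhom k⟩, ?_, fun k hk => ?_, fun j hj => ?_, fun k hk j hj => ?_⟩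
    · have h1 : b 0 = γ 0 := by
        refine le_antisymm ?_ (hb0 0)
        obtain ⟨k, hk, hk'⟩ := hbsurj _ h0B'
        rw [← hk']
        rcases Nat.eq_zero_or_pos k with rfl | hpos
        · exact le_rfl
        · exact (hblt hpos hk).le
      rw [hQ0, ← h1]
      exact hTval _ (hbB 0)
    · change u (T (b k)) < u (T (b (k + 1)))
      rw [hTval _ (hbB _), hTval _ (hbB _), WithTop.coe_lt_coe]
      exact hblt (Nat.lt_succ_self k) hk
    · obtain ⟨-, h2, h3⟩ := hshape m le_rfl
      rw [lt_iff_realVal h3 (hvz' m)]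
      exact coe_lt_trans ((h2 j).2 (by simpa using hj.ne)) (by linarith)
    · obtain ⟨h1, h2, h3⟩ := hshape k hk.le
      have hS := partialSum_succ (F := F) (l := l) (z := z') k
      have hd1 : (z' k).degree < (partialSum F l z' (k + 1)).degree := by
        have h4 := degree_add_eq_left_of_degree_lt
          (D.degree_partialSum_sub (t := k + 1) fun i _ => hhom i)
        rw [_root_.add_sub_cancel] at h4
        rw [h4]
        exact hTdeg _ (hbB k)
      have hd0 : (z' k).degree < (partialSum F l z' k).degree := by
        have h4 := degree_add_eq_left_of_degree_lt
          (D.degree_partialSum_sub (t := k) fun i _ => hhom i)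
        rw [_root_.add_sub_cancel] at h4
        rw [h4]
        exact hTdeg _ (hbB k)
      have h0 : KeyPair v (partialSum F l z' k) (φ (b k)) := by
        have := h1.translate (z := -z' k) (by rwa [degree_neg])
          (by rw [v.map_neg, hvz'])
        rwa [hS, add_neg_cancel_right] at this
      obtain ⟨h5, h6⟩ := h1.digit_sub_lt h0 hS.symm hd0 (hvz' k).ge h2 h3
      rw [lt_iff_realVal h5 (hvz' k)]
      exact h6 j hj
  have hmem : u (partialSum F l z' (m + 1)) ∈ valuesT u f F l := ⟨z', m, hInT, rfl⟩
  have hge : (βbar : WithTop Γ) ≤ u (partialSum F l z' (m + 1)) := by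
    have h1 : (βbar : WithTop Γ) ≤ u (G - partialSum F l z' (m + 1)) := by
      rw [hrem m le_rfl]
      refine u.map_le_sum fun x hx => ?_
      rw [Finset.mem_filter] at hx
      rw [hTval x hx.1, WithTop.coe_le_coe]
      by_contra hlt
      obtain ⟨k, hk, rfl⟩ := hbsurj x (Finset.mem_filter.2 ⟨hx.1, not_le.1 hlt⟩)
      rcases hk.eq_or_lt with rfl | hkm
      · exact lt_irrefl _ hx.2
      · exact lt_asymm hx.2 (hblt hkm le_rfl)
    have h2 := u.map_le_sub hle h1
    rwa [sub_sub_cancel] at h2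
  refine hc.not_attained ?_
  rwa [le_antisymm hge (hc.isLUB.1 hmem)]

end CaseData

end Values

end KeyPoly

namespace KeyPoly

/-! ### Existence of a candidate. -/

section Core

variable {K : Type*} [Field K] {Γ : Type*} [AddCommGroup Γ] [LinearOrder Γ]
  [IsOrderedAddMonoid Γ] {φ : Γ →+o ℝ} {hφ : Function.Injective φ}
  {u : AddValuation K[X] (WithTop Γ)} {F : Family K} {l : Ordinal.{0}} {n : ℕ} {f h G : K[X]}
  {z : ℕ → K[X]} {βbar : Γ} {p e₀ : ℕ}

theorem IsExpansion.val_ne_top (hh : IsExpansion u F n l h) (h0 : h ≠ 0) : u h ≠ ⊤ := by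
  obtain ⟨B, T, hT, rfl⟩ := hh
  have hB : B.Nonempty := by
    by_contra hB
    rw [Finset.not_nonempty_iff_eq_empty] at hB
    rw [hB, Finset.sum_empty] at h0
    exact h0 rfl
  rw [val_sum_eq_min (fun b hb => (hT b hb).val_eq) hB]
  exact WithTop.coe_ne_top

/-- Otherwise f would be an expansion not involving Q_l, and a non-zero such expansion has finite
value. -/
theorem DegData.natDegree_le (D : DegData F l) (hf : HasStandardExpansion u F n l f)
    (huf : u f = ⊤) (hf0 : f ≠ 0) : (F.Q l).natDegree ≤ f.natDegree := by
  by_contra hlt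
  exact (D.isExpansion_of_degree_lt hf (degree_lt_degree (not_le.1 hlt))).val_ne_top hf0 huf

theorem DegData.natDegree_lt (D : DegData F l) (hdeg : h.degree < (F.Q l).degree) :
    h.natDegree < (F.Q l).natDegree := by
  rcases eq_or_ne h 0 with rfl | hh
  · rw [natDegree_zero]
    exact D.pos l le_rfl
  · exact natDegree_lt_natDegree hh hdeg

theorem DegData.isExpansion (D : DegData F l) (huf : u f = ⊤) (hf0 : f ≠ 0)
    (hexp : ∀ h : K[X], h = f ∨ h.natDegree < f.natDegree →
      HasStandardExpansion u F f.natDegree l h) (hdeg : h.degree < (F.Q l).degree) :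
    IsExpansion u F f.natDegree l h :=
  D.isExpansion_of_degree_lt (hexp h (Or.inr ((D.natDegree_lt hdeg).trans_le
    (D.natDegree_le (hexp f (Or.inl rfl)) huf hf0)))) hdeg

/-- The candidate has the least positive `Deep` degree. The absence of smaller `Deep` degrees is
recorded because crossing a limit step in the induction needs it. -/
theorem IsCase2b.exists_candidate [Fact p.Prime] [CharP K p] {γ : ℕ → Γ} {c : ℝ}
    (hc : IsCase2b u f F l z βbar) (D : DegData F l) (C : CaseData φ hφ u f F l z βbar γ c)
    (huf : u f = ⊤) (hf0 : f ≠ 0)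
    (hexp : ∀ h : K[X], h = f ∨ h.natDegree < f.natDegree →
      HasStandardExpansion u F f.natDegree l h) :
    ∃ (e₀ : ℕ) (G : K[X]), IsLimitCandidate u f p F l βbar e₀ G ∧ ∀ r, 0 < r → r < p ^ e₀ →
      ¬ Deep (realVal φ hφ u) (partialSum F l z) (fun t => φ (γ t)) r := by
  classical
  have H := C.limSeq
  set v := realVal φ hφ u with hv
  set P := partialSum F l z with hP
  have hP0 : P 0 = F.Q l := partialSum_zero
  set δ := delta u (F.Q l) f with hδ
  have hp : p.Prime := Fact.out
  -- Top index 0 would make the value of f finite.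
  have hδ0 : 0 < δ := by
    refine Nat.pos_of_ne_zero fun h0 => ?_
    have h1 := C.top 0
    rw [← hδ, h0] at h1
    have h2 := (H.key 0).top_zero h1
    rw [realVal_eq_top.2 huf] at h2
    exact WithTop.top_ne_coe h2
  have hDδ := H.deep_prime_pow p hδ0 (H.deep_of_top (t₀ := 0) fun t _ => C.top t)
  have hD1 : ¬ Deep v P (fun t => φ (γ t)) 1 := by
    rintro ⟨G, t₀, hGm, hdeg, hG⟩
    rw [one_mul, hP0] at hdeg
    have hQ := D.monic l le_rfl
    refine C.not_le_val hc D (G := G) (D.isExpansion huf hf0 hexp ?_) ?_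
    · have hd : G.degree = (F.Q l).degree := by
        rw [degree_eq_natDegree hGm.ne_zero, degree_eq_natDegree hQ.ne_zero, hdeg]
      exact hd ▸ degree_sub_lt_left hd hGm.ne_zero (by rw [hGm.leadingCoeff, hQ.leadingCoeff])
    · rw [← coe_le_realVal (hφ := hφ)]
      have := H.le_of_forall (c := 0) (k := 1) (h := G) (t₀ := t₀) fun t ht => by
        have h1 := (H.keyAt (le_refl t)).coe_le (hG t ht)
        rw [Nat.cast_one, one_mul] at h1
        rwa [_root_.zero_add, one_mul]
      rwa [_root_.zero_add, one_mul] at this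
  have hex : ∃ m, 0 < m ∧ Deep v P (fun t => φ (γ t)) m := ⟨_, pow_pos hp.pos _, hDδ⟩
  set m := Nat.find hex with hm
  obtain ⟨hm0, hDm⟩ := Nat.find_spec hex
  have hmin : ∀ r, 0 < r → r < m → ¬ Deep v P (fun t => φ (γ t)) r := fun r h0 hr hD =>
    Nat.find_min hex hr ⟨h0, hD⟩
  have hmp : p ^ padicValNat p m = m := by
    refine le_antisymm (Nat.le_of_dvd hm0 pow_padicValNat_dvd) (not_lt.1 fun h => ?_)
    exact hmin _ (pow_pos hp.pos _) h (H.deep_prime_pow p hm0 hDm)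
  set e := padicValNat p m with he
  have hle : m ≤ p ^ padicValNat p δ := Nat.find_min' hex ⟨pow_pos hp.pos _, hDδ⟩
  obtain ⟨t, a, had, ham, haz, hval⟩ := H.exists_weaklyAffine p hm0 hmin hDm
  refine ⟨e, _, ⟨?_, ?_, ⟨t, a, fun j _ => ?_, ?_, fun j hj h0 hjp => ?_, rfl⟩, ?_⟩, ?_⟩
  · refine Nat.pos_of_ne_zero fun h0 => hD1 ?_
    rw [h0, pow_zero] at hmp
    rw [hmp]
    exact hDm
  · rw [← hmp] at hle
    exact (Nat.pow_le_pow_iff_right hp.one_lt).1 hle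
  · exact (D.isExpansion huf hf0 hexp (hP0 ▸ had j)).add_nat fun s hs _ => hc.α_eq s hs
  · rw [hmp, ham]
  · rw [hmp] at hj
    rcases hj.eq_or_lt with rfl | hj
    · exact absurd ⟨e, hmp.symm⟩ hjp
    · exact haz j hj h0 hjp
  · rw [hmp, hc.Q_eq t, ← coe_le_realVal (hφ := hφ), map_nsmul, _root_.nsmul_eq_mul]
    exact hval
  · rw [hmp]
    exact hmin

theorem IsCase2b.degData_add (hc : IsCase2b u f F l z βbar) (D : DegData F l) (t : ℕ) :
    DegData F (l + t) ∧ (F.Q (l + t)).degree = (F.Q l).degree := by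
  have hdeg : ∀ t : ℕ, (F.Q (l + t) - F.Q l).degree < (F.Q l).degree := fun t => by
    rw [hc.Q_eq]
    choose g hg using (hc.inT t).homogeneous
    refine D.degree_partialSum_sub (u := u) (n := f.natDegree)
      (β := fun k => if h : k ≤ t then g k h else 0) fun k hk => ?_
    rw [dif_pos hk.le]
    exact hg k hk.le
  have hdeg' : ∀ t : ℕ, (F.Q (l + t)).degree = (F.Q l).degree := fun t => by
    have := degree_add_eq_left_of_degree_lt (hdeg t)
    rwa [_root_.add_sub_cancel] at this
  refine ⟨D.add_nat t (fun t _ => ?_) (fun t _ => natDegree_eq_of_degree_eq (hdeg' t))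
    fun t _ h => hc.α_eq t h, hdeg' t⟩
  have := (D.monic l le_rfl).add_of_left (hdeg t)
  rwa [_root_.add_sub_cancel] at this

theorem IsLimitCandidate.natDegree_eq [Fact p.Prime] (hG : IsLimitCandidate u f p F l βbar e₀ G)
    (hc : IsCase2b u f F l z βbar) (D : DegData F l) :
    G.Monic ∧ G.natDegree = p ^ e₀ * (F.Q l).natDegree := by
  obtain ⟨t, c, hc1, hc2, -, rfl⟩ := hG.weaklyAffine
  obtain ⟨D', hdeg⟩ := hc.degData_add D t
  rw [← natDegree_eq_of_degree_eq hdeg]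
  exact monic_sum_mul_pow (D'.monic _ le_rfl) c _
    (fun j hj => D'.degree_expansion_lt (hc1 j hj.le)) hc2

end Core

end KeyPoly

namespace KeyPoly

/-! ### The non-special step. -/

section Lift

variable {K : Type*} [Field K] {Γ : Type*} [AddCommGroup Γ] [LinearOrder Γ]
  [IsOrderedAddMonoid Γ] {φ : Γ →+o ℝ} {hφ : Function.Injective φ}
  {u : AddValuation K[X] (WithTop Γ)} {F : Family K} {l : Ordinal.{0}} {n : ℕ} {f h a : K[X]}
  {s : ℝ}

theorem IsExpansion.exists_homogeneous (hh : IsExpansion u F n l h) {b : Γ} (hb : u h = b) :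
    ∃ S, IsHomogeneous u F n l b S ∧ (b : WithTop Γ) < u (h - S) := by
  obtain ⟨B, T, hT, rfl⟩ := hh
  have hB : B.Nonempty := by
    by_contra hB
    rw [Finset.not_nonempty_iff_eq_empty] at hB
    rw [hB, Finset.sum_empty, u.map_zero] at hb
    exact WithTop.top_ne_coe hb
  have hval : ∀ b ∈ B, u (T b) = b := fun b hb => (hT b hb).val_eq
  have hmin : B.min' hB = b := by
    rwa [val_sum_eq_min hval hB, WithTop.coe_inj] at hb
  have hm : b ∈ B := hmin ▸ B.min'_mem hB
  refine ⟨T b, hT b hm, ?_⟩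
  rw [← Finset.add_sum_erase _ _ hm, add_sub_cancel_left]
  refine u.map_lt_sum WithTop.coe_ne_top fun x hx => ?_
  rw [hval x (Finset.mem_of_mem_erase hx), WithTop.coe_lt_coe, ← hmin]
  exact B.min'_lt_of_mem_erase_min' hB (hmin ▸ hx)

theorem IsLifting.pos (hQ : IsLifting u f F l) : 0 < F.α (l + 1) := by
  refine Nat.pos_of_ne_zero fun h0 => ?_
  have h1 := hQ.vanish
  obtain ⟨c, -, hc⟩ := hQ.exists_eq
  rw [hc, h0, zero_nsmul, Finset.range_zero, Finset.sum_empty, pow_zero, _root_.add_zero,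
    u.map_one] at h1
  exact lt_irrefl _ h1

/-- Polynomials of degree less than `deg Q_{l+1}` have the value given by their expansion in powers
of `Q_l`. -/
theorem IsLifting.exists_top (hQ : IsLifting u f F l)
    (hkey : KeyPair (realVal φ hφ u) (F.Q l) s) (hs : realVal φ hφ u (F.Q l) = s)
    (hexp : ∀ h : K[X], h.degree < (F.Q l).degree → IsExpansion u F f.natDegree l h)
    (ha : a ≠ 0) (hdeg : a.natDegree < F.α (l + 1) * (F.Q l).natDegree) :
    ∃ (c : ℝ) (r : ℕ), Top (realVal φ hφ u) (F.Q l) s c r a ∧ realVal φ hφ u a = c := by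
  obtain ⟨c, r, hT⟩ := hkey.exists_top ha
  refine ⟨c, r, hT, (not_lt.1 fun hlt => ?_).antisymm (hkey.coe_le hT.1)⟩
  have hmon := hkey.monic
  obtain ⟨g, hg, rfl⟩ := exists_of_realVal_eq hs
  obtain ⟨b, hb, hbc⟩ := exists_of_realVal_eq hT.digit_eq
  have hc : c = φ (b + r • g) := by
    rw [map_add, map_nsmul, hbc, _root_.nsmul_eq_mul]
    ring
  subst hc
  rw [coe_lt_realVal] at hlt
  set β := b + r • g with hβ
  have hge : ∀ j, (β : WithTop Γ) ≤ u (digit (F.Q l) a j * F.Q l ^ j) := fun j => by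
    rw [← coe_le_realVal (hφ := hφ)]
    refine coe_le_trans (coe_le_mul (hT.1 j).1 (coe_le_pow hs.ge j)) (by linarith)
  -- Minimality concerns sums of monomials of prescribed value. Each digit attaining the minimum is
  -- replaced by its leading homogeneous part, the others by 0; the change has value greater than β.
  have hd : ∀ j, ∃ d : K[X], (∃ s : Multiset K[X], d = s.sum ∧
      ∀ m ∈ s, (∃ (a : K) (γ : Ordinal.{0} →₀ ℕ), (∀ i, γ i ≠ 0 → i < l) ∧ m = mon F a γ) ∧
        u m + j • u (F.Q l) = (β : WithTop Γ)) ∧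
      (u (digit (F.Q l) a j) + j • u (F.Q l) = β → u d + j • u (F.Q l) = β) ∧
      (β : WithTop Γ) < u ((digit (F.Q l) a j - d) * F.Q l ^ j) := by
    intro j
    by_cases heq : u (digit (F.Q l) a j) + j • u (F.Q l) = β
    · cases hx : u (digit (F.Q l) a j) with
      | top =>
        rw [hx, top_add] at heq
        exact absurd heq WithTop.top_ne_coe
      | coe x =>
        rw [hx] at heq
        obtain ⟨S, hS, hS'⟩ := (hexp _ (degree_digit_lt hmon a j)).exists_homogeneous hx
        refine ⟨S, ?_, fun _ => by rw [hS.val_eq, heq], ?_⟩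
        · obtain ⟨t, ht, hsum, -⟩ := hS
          refine ⟨t, hsum, fun m hm => ⟨?_, by rw [(ht m hm).2, heq]⟩⟩
          obtain ⟨e, γ, hγ, h0, rfl⟩ := (ht m hm).1
          refine ⟨e, γ, fun i hi => lt_of_le_of_ne (hγ.support_le i hi) ?_, rfl⟩
          rintro rfl
          exact hi h0
        · rw [u.map_mul, u.map_pow, ← heq, hg]
          exact WithTop.add_lt_add_right (WithTop.coe_ne_top (a := j • g)) hS'
    · refine ⟨0, ⟨0, by simp, by simp⟩, fun h => absurd h heq, ?_⟩
      rw [_root_.sub_zero]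
      refine lt_of_le_of_ne (hge j) fun h => heq ?_
      rw [h, u.map_mul, u.map_pow]
  choose d hd1 hd2 hd3 using hd
  have hr : r < F.α (l + 1) := by
    by_contra hle
    rw [digit_eq_zero hmon, u.map_zero] at hb
    · exact WithTop.top_ne_coe hb
    · exact hdeg.trans_le (Nat.mul_le_mul_right _ (not_lt.1 hle))
  refine hQ.minimal β d (fun j _ => hd1 j) ⟨r, hr, hd2 r ?_⟩ ?_
  · rw [hb, hg, ← WithTop.coe_nsmul, ← WithTop.coe_add]
  · have h1 : (β : WithTop Γ) < u (∑ j ∈ Finset.range (F.α (l + 1)),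
        (digit (F.Q l) a j - d j) * F.Q l ^ j) :=
      u.map_lt_sum WithTop.coe_ne_top fun j _ => hd3 j
    simp_rw [sub_mul] at h1
    rw [Finset.sum_sub_distrib, sum_digit hmon hdeg] at h1
    have h2 := u.map_lt_add hlt (u.map_sub_swap _ _ ▸ h1)
    rwa [_root_.add_sub_cancel] at h2

theorem IsLifting.monic (hQ : IsLifting u f F l) (D : DegData F l) :
    (F.Q (l + 1)).Monic ∧ (F.Q (l + 1)).natDegree = F.α (l + 1) * (F.Q l).natDegree := by
  obtain ⟨c, hc, hsum⟩ := hQ.exists_eq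
  set α := F.α (l + 1) with hα
  have := monic_sum_mul_pow (D.monic l le_rfl) (fun j => if j = α then 1 else c j) α
    (fun j hj => by
      rw [if_neg hj.ne]
      rcases hc j hj with h | ⟨β, h, -⟩
      · rw [h, degree_zero]
        exact bot_lt_iff_ne_bot.2 (degree_ne_bot.2 (D.monic l le_rfl).ne_zero)
      · exact D.degree_homogeneous_lt h) (if_pos rfl)
  have heq : F.Q (l + 1) =
      ∑ j ∈ Finset.range (α + 1), (if j = α then 1 else c j) * F.Q l ^ j := by
    rw [hsum, Finset.sum_range_succ, if_pos rfl, one_mul, _root_.add_comm]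
    congr 1
    refine Finset.sum_congr rfl fun j hj => ?_
    rw [if_neg (Finset.mem_range.1 hj).ne]
  rwa [← heq] at this

theorem IsLifting.degData (hQ : IsLifting u f F l) (D : DegData F l) : DegData F (l + 1) := by
  obtain ⟨h1, h2⟩ := hQ.monic D
  exact D.step h1 h2.ge (h2 ▸ Nat.le_mul_of_pos_left _ hQ.pos)

theorem IsLifting.top (hQ : IsLifting u f F l) (D : DegData F l)
    (hkey : KeyPair (realVal φ hφ u) (F.Q l) s) (hs : realVal φ hφ u (F.Q l) = s) :
    Top (realVal φ hφ u) (F.Q l) s (F.α (l + 1) * s) (F.α (l + 1)) (F.Q (l + 1)) := by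
  obtain ⟨hm, hdeg⟩ := hQ.monic D
  obtain ⟨c, hc, hsum⟩ := hQ.exists_eq
  set v := realVal φ hφ u with hv
  set α := F.α (l + 1) with hα
  have hmon := hkey.monic
  refine top_of_digit_eq ?_ ?_
  · rw [hsum]
    refine InG.add hmon ?_ (InG.sum hmon fun j hj => ?_)
    · have h1 : (1 : K[X]).degree < (F.Q l).degree := by
        rw [degree_one]
        exact natDegree_pos_iff_degree_pos.1 hkey.pos
      have := inG_mul_pow (v := v) (s := s) (c := α * s) (S := Set.Iic α) hmon h1 (i := α)
        (by rw [_root_.sub_self, v.map_one]; rfl) (fun h => absurd (Set.mem_Iic.2 le_rfl) h)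
      rwa [one_mul] at this
    · rw [Finset.mem_range] at hj
      rcases hc j hj with h | ⟨β, h, hβ⟩
      · rw [h, zero_mul]
        exact inG_zero hmon
      · refine inG_mul_pow hmon (D.degree_homogeneous_lt h) ?_
          fun h => absurd (Set.mem_Iic.2 hj.le) h
        obtain ⟨g, hg, rfl⟩ := exists_of_realVal_eq hs
        rw [hg, ← WithTop.coe_nsmul, ← WithTop.coe_nsmul, ← WithTop.coe_add, WithTop.coe_inj] at hβ
        rw [realVal_eq_coe.2 h.val_eq, WithTop.coe_le_coe]
        have := congrArg φ hβ
        rw [map_add, map_nsmul, map_nsmul, _root_.nsmul_eq_mul, _root_.nsmul_eq_mul] at this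
        linarith
  · rw [digit_natDegree_eq_one hmon hkey.pos hm hdeg, _root_.sub_self, v.map_one]
    rfl

/-- Along Q_l, the polynomial Q_{l+1} has top index α_{l+1}, yet its value exceeds α_{l+1} v(Q_l);
below its degree, values are Gauss values. This is the setting of `KeyPair.mul_lt_of_top`. -/
theorem IsLifting.keyPair (hQ : IsLifting u f F l) (D : DegData F l)
    (hkey : KeyPair (realVal φ hφ u) (F.Q l) s) (hs : realVal φ hφ u (F.Q l) = s)
    (hexp : ∀ h : K[X], h.degree < (F.Q l).degree → IsExpansion u F f.natDegree l h) {t : ℝ}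
    (ht : realVal φ hφ u (F.Q (l + 1)) = t) : KeyPair (realVal φ hφ u) (F.Q (l + 1)) t := by
  obtain ⟨hm, hdeg⟩ := hQ.monic D
  have hT := hQ.top D hkey hs
  have hα := hQ.pos
  have hst : F.α (l + 1) * s < t := by
    obtain ⟨g, hg, rfl⟩ := exists_of_realVal_eq hs
    have h1 := hQ.vanish
    rw [hg, ← WithTop.coe_nsmul, ← coe_lt_realVal (hφ := hφ), ht, WithTop.coe_lt_coe, map_nsmul,
      _root_.nsmul_eq_mul] at h1
    exact h1
  have key : ∀ a : K[X], a ≠ 0 → a.natDegree < (F.Q (l + 1)).natDegree →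
      ∃ (c : ℝ) (r : ℕ), Top (realVal φ hφ u) (F.Q l) s c r a ∧ realVal φ hφ u a = c :=
    fun a ha hda => hQ.exists_top hkey hs hexp ha (hdeg ▸ hda)
  refine ⟨hm, (hQ.degData D).pos _ le_rfl, ht.ge, fun a ha hda => ?_, fun a b ha hb hda hdb => ?_⟩
  · obtain ⟨c, r, -, h⟩ := key a ha (natDegree_lt_natDegree ha hda)
    rw [h]
    exact WithTop.coe_ne_top
  · have hda' := natDegree_lt_natDegree ha hda
    have hdb' := natDegree_lt_natDegree hb hdb
    obtain ⟨ca, ra, hTa, hva⟩ := key a ha hda'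
    obtain ⟨cb, rb, hTb, hvb⟩ := key b hb hdb'
    refine hkey.mul_lt_of_top hm hdeg hα hT hst hTa.inG hva hTb.inG hvb fun hq => key _ hq ?_
    rw [natDegree_divByMonic _ hm, natDegree_mul ha hb]
    omega

end Lift

/-! ### Induction over the construction. -/

section Stage

variable {K : Type*} [Field K] {Γ : Type*} [AddCommGroup Γ] [LinearOrder Γ]
  [IsOrderedAddMonoid Γ] {φ : Γ →+o ℝ} {hφ : Function.Injective φ}
  {u : AddValuation K[X] (WithTop Γ)} {F : Family K} {l : Ordinal.{0}} {f : K[X]}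
  {z : ℕ → K[X]} {βbar : Γ} {p e₀ m : ℕ}

theorem keyPair_X {s : ℝ} {v : AddValuation K[X] (WithTop ℝ)} (hs : v X = s)
    (hfin : ∀ a : K, a ≠ 0 → v (C a) ≠ ⊤) : KeyPair v X s := by
  have hC : ∀ a : K[X], a.degree < (X : K[X]).degree → ∃ b, a = C b := fun a ha => by
    refine ⟨a.coeff 0, eq_C_of_degree_le_zero ?_⟩
    rw [degree_X] at ha
    exact Order.le_of_lt_succ ha
  refine ⟨monic_X, by simp, hs.ge, fun a ha hda => ?_, fun a b ha hb hda hdb => ?_⟩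
  · obtain ⟨b, rfl⟩ := hC a hda
    exact hfin b fun h => ha (by rw [h, C_0])
  · obtain ⟨a, rfl⟩ := hC a hda
    obtain ⟨b, rfl⟩ := hC b hdb
    rw [← C_mul, (divByMonic_eq_zero_iff monic_X).2, v.map_zero, top_add]
    · refine lt_top_iff_ne_top.2 (hfin _ fun h => ?_)
      rcases mul_eq_zero.1 h with h | h
      · exact ha (by rw [h, C_0])
      · exact hb (by rw [h, C_0])
    · rw [degree_X]
      exact degree_C_lt.trans_le le_rfl

theorem degData_zero (hQ : F.Q 0 = X) : DegData F 0 := by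
  have h0 : ∀ {i : Ordinal.{0}}, i ≤ 0 → i = 0 := fun {i} h => le_antisymm h zero_le
  refine ⟨fun i hi => ?_, fun i hi => ?_, fun i j hij hj => ?_, fun i hi => ?_, fun i hi => ?_⟩
  · rw [h0 hi, hQ]
    exact monic_X
  · rw [h0 hi, hQ, natDegree_X]
    exact one_pos
  · rw [h0 hj, h0 (hij.trans hj)]
  · exact absurd (h0 hi) (lt_of_le_of_lt zero_le (Order.lt_add_one_iff.2 le_rfl)).ne'
  · exact absurd (h0 hi) (lt_of_lt_of_le Ordinal.omega0_pos (le_add_of_nonneg_left zero_le)).ne'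

/-- Q_l is translated by terms of value at least v(Q_l), after which the slope may be raised to the
new value. -/
theorem InT.degData_keyPair (hT : InT u f F l z m) (D : DegData F l)
    (hkey : ∀ s : ℝ, realVal φ hφ u (F.Q l) = s → KeyPair (realVal φ hφ u) (F.Q l) s)
    (h0 : u (F.Q l) ≠ ⊤) (hQ : ∀ t ≤ m + 1, F.Q (l + (t : Ordinal.{0})) = partialSum F l z t)
    (hα : ∀ t ≤ m + 1, 0 < t → F.α (l + (t : Ordinal.{0})) = 1) :
    DegData F (l + ((m + 1 : ℕ) : Ordinal.{0})) ∧
      ∀ s : ℝ, realVal φ hφ u (F.Q (l + ((m + 1 : ℕ) : Ordinal.{0}))) = s →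
        KeyPair (realVal φ hφ u) (F.Q (l + ((m + 1 : ℕ) : Ordinal.{0}))) s := by
  choose b hb using hT.homogeneous
  have hdeg : ∀ t ≤ m + 1, (partialSum F l z t - F.Q l).degree < (F.Q l).degree := fun t ht => by
    refine D.degree_partialSum_sub (u := u) (n := f.natDegree)
      (β := fun k => if h : k ≤ m then b k h else 0) fun k hk => ?_
    rw [dif_pos (by omega)]
    exact hb k (by omega)
  have hge : ∀ k ≤ m, u (F.Q l) ≤ u (z k) := by
    intro k
    induction k with
    | zero => exact fun _ => hT.val_zero.ge
    | succ k ih => exact fun hk => (ih (by omega)).trans (hT.val_lt k (by omega)).le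
  have hle : u (F.Q l) ≤ u (partialSum F l z (m + 1) - F.Q l) := by
    rw [partialSum, add_sub_cancel_left]
    exact u.map_le_sum fun k hk => hge k (by rw [Finset.mem_range] at hk; omega)
  refine ⟨D.add_nat _ (fun t ht => ?_) (fun t ht => ?_) hα, fun s hs => ?_⟩
  · have := (D.monic l le_rfl).add_of_left (hdeg t ht)
    rwa [_root_.add_sub_cancel, ← hQ t ht] at this
  · have := degree_add_eq_left_of_degree_lt (hdeg t ht)
    rw [_root_.add_sub_cancel, ← hQ t ht] at this
    exact natDegree_eq_of_degree_eq this
  · rw [hQ _ le_rfl] at hs ⊢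
    obtain ⟨g, hg⟩ := WithTop.ne_top_iff_exists.1 h0
    have hv := realVal_eq_coe (hφ := hφ).2 hg.symm
    have h1 := (hkey _ hv).translate (hdeg (m + 1) le_rfl) (by
      rw [coe_le_realVal, hg]
      exact hle)
    rw [_root_.add_sub_cancel] at h1
    refine h1.mono ?_ hs.ge
    have h2 := h1.le
    rwa [hs, WithTop.coe_le_coe] at h2

/-- The critical case is a limit step: the minimal exponent e₀ is at most that of the candidate from
`IsCase2b.exists_candidate`, so no `Deep` degree lies below p ^ e₀ and `LimSeq.keyPair_of_deep`
applies to the chosen Q_{l+ω}. -/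
theorem IsStage.degData_keyPair [Fact p.Prime] [CharP K p] (hl : IsStage u f p F l)
    (huf : u f = ⊤) (hf0 : f ≠ 0) (hfin : ∀ a : K[X], a ≠ 0 → a.natDegree < f.natDegree → u a ≠ ⊤)
    (hf1 : 0 < f.natDegree)
    (hexp : ∀ i ≤ l, ∀ h : K[X], h = f ∨ h.natDegree < f.natDegree →
      HasStandardExpansion u F f.natDegree i h) :
    DegData F l ∧ ∀ s : ℝ, realVal φ hφ u (F.Q l) = s → KeyPair (realVal φ hφ u) (F.Q l) s := by
  induction hl with
  | zero hQ hα =>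
    refine ⟨degData_zero hQ, fun s hs => ?_⟩
    rw [hQ] at hs ⊢
    refine keyPair_X hs fun a ha => ?_
    rw [Ne, realVal_eq_top]
    exact hfin _ (C_ne_zero.2 ha) (by rwa [natDegree_C])
  | lift l hl h0 hs hQ ih =>
    obtain ⟨D, hkey⟩ := ih fun i hi => hexp i (hi.trans (Order.lt_add_one_iff.2 le_rfl).le)
    obtain ⟨g, hg⟩ := WithTop.ne_top_iff_exists.1 h0
    have hv := realVal_eq_coe (hφ := hφ).2 hg.symm
    exact ⟨hQ.degData D, fun s hs => hQ.keyPair D (hkey _ hv) hv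
      (fun h => D.isExpansion huf hf0 (hexp l (Order.lt_add_one_iff.2 le_rfl).le)) hs⟩
  | finite l z m hl hs hmax hQ hα ih =>
    obtain ⟨D, hkey⟩ := ih fun i hi => hexp i (hi.trans (le_add_of_nonneg_right zero_le))
    obtain ⟨g, -, hg, -⟩ := hs
    exact hmax.1.degData_keyPair D hkey (hg ▸ WithTop.coe_ne_top) hQ hα
  | limit l z βbar e₀ hl hc hQ hα ih =>
    have hlω : l ≤ l + ω := le_add_of_nonneg_right zero_le
    obtain ⟨D, hkey⟩ := ih fun i hi => hexp i (hi.trans hlω)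
    obtain ⟨γ, c, C⟩ := hc.exists_caseData D hkey hf0
    obtain ⟨e, G, hG, hmin⟩ := hc.exists_candidate (p := p) D C huf hf0 (hexp l hlω)
    have hle : p ^ e₀ ≤ p ^ e := Nat.pow_le_pow_right (Fact.out : p.Prime).pos (hQ.2 e G hG)
    obtain ⟨hm, hdeg⟩ := hQ.1.natDegree_eq hc D
    have hpos : 0 < p ^ e₀ := pow_pos (Fact.out : p.Prime).pos _
    have hD := hc.degData_add D
    have hdt : ∀ t : ℕ, (F.Q (l + t)).natDegree = (F.Q l).natDegree := fun t =>
      natDegree_eq_of_degree_eq (hD t).2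
    have Dω : DegData F (l + ω) := DegData.add_omega (fun t => (hD t).1) hm
      (fun t => by rw [hα, hdt, hdeg])
      (fun t => by rw [hdt, hdeg]; exact Nat.le_mul_of_pos_left _ hpos)
    refine ⟨Dω, fun s hs => ?_⟩
    have hn := Dω.natDegree_le (hexp _ le_rfl f (Or.inl rfl)) huf hf0
    refine C.limSeq.keyPair_of_deep hpos (fun r h0 hr => hmin r h0 (hr.trans_le hle)) ?_ hm ?_ ?_ hs
    · intro a ha hda
      rw [partialSum_zero, ← hdeg] at hda
      rw [Ne, realVal_eq_top]
      exact hfin a ha (hda.trans_le hn)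
    · rw [partialSum_zero, hdeg]
    · have := hQ.1.le_val
      rwa [← coe_le_realVal (hφ := hφ), map_nsmul, _root_.nsmul_eq_mul] at this

end Stage

end KeyPoly

theorem mainTheorem4 {K L Γ : Type*} [Field K] [Field L] [Algebra K L] [FiniteDimensional K L]
    [Algebra.IsSeparable K L] [AddCommGroup Γ] [LinearOrder Γ] [IsOrderedAddMonoid Γ]
    [Archimedean Γ] (p : ℕ) [Fact p.Prime] [CharP K p]
    (ν : AddValuation K (WithTop Γ)) (hν : ∃ a : K, a ≠ 0 ∧ ν a ≠ 0)
    (ν' : AddValuation L (WithTop Γ)) (hν' : ∀ a : K, ν' (algebraMap K L a) = ν a)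
    (x : L) (hx : IntermediateField.adjoin K {x} = ⊤)
    (hpos : ∀ i < (minpoly K x).natDegree, 0 < ν ((minpoly K x).coeff i))
    (F : KeyPoly.Family K) (l : Ordinal.{0})
    (hl : KeyPoly.IsStage (KeyPoly.polyVal ν' x) (minpoly K x) p F l)
    (hexp : ∀ i ≤ l, ∀ h : Polynomial K,
      (h = minpoly K x ∨ h.natDegree < (minpoly K x).natDegree) →
      KeyPoly.HasStandardExpansion (KeyPoly.polyVal ν' x) F (minpoly K x).natDegree i h)
    (z : ℕ → Polynomial K) (βbar : Γ)
    (hcase : KeyPoly.IsCase2b (KeyPoly.polyVal ν' x) (minpoly K x) F l z βbar) :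
    ∃ (e₀ : ℕ) (G : Polynomial K),
      KeyPoly.IsLimitKey (KeyPoly.polyVal ν' x) (minpoly K x) p F l βbar e₀ G := by
  classical
  obtain ⟨φ, hφ⟩ := Archimedean.exists_orderAddMonoidHom_real_injective Γ
  set u : AddValuation K[X] (WithTop Γ) := ν'.comap (aeval x).toRingHom with hu
  have huv : KeyPoly.polyVal ν' x = u := rfl
  rw [huv] at hl hexp hcase ⊢
  have hint : IsIntegral K x := Algebra.IsIntegral.isIntegral x
  have hutop : ∀ a : K[X], u a = ⊤ ↔ aeval x a = 0 := fun a => ν'.top_iff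
  have hf0 := minpoly.ne_zero hint
  have huf : u (minpoly K x) = ⊤ := (hutop _).2 (minpoly.aeval K x)
  have hfin : ∀ a : K[X], a ≠ 0 → a.natDegree < (minpoly K x).natDegree → u a ≠ ⊤ :=
    fun a ha hda h => absurd (natDegree_le_natDegree
      (minpoly.degree_le_of_ne_zero K x ha ((hutop a).1 h))) (not_le.2 hda)
  obtain ⟨D, hkey⟩ := hl.degData_keyPair (hφ := hφ) huf hf0 hfin (minpoly.natDegree_pos hint) hexp
  obtain ⟨γ, c, C⟩ := hcase.exists_caseData D hkey hf0
  obtain ⟨e, G, hG, -⟩ := hcase.exists_candidate (p := p) D C huf hf0 (hexp l le_rfl)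
  -- Any candidate suffices; the least exponent is then selected among all of them.
  have hex : ∃ e₀ G, KeyPoly.IsLimitCandidate u (minpoly K x) p F l βbar e₀ G := ⟨e, G, hG⟩
  obtain ⟨G₀, hG₀⟩ := Nat.find_spec hex
  exact ⟨_, G₀, hG₀, fun e₁ G' hG' => Nat.find_min' hex ⟨G', hG'⟩⟩
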